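/- Let $\mathcal X=(X,g,\xi)$ be a connected Sasakian manifold of dimension $2m+1$, $m\ge 1$: $\xi$ is a Killing field of length one and $\Phi(v)=-\nabla_v\xi$ satisfies $(\nabla_v\Phi)(w)=g(v,w)\xi-g(\xi,w)v$. Put $F=\xi^\perp$, $F^{1,0}=\{v-\sqrt{-1}\,\Phi(v)\mid v\in F\}$, $F^{0,1}=\overline{F^{1,0}}$ and $\mathcal F^{0,1}=F^{0,1}\oplus\mathbb C\xi$. Let $G$ be a connected complex Lie group and $H\subset G$ a complex Lie subgroup. A holomorphic principal $H$-bundle on $\mathcal X$ is a $C^\infty$ principal $H$-bundle $p:E_H\to X$, with a complex structure $J_E$ on its fibres for which the action on each fibre is holomorphic, a partial connection $\widetilde\xi$ on $E_H$ along $\mathbb R\xi$ preserving $J_E$, and an $H$-invariant integrable complex distribution $\widetilde{\mathcal F}\supset\widetilde\xi$ of rank $m+1$ on $E_H$ that $dp$ maps isomorphically to $p^*\mathcal F^{0,1}$ and for which $\widetilde{\mathcal F}\oplus\mathbb K^{0,1}$ is integrable, where $\mathbb K^{1,0}$ and $\mathbb K^{0,1}$ are the subbundles of types $(1,0)$ and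 $(0,1)$ of $\ker(dp)\otimes\mathbb C$. With $\mathbb F\subset\widetilde{\mathcal F}$ the part over $F^{0,1}$, put $\mathrm{ad}(\mathcal E_H)=\mathbb K^{1,0}/H$ and $\mathrm{At}(\mathcal E_H)=(\mathbb K^{1,0}\oplus\overline{\mathbb F})/H$; these and $F^{1,0}$ are holomorphic vector bundles on $\mathcal X$, their partial connections along $\mathcal F^{0,1}$ being given by the Lie bracket, and $dp$ induces the Atiyah sequence $0\to\mathrm{ad}(\mathcal E_H)\xrightarrow{\iota_2}\mathrm{At}(\mathcal E_H)\xrightarrow{d'p}F^{1,0}\to 0$. A holomorphic homomorphism of such bundles is a $C^\infty$ fibrewise $\mathbb C$-linear map that intertwines the partial connections along $\mathcal F^{0,1}$; a holomorphic connection is a holomorphic homomorphism $D:F^{1,0}\to\mathrm{At}$ with $d'p\circ D=\mathrm{Id}$. Let $\mathcal E_G$ be the holomorphic principal $G$-bundle obtained from $\mathcal E_H$ by extension of structure group along $H\hookrightarrow G$, let $j:E_H\to E_G$ be the canonical map, $j_*:\mathrm{At}(\mathcal E_H)\to\mathrm{At}(\mathcal E_G)$ and $\iota_1:\mathrm{ad}(\mathcal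 E_H)\to\mathrm{ad}(\mathcal E_G)$ the homomorphisms induced by $dj$, and $0\to\mathrm{ad}(\mathcal E_G)\xrightarrow{\iota'}\mathrm{At}(\mathcal E_G)\xrightarrow{d'p'}F^{1,0}\to 0$ the Atiyah sequence of $\mathcal E_G$. Let $(\mathcal E_H,\varphi)$ be a branched holomorphic Cartan geometry of type $(G,H)$ on $\mathcal X$, that is, $\varphi:\mathrm{At}(\mathcal E_H)\to\mathrm{ad}(\mathcal E_G)$ is a holomorphic homomorphism that is an isomorphism over a nonempty subset of $X$ and satisfies $\varphi\circ\iota_2=\iota_1$. Then $\mathcal E_G$ has a natural holomorphic connection given by $\varphi$. Precisely: $\alpha(v,w)=\iota'(v)+j_*(w)$ defines a surjective holomorphic homomorphism $\alpha:\mathrm{ad}(\mathcal E_G)\oplus\mathrm{At}(\mathcal E_H)\to\mathrm{At}(\mathcal E_G)$ with kernel $\{(\iota_1(u),-\iota_2(u))\mid u\in\mathrm{ad}(\mathcal E_H)\}$; there is a unique holomorphic homomorphism $\beta':\mathrm{At}(\mathcal E_G)\to\mathrm{ad}(\mathcal E_G)$ with $\beta'(\alpha(v,w))=v+\varphi(w)$,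 and it satisfies $\beta'\circ\iota'=\mathrm{Id}$; and there is a unique holomorphic connection $D:F^{1,0}\to\mathrm{At}(\mathcal E_G)$ with $\iota'\circ\beta'+D\circ d'p'=\mathrm{Id}_{\mathrm{At}(\mathcal E_G)}$. -/

import Mathlib

open scoped Manifold ContDiff TensorProduct

noncomputable section

namespace BranchedCartan

/-! ## Complexified tangent spaces, complex vector fields and complex distributions -/

section Complexification

variable {V W : Type*} [AddCommGroup V] [Module ℝ V] [AddCommGroup W] [Module ℝ W]

/-- The real part `ℂ ⊗ V → V`. -/
def cRe : ℂ ⊗[ℝ] V →ₗ[ℝ] V :=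
  (TensorProduct.lid ℝ V).toLinearMap ∘ₗ LinearMap.rTensor V Complex.reLm

/-- The imaginary part `ℂ ⊗ V → V`. -/
def cIm : ℂ ⊗[ℝ] V →ₗ[ℝ] V :=
  (TensorProduct.lid ℝ V).toLinearMap ∘ₗ LinearMap.rTensor V Complex.imLm

/-- Complex conjugation on `ℂ ⊗ V`. -/
def cConj : ℂ ⊗[ℝ] V →ₗ[ℝ] ℂ ⊗[ℝ] V :=
  LinearMap.rTensor V Complex.conjAe.toLinearMap

/-- The complex conjugate of a complex subspace of `ℂ ⊗ V`. -/
def conjSubmodule (D : Submodule ℂ (ℂ ⊗[ℝ] V)) : Submodule ℂ (ℂ ⊗[ℝ] V) :=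
  Submodule.span ℂ (cConj '' (D : Set (ℂ ⊗[ℝ] V)))

end Complexification

section Distributions

variable {E : Type*} [NormedAddCommGroup E] [NormedSpace ℝ E]
  {M : Type*} [TopologicalSpace M] [ChartedSpace E M]
  {E' : Type*} [NormedAddCommGroup E'] [NormedSpace ℝ E']
  {M' : Type*} [TopologicalSpace M'] [ChartedSpace E' M']

variable (E) in
/-- The complexified tangent space `T_x M ⊗ ℂ`. -/
abbrev CTan (x : M) : Type _ := ℂ ⊗[ℝ] TangentSpace 𝓘(ℝ, E) x

/-- The complexified differential `df ⊗ ℂ` at `x`. -/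
def cdiff (E E' : Type*) [NormedAddCommGroup E] [NormedSpace ℝ E]
    [NormedAddCommGroup E'] [NormedSpace ℝ E']
    {M : Type*} [TopologicalSpace M] [ChartedSpace E M]
    {M' : Type*} [TopologicalSpace M'] [ChartedSpace E' M']
    (f : M → M') (x : M) : CTan E x →ₗ[ℂ] CTan E' (f x) :=
  LinearMap.baseChange ℂ (mfderiv 𝓘(ℝ, E) 𝓘(ℝ, E') f x).toLinearMap

/-- The Lie bracket of real vector fields, extended `ℂ`-bilinearly to sections of `TM ⊗ ℂ`. -/
def cBracket (A B : ∀ x : M, CTan E x) (x : M) : CTan E x :=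
  (1 : ℂ) ⊗ₜ[ℝ]
      (VectorField.mlieBracket 𝓘(ℝ, E) (fun y => cRe (A y)) (fun y => cRe (B y)) x
        - VectorField.mlieBracket 𝓘(ℝ, E) (fun y => cIm (A y)) (fun y => cIm (B y)) x)
    + Complex.I ⊗ₜ[ℝ]
      (VectorField.mlieBracket 𝓘(ℝ, E) (fun y => cRe (A y)) (fun y => cIm (B y)) x
        + VectorField.mlieBracket 𝓘(ℝ, E) (fun y => cIm (A y)) (fun y => cRe (B y)) x)

variable [IsManifold 𝓘(ℝ, E) ∞ M]

/-- `A` is a `C^∞` real vector field over `U`. -/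
def SmoothVF (U : Set M) (A : ∀ x : M, TangentSpace 𝓘(ℝ, E) x) : Prop :=
  ContMDiffOn 𝓘(ℝ, E) 𝓘(ℝ, E).tangent ∞
    (fun x => (⟨x, A x⟩ : TangentBundle 𝓘(ℝ, E) M)) U

/-- `A` is differentiable at `x`, as a section of the tangent bundle. -/
def DiffVFAt (A : ∀ x : M, TangentSpace 𝓘(ℝ, E) x) (x : M) : Prop :=
  MDifferentiableAt 𝓘(ℝ, E) 𝓘(ℝ, E).tangent
    (fun x => (⟨x, A x⟩ : TangentBundle 𝓘(ℝ, E) M)) x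

/-- `A` is a `C^∞` section of `TM ⊗ ℂ` over `U`. -/
def SmoothCVF (U : Set M) (A : ∀ x : M, CTan E x) : Prop :=
  SmoothVF U (fun x => cRe (A x)) ∧ SmoothVF U (fun x => cIm (A x))

/-- `D` is a `C^∞` distribution of rank `r`: a smooth subbundle of `TM` (local frames). -/
def IsSmoothDistribution (D : ∀ x : M, Submodule ℝ (TangentSpace 𝓘(ℝ, E) x)) (r : ℕ) : Prop :=
  ∀ x₀ : M, ∃ U : Set M, IsOpen U ∧ x₀ ∈ U ∧
    ∃ e : Fin r → ∀ x : M, TangentSpace 𝓘(ℝ, E) x,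
      (∀ i, SmoothVF U (e i)) ∧
      ∀ x ∈ U, LinearIndependent ℝ (fun i => e i x) ∧
        Submodule.span ℝ (Set.range fun i => e i x) = D x

/-- `D` is a `C^∞` complex distribution of complex rank `r`: a smooth subbundle of `TM ⊗ ℂ`. -/
def IsSmoothCDistribution (D : ∀ x : M, Submodule ℂ (CTan E x)) (r : ℕ) : Prop :=
  ∀ x₀ : M, ∃ U : Set M, IsOpen U ∧ x₀ ∈ U ∧
    ∃ e : Fin r → ∀ x : M, CTan E x,
      (∀ i, SmoothCVF U (e i)) ∧
      ∀ x ∈ U, LinearIndependent ℂ (fun i => e i x) ∧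
        Submodule.span ℂ (Set.range fun i => e i x) = D x

/-- The complex distribution `D` is integrable: its local `C^∞` sections are closed under the
Lie bracket. -/
def IsIntegrable (D : ∀ x : M, Submodule ℂ (CTan E x)) : Prop :=
  ∀ U : Set M, IsOpen U → ∀ A B : ∀ x : M, CTan E x, SmoothCVF U A → SmoothCVF U B →
    (∀ x ∈ U, A x ∈ D x) → (∀ x ∈ U, B x ∈ D x) → ∀ x ∈ U, cBracket A B x ∈ D x

end Distributions

/-! ## Sasakian manifolds -/

section Sasakian

variable (E : Type*) [NormedAddCommGroup E] [NormedSpace ℝ E] [FiniteDimensional ℝ E]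
  (X : Type*) [TopologicalSpace X] [ChartedSpace E X] [IsManifold 𝓘(ℝ, E) ∞ X]

/-- A Riemannian metric `g` on `X`, its Levi-Civita connection `∇` and a unit Killing field `ξ`
such that `Φ = -∇ξ` satisfies `(∇_v Φ)(w) = g(v, w) ξ - g(ξ, w) v`; here `dim X = 2m + 1`, `m > 0`.
Mathlib writes `∇_v Y` at `x` as `nabla Y x v`. -/
structure SasakianStructure (m : ℕ) where
  m_pos : 0 < m
  finrank_eq : Module.finrank ℝ E = 2 * m + 1
  /-- the Riemannian metric -/
  g : Bundle.ContMDiffRiemannianMetric 𝓘(ℝ, E) ∞ E (fun x : X => TangentSpace 𝓘(ℝ, E) x)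
  /-- the Levi-Civita connection, the torsion-free metric connection -/
  nabla : CovariantDerivative 𝓘(ℝ, E) E (fun x : X => TangentSpace 𝓘(ℝ, E) x)
  nabla_torsion : ∀ (Y Z : ∀ x : X, TangentSpace 𝓘(ℝ, E) x) (x : X),
    DiffVFAt Y x → DiffVFAt Z x →
      nabla Z x (Y x) - nabla Y x (Z x) = VectorField.mlieBracket 𝓘(ℝ, E) Y Z x
  nabla_metric : ∀ (Y Z : ∀ x : X, TangentSpace 𝓘(ℝ, E) x) (x : X) (v : TangentSpace 𝓘(ℝ, E) x),
    DiffVFAt Y x → DiffVFAt Z x →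
      mfderiv 𝓘(ℝ, E) 𝓘(ℝ, ℝ) (fun y => g.inner y (Y y) (Z y)) x v
        = g.inner x (nabla Y x v) (Z x) + g.inner x (Y x) (nabla Z x v)
  /-- the Reeb vector field -/
  xi : ∀ x : X, TangentSpace 𝓘(ℝ, E) x
  xi_smooth : SmoothVF Set.univ xi
  xi_unit : ∀ x, g.inner x (xi x) (xi x) = 1
  /-- `ξ` is Killing: the Lie derivative `L_ξ g` vanishes. -/
  xi_killing : ∀ (Y Z : ∀ x : X, TangentSpace 𝓘(ℝ, E) x) (x : X),
    DiffVFAt Y x → DiffVFAt Z x →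
      mfderiv 𝓘(ℝ, E) 𝓘(ℝ, ℝ) (fun y => g.inner y (Y y) (Z y)) x (xi x)
        = g.inner x (VectorField.mlieBracket 𝓘(ℝ, E) xi Y x) (Z x)
          + g.inner x (Y x) (VectorField.mlieBracket 𝓘(ℝ, E) xi Z x)
  nabla_Phi : ∀ (W : ∀ x : X, TangentSpace 𝓘(ℝ, E) x) (x : X) (v : TangentSpace 𝓘(ℝ, E) x),
    DiffVFAt W x →
      nabla (fun y => -(nabla xi y (W y))) x v - (-(nabla xi x (nabla W x v)))
        = g.inner x v (W x) • xi x - g.inner x (xi x) (W x) • v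

variable {E X} {m : ℕ} (S : SasakianStructure E X m)

namespace SasakianStructure

/-- `Φ(v) = -∇_v ξ`. -/
def Phi (x : X) : TangentSpace 𝓘(ℝ, E) x →ₗ[ℝ] TangentSpace 𝓘(ℝ, E) x :=
  -(S.nabla S.xi x).toLinearMap

/-- `F = ξ^⊥`. -/
def F (x : X) : Submodule ℝ (TangentSpace 𝓘(ℝ, E) x) :=
  LinearMap.ker (S.g.inner x (S.xi x)).toLinearMap

/-- `F^{0,1} = {v + √-1 Φ(v)}`. -/
def F01 (x : X) : Submodule ℂ (CTan E x) :=
  Submodule.span ℂ {w | ∃ v ∈ S.F x, w = (1 : ℂ) ⊗ₜ[ℝ] v + Complex.I ⊗ₜ[ℝ] S.Phi x v}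

/-- `F^{1,0} = {v - √-1 Φ(v)}`. -/
def F10 (x : X) : Submodule ℂ (CTan E x) :=
  Submodule.span ℂ {w | ∃ v ∈ S.F x, w = (1 : ℂ) ⊗ₜ[ℝ] v - Complex.I ⊗ₜ[ℝ] S.Phi x v}

/-- `𝓕^{0,1} = F^{0,1} ⊕ ℂ ξ`. -/
def calF01 (x : X) : Submodule ℂ (CTan E x) :=
  S.F01 x ⊔ Submodule.span ℂ {(1 : ℂ) ⊗ₜ[ℝ] S.xi x}

end SasakianStructure

end Sasakian

/-! ## Holomorphic vector bundles over a Sasakian manifold and their homomorphisms -/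

section Bundles

variable {E : Type*} [NormedAddCommGroup E] [NormedSpace ℝ E] [FiniteDimensional ℝ E]
  {X : Type*} [TopologicalSpace X] [ChartedSpace E X] [IsManifold 𝓘(ℝ, E) ∞ X]

/-- The data through which a smooth complex vector bundle with a partial connection along
`𝓕^{0,1}` is used: its fibres, its `C^∞` sections over open sets `U`, and the relation
`IsDerivAt U v s x t`, saying that the derivative of the section `s` along the section `v` of
`𝓕^{0,1}` over `U` has value `t` at `x ∈ U`. It is only ever instantiated by the
explicit bundles below. -/
structure PartialBundle (E : Type*) [NormedAddCommGroup E] [NormedSpace ℝ E]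
    (X : Type*) [TopologicalSpace X] [ChartedSpace E X] where
  Fiber : X → Type*
  [addCommGroup : ∀ x, AddCommGroup (Fiber x)]
  [module : ∀ x, Module ℂ (Fiber x)]
  IsSmoothOn : Set X → (∀ x, Fiber x) → Prop
  IsDerivAt : Set X → (∀ x : X, CTan E x) → (∀ x, Fiber x) → ∀ x, Fiber x → Prop

attribute [instance] PartialBundle.addCommGroup PartialBundle.module

/-- The direct sum of two bundles. -/
def PartialBundle.prod (W₁ W₂ : PartialBundle E X) : PartialBundle E X where
  Fiber x := W₁.Fiber x × W₂.Fiber x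
  IsSmoothOn U s := W₁.IsSmoothOn U (fun x => (s x).1) ∧ W₂.IsSmoothOn U (fun x => (s x).2)
  IsDerivAt U v s x t :=
    W₁.IsDerivAt U v (fun y => (s y).1) x t.1 ∧ W₂.IsDerivAt U v (fun y => (s y).2) x t.2

variable {m : ℕ} (S : SasakianStructure E X m)

/-- A holomorphic homomorphism of vector bundles: fibrewise `ℂ`-linear, `C^∞` (it takes local
`C^∞` sections to `C^∞` sections), and intertwining the partial connections along `𝓕^{0,1}`. -/
structure HolHom (W₁ W₂ : PartialBundle E X) where
  toFun : ∀ x, W₁.Fiber x →ₗ[ℂ] W₂.Fiber x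
  smooth : ∀ U : Set X, IsOpen U → ∀ s : ∀ x, W₁.Fiber x, W₁.IsSmoothOn U s →
    W₂.IsSmoothOn U (fun x => toFun x (s x))
  intertwines : ∀ U : Set X, IsOpen U → ∀ s : ∀ x, W₁.Fiber x, W₁.IsSmoothOn U s →
    ∀ v : ∀ x : X, CTan E x, SmoothCVF U v → (∀ x ∈ U, v x ∈ S.calF01 x) →
    ∀ x ∈ U, ∀ t : W₁.Fiber x, W₁.IsDerivAt U v s x t →
      W₂.IsDerivAt U v (fun y => toFun y (s y)) x (toFun x t)

/-- The holomorphic vector bundle `F^{1,0}`; the derivative of `s` along `v` is the component in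
`F^{1,0}` of the Lie bracket `[v, s]` (with respect to `TX ⊗ ℂ = F^{1,0} ⊕ 𝓕^{0,1}`). -/
def SasakianStructure.F10Bundle : PartialBundle E X where
  Fiber x := S.F10 x
  IsSmoothOn U s := SmoothCVF U (fun x => (s x : CTan E x))
  IsDerivAt _ v s x t :=
    cBracket v (fun y => (s y : CTan E y)) x - (t : CTan E x) ∈ S.calF01 x

end Bundles

/-! ## Principal bundles -/

/-- `C^∞` principal `H`-bundle `P → X` with a right action of `H`, locally equivariantly
diffeomorphic to `U × H` (`σ` is a section over `U`, and `τ` the component in `H`).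
The complex Lie group `H`, modelled on the complex vector space `V`, is regarded
as a real manifold modelled on `V`. -/
structure PrincipalBundle (E : Type*) [NormedAddCommGroup E] [NormedSpace ℝ E]
    (X : Type*) [TopologicalSpace X] [ChartedSpace E X]
    (V : Type*) [NormedAddCommGroup V] [NormedSpace ℂ V]
    (H : Type*) [TopologicalSpace H] [ChartedSpace V H] [Group H]
    (N : Type*) [NormedAddCommGroup N] [NormedSpace ℝ N]
    (P : Type*) [TopologicalSpace P] [ChartedSpace N P] where
  proj : P → X
  act : P → H → P
  proj_smooth : ContMDiff 𝓘(ℝ, N) 𝓘(ℝ, E) ∞ proj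
  act_smooth : ContMDiff (𝓘(ℝ, N).prod 𝓘(ℝ, V)) 𝓘(ℝ, N) ∞ (fun q : P × H => act q.1 q.2)
  act_one : ∀ z, act z 1 = z
  act_mul : ∀ z h k, act z (h * k) = act (act z h) k
  proj_act : ∀ z h, proj (act z h) = proj z
  locally_trivial : ∀ x₀ : X, ∃ U : Set X, IsOpen U ∧ x₀ ∈ U ∧
    ∃ (σ : X → P) (τ : P → H),
      ContMDiffOn 𝓘(ℝ, E) 𝓘(ℝ, N) ∞ σ U ∧ ContMDiffOn 𝓘(ℝ, N) 𝓘(ℝ, V) ∞ τ (proj ⁻¹' U) ∧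
      (∀ x ∈ U, proj (σ x) = x) ∧
      (∀ z, proj z ∈ U → act (σ (proj z)) (τ z) = z) ∧
      (∀ x ∈ U, ∀ h, τ (act (σ x) h) = h)

section Principal

variable {E : Type*} [NormedAddCommGroup E] [NormedSpace ℝ E] [FiniteDimensional ℝ E]
  {X : Type*} [TopologicalSpace X] [ChartedSpace E X] [IsManifold 𝓘(ℝ, E) ∞ X]
  {V : Type*} [NormedAddCommGroup V] [NormedSpace ℂ V]
  {H : Type*} [TopologicalSpace H] [ChartedSpace V H] [Group H]
  {N : Type*} [NormedAddCommGroup N] [NormedSpace ℝ N]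
  {P : Type*} [TopologicalSpace P] [ChartedSpace N P]

namespace PrincipalBundle

variable (B : PrincipalBundle E X V H N P)

/-- The vertical tangent space `ker(dp)`. -/
def vert (z : P) : Submodule ℝ (TangentSpace 𝓘(ℝ, N) z) :=
  LinearMap.ker (mfderiv 𝓘(ℝ, N) 𝓘(ℝ, E) B.proj z).toLinearMap

/-- The differential of the right translation `R_h` at `z`. -/
def dR (h : H) (z : P) : TangentSpace 𝓘(ℝ, N) z →L[ℝ] TangentSpace 𝓘(ℝ, N) (B.act z h) :=
  mfderiv 𝓘(ℝ, N) 𝓘(ℝ, N) (fun y => B.act y h) z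

/-- The complexified differential of the right translation `R_h` at `z`. -/
def cdR (h : H) (z : P) : CTan N z →ₗ[ℂ] CTan N (B.act z h) :=
  cdiff N N (fun y => B.act y h) z

/-- The complexified differential `dp ⊗ ℂ`. -/
def cdp (z : P) : CTan N z →ₗ[ℂ] CTan E (B.proj z) :=
  cdiff N E B.proj z

end PrincipalBundle

end Principal

/-- A complex principal `H`-bundle on a Sasakian manifold: the fibres carry an `H`-invariant
complex structure `J` for which the action on each fibre is holomorphic, and there is
a partial connection `xiT` along `ℝ ξ` with `L_{ξ̂} J = 0` for the lift `ξ̂` of `ξ` to `xiT`. -/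
structure ComplexPrincipalBundle
    {E : Type*} [NormedAddCommGroup E] [NormedSpace ℝ E] [FiniteDimensional ℝ E]
    {X : Type*} [TopologicalSpace X] [ChartedSpace E X] [IsManifold 𝓘(ℝ, E) ∞ X]
    {m : ℕ} (S : SasakianStructure E X m)
    (V : Type*) [NormedAddCommGroup V] [NormedSpace ℂ V]
    (H : Type*) [TopologicalSpace H] [ChartedSpace V H] [Group H]
    (N : Type*) [NormedAddCommGroup N] [NormedSpace ℝ N]
    (P : Type*) [TopologicalSpace P] [ChartedSpace N P] [IsManifold 𝓘(ℝ, N) ∞ P]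
    extends PrincipalBundle E X V H N P where
  J : ∀ z : P, toPrincipalBundle.vert z →ₗ[ℝ] toPrincipalBundle.vert z
  J_smooth : ∀ U : Set P, IsOpen U → ∀ A : ∀ z : P, toPrincipalBundle.vert z,
    SmoothVF U (fun z => (A z : TangentSpace 𝓘(ℝ, N) z)) →
      SmoothVF U (fun z => (J z (A z) : TangentSpace 𝓘(ℝ, N) z))
  J_sq : ∀ z v, J z (J z v) = -v
  /-- `J` is integrable on every fibre; since the fields are vertical, this is the
  integrability of `{v + √-1 J(v)}` as a distribution on `P`. -/
  J_integrable : IsIntegrable (fun z : P => Submodule.span ℂ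
    {w : CTan N z | ∃ v : toPrincipalBundle.vert z,
      w = (1 : ℂ) ⊗ₜ[ℝ] (v : TangentSpace 𝓘(ℝ, N) z)
        + Complex.I ⊗ₜ[ℝ] (J z v : TangentSpace 𝓘(ℝ, N) z)})
  /-- the translations `z ↦ z h` are holomorphic on the fibres -/
  J_translation : ∀ (z : P) (h : H) (v : toPrincipalBundle.vert z)
    (v' : toPrincipalBundle.vert (toPrincipalBundle.act z h)),
    (v' : TangentSpace 𝓘(ℝ, N) (toPrincipalBundle.act z h)) = toPrincipalBundle.dR h z v →
      (J _ v' : TangentSpace 𝓘(ℝ, N) (toPrincipalBundle.act z h))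
        = toPrincipalBundle.dR h z (J z v)
  /-- the orbit maps `h ↦ z h` from `H` to the fibres are holomorphic -/
  J_orbit : ∀ (z : P) (h : H) (η : V) (v : toPrincipalBundle.vert (toPrincipalBundle.act z h)),
    (v : TangentSpace 𝓘(ℝ, N) (toPrincipalBundle.act z h))
        = mfderiv 𝓘(ℝ, V) 𝓘(ℝ, N) (fun k => toPrincipalBundle.act z k) h η →
      (J _ v : TangentSpace 𝓘(ℝ, N) (toPrincipalBundle.act z h))
        = mfderiv 𝓘(ℝ, V) 𝓘(ℝ, N) (fun k => toPrincipalBundle.act z k) h (Complex.I • η : V)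
  /-- the partial connection in the direction of `ξ` -/
  xiT : ∀ z : P, Submodule ℝ (TangentSpace 𝓘(ℝ, N) z)
  xiT_smooth : IsSmoothDistribution xiT 1
  xiT_invariant : ∀ z h,
    (xiT z).map (toPrincipalBundle.dR h z).toLinearMap = xiT (toPrincipalBundle.act z h)
  xiT_iso : ∀ z, Set.BijOn (mfderiv 𝓘(ℝ, N) 𝓘(ℝ, E) toPrincipalBundle.proj z) (xiT z)
    (Submodule.span ℝ {S.xi (toPrincipalBundle.proj z)} :
      Set (TangentSpace 𝓘(ℝ, E) (toPrincipalBundle.proj z)))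
  /-- `(L_ξ̂ J)(A) = [ξ̂, J A] - J [ξ̂, A]` vanishes for every vertical vector field `A`. -/
  lie_J : ∀ xiHat : ∀ z : P, TangentSpace 𝓘(ℝ, N) z, (∀ z, xiHat z ∈ xiT z) →
    (∀ z, mfderiv 𝓘(ℝ, N) 𝓘(ℝ, E) toPrincipalBundle.proj z (xiHat z)
      = S.xi (toPrincipalBundle.proj z)) →
    ∀ U : Set P, IsOpen U → ∀ A : ∀ z : P, toPrincipalBundle.vert z,
      SmoothVF U (fun z => (A z : TangentSpace 𝓘(ℝ, N) z)) →
      ∀ z ∈ U, ∀ b : toPrincipalBundle.vert z,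
        (b : TangentSpace 𝓘(ℝ, N) z)
            = VectorField.mlieBracket 𝓘(ℝ, N) xiHat (fun y => (A y : TangentSpace 𝓘(ℝ, N) y)) z →
          VectorField.mlieBracket 𝓘(ℝ, N) xiHat
              (fun y => (J y (A y) : TangentSpace 𝓘(ℝ, N) y)) z
            = (J z b : TangentSpace 𝓘(ℝ, N) z)

section ComplexPrincipal

variable {E : Type*} [NormedAddCommGroup E] [NormedSpace ℝ E] [FiniteDimensional ℝ E]
  {X : Type*} [TopologicalSpace X] [ChartedSpace E X] [IsManifold 𝓘(ℝ, E) ∞ X]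
  {m : ℕ} {S : SasakianStructure E X m}
  {V : Type*} [NormedAddCommGroup V] [NormedSpace ℂ V]
  {H : Type*} [TopologicalSpace H] [ChartedSpace V H] [Group H]
  {N : Type*} [NormedAddCommGroup N] [NormedSpace ℝ N]
  {P : Type*} [TopologicalSpace P] [ChartedSpace N P] [IsManifold 𝓘(ℝ, N) ∞ P]

/-- `𝕂^{0,1} = {v + √-1 J(v)}`, `v` vertical. -/
def ComplexPrincipalBundle.K01 (B : ComplexPrincipalBundle S V H N P) (z : P) :
    Submodule ℂ (CTan N z) :=
  Submodule.span ℂ {w | ∃ v : B.vert z,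
    w = (1 : ℂ) ⊗ₜ[ℝ] (v : TangentSpace 𝓘(ℝ, N) z)
      + Complex.I ⊗ₜ[ℝ] (B.J z v : TangentSpace 𝓘(ℝ, N) z)}

/-- `𝕂^{1,0} = {v - √-1 J(v)}`, `v` vertical. -/
def ComplexPrincipalBundle.K10 (B : ComplexPrincipalBundle S V H N P) (z : P) :
    Submodule ℂ (CTan N z) :=
  Submodule.span ℂ {w | ∃ v : B.vert z,
    w = (1 : ℂ) ⊗ₜ[ℝ] (v : TangentSpace 𝓘(ℝ, N) z)
      - Complex.I ⊗ₜ[ℝ] (B.J z v : TangentSpace 𝓘(ℝ, N) z)}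

end ComplexPrincipal

/-- A holomorphic principal `H`-bundle on a Sasakian manifold: a complex principal bundle with a
holomorphic structure, a complex distribution `calF` of rank `m + 1`. -/
structure HolPrincipalBundle
    {E : Type*} [NormedAddCommGroup E] [NormedSpace ℝ E] [FiniteDimensional ℝ E]
    {X : Type*} [TopologicalSpace X] [ChartedSpace E X] [IsManifold 𝓘(ℝ, E) ∞ X]
    {m : ℕ} (S : SasakianStructure E X m)
    (V : Type*) [NormedAddCommGroup V] [NormedSpace ℂ V]
    (H : Type*) [TopologicalSpace H] [ChartedSpace V H] [Group H]
    (N : Type*) [NormedAddCommGroup N] [NormedSpace ℝ N]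
    (P : Type*) [TopologicalSpace P] [ChartedSpace N P] [IsManifold 𝓘(ℝ, N) ∞ P]
    extends ComplexPrincipalBundle S V H N P where
  calF : ∀ z : P, Submodule ℂ (CTan N z)
  calF_smooth : IsSmoothCDistribution calF (m + 1)
  calF_integrable : IsIntegrable calF
  xiT_le_calF : ∀ z, ∀ v ∈ toComplexPrincipalBundle.xiT z, (1 : ℂ) ⊗ₜ[ℝ] v ∈ calF z
  calF_iso : ∀ z, Set.BijOn (toComplexPrincipalBundle.cdp z) (calF z)
    (S.calF01 (toComplexPrincipalBundle.proj z))
  calF_invariant : ∀ z h, (calF z).map (toComplexPrincipalBundle.cdR h z)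
    = calF (toComplexPrincipalBundle.act z h)
  calF_K01_integrable : IsIntegrable (fun z => calF z ⊔ toComplexPrincipalBundle.K01 z)

section Atiyah

variable {E : Type*} [NormedAddCommGroup E] [NormedSpace ℝ E] [FiniteDimensional ℝ E]
  {X : Type*} [TopologicalSpace X] [ChartedSpace E X] [IsManifold 𝓘(ℝ, E) ∞ X]
  {m : ℕ} {S : SasakianStructure E X m}
  {V : Type*} [NormedAddCommGroup V] [NormedSpace ℂ V]
  {H : Type*} [TopologicalSpace H] [ChartedSpace V H] [Group H]
  {N : Type*} [NormedAddCommGroup N] [NormedSpace ℝ N]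
  {P : Type*} [TopologicalSpace P] [ChartedSpace N P] [IsManifold 𝓘(ℝ, N) ∞ P]

namespace HolPrincipalBundle

variable (B : HolPrincipalBundle S V H N P)

/-- `𝔽 ⊆ calF`, the part of `calF` over `F^{0,1}`. -/
def FF (z : P) : Submodule ℂ (CTan N z) :=
  B.calF z ⊓ (S.F01 (B.proj z)).comap (B.cdp z)

/-- `𝕋 = 𝕂^{1,0} ⊕ conj 𝔽`. -/
def TT (z : P) : Submodule ℂ (CTan N z) :=
  B.K10 z ⊔ conjSubmodule (B.FF z)

/-- For an `H`-invariant subbundle `D` of `TP ⊗ ℂ`, the fibre `(D / H)_x`: an element of it is an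
`H`-orbit in `D` over the fibre `p⁻¹(x)`, that is, an `H`-equivariant choice of a vector `w z` in
`D z` for every `z` in `p⁻¹(x)`. -/
def quotFiber (D : ∀ z : P, Submodule ℂ (CTan N z)) (x : X) :
    Submodule ℂ (∀ z : {z : P // B.proj z = x}, CTan N z.1) where
  carrier := {w | (∀ z, w z ∈ D z.1) ∧
    ∀ (z : {z : P // B.proj z = x}) (h : H),
      w ⟨B.act z.1 h, (B.proj_act z.1 h).trans z.2⟩ = B.cdR h z.1 (w z)}
  add_mem' := fun ha hb => ⟨fun z => add_mem (ha.1 z) (hb.1 z), fun z h => by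
    simp only [Pi.add_apply, map_add, ha.2 z h, hb.2 z h]⟩
  zero_mem' := ⟨fun _ => zero_mem _, fun z h => by simp⟩
  smul_mem' := fun c _ ha => ⟨fun z => Submodule.smul_mem _ c (ha.1 z), fun z h => by
    simp only [Pi.smul_apply, map_smul, ha.2 z h]⟩

theorem quotFiber_mono {D D' : ∀ z : P, Submodule ℂ (CTan N z)} (h : ∀ z, D z ≤ D' z) (x : X) :
    B.quotFiber D x ≤ B.quotFiber D' x :=
  fun _ hw => ⟨fun z => h z.1 (hw.1 z), hw.2⟩

/-- The bundle `D / H` over `X`, for `D ⊆ 𝕋`: its sections over `U` are the `H`-invariant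
sections of `D` over `p⁻¹(U)`. The derivative of `s` along `v` is the component in `D` of
the bracket `[ṽ, s]`, with `ṽ` the lift of `v` to `calF`
(with respect to `TP ⊗ ℂ = 𝕋 ⊕ (calF ⊕ 𝕂^{0,1})`). -/
def quotBundle (D : ∀ z : P, Submodule ℂ (CTan N z)) : PartialBundle E X where
  Fiber x := B.quotFiber D x
  IsSmoothOn U s := SmoothCVF (B.proj ⁻¹' U) (fun z => (s (B.proj z)).1 ⟨z, rfl⟩)
  IsDerivAt U v s x t :=
    ∀ vT : ∀ z : P, CTan N z,
      (∀ z, B.proj z ∈ U → vT z ∈ B.calF z ∧ B.cdp z (vT z) = v (B.proj z)) →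
      ∀ z : {z : P // B.proj z = x},
        cBracket vT (fun y => (s (B.proj y)).1 ⟨y, rfl⟩) z.1 - t.1 z ∈ B.calF z.1 ⊔ B.K01 z.1

/-- The adjoint bundle `ad = 𝕂^{1,0} / H`. -/
def ad : PartialBundle E X := B.quotBundle B.K10

/-- The Atiyah bundle `At = 𝕋 / H`. -/
def At : PartialBundle E X := B.quotBundle B.TT

/-- The value at `z` of an element of the fibre of `ad` at `p(z)`. -/
def adVal {x : X} (v : B.ad.Fiber x) (z : P) (hz : B.proj z = x) : CTan N z := v.1 ⟨z, hz⟩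

/-- The value at `z` of an element of the fibre of `At` at `p(z)`. -/
def atVal {x : X} (w : B.At.Fiber x) (z : P) (hz : B.proj z = x) : CTan N z := w.1 ⟨z, hz⟩

/-- The inclusion `ad ⊆ At`. -/
def adToAt (x : X) : B.ad.Fiber x →ₗ[ℂ] B.At.Fiber x :=
  Submodule.inclusion (B.quotFiber_mono (D := B.K10) (D' := B.TT) (fun _ => le_sup_left) x)

/-- `d'p(w) = f` for the projection `d'p : At → F^{1,0}` induced by `dp`, which vanishes on
`𝕂^{1,0}`. The elements are taken over the point `p(z)`, the image is independent of `z`. -/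
def AtProjEq (z : P) (w : B.At.Fiber (B.proj z)) (f : S.F10Bundle.Fiber (B.proj z)) : Prop :=
  B.cdp z (B.atVal w z rfl) = (show S.F10 (B.proj z) from f).1

/-- A holomorphic homomorphism `D : F^{1,0} → At` is a holomorphic connection if
`d'p ∘ D = Id`. -/
def IsHolConnection (D : HolHom S S.F10Bundle B.At) : Prop :=
  ∀ (z : P) (f : S.F10Bundle.Fiber (B.proj z)), B.AtProjEq z (D.toFun _ f) f

end HolPrincipalBundle

end Atiyah

/-! ## Extension of structure group and branched Cartan geometries -/

/-- `ι` makes `H` a complex Lie subgroup of `G`: an injective holomorphic immersion. -/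
structure IsComplexLieSubgroup
    {V : Type*} [NormedAddCommGroup V] [NormedSpace ℂ V]
    {H : Type*} [TopologicalSpace H] [ChartedSpace V H] [Group H]
    {V' : Type*} [NormedAddCommGroup V'] [NormedSpace ℂ V']
    {G : Type*} [TopologicalSpace G] [ChartedSpace V' G] [Group G] (ι : H →* G) : Prop where
  injective : Function.Injective ι
  holomorphic : ContMDiff 𝓘(ℂ, V) 𝓘(ℂ, V') ∞ ι
  immersion : ∀ h, Function.Injective (mfderiv 𝓘(ℂ, V) 𝓘(ℂ, V') ι h)

section Extension

variable {E : Type*} [NormedAddCommGroup E] [NormedSpace ℝ E] [FiniteDimensional ℝ E]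
  {X : Type*} [TopologicalSpace X] [ChartedSpace E X] [IsManifold 𝓘(ℝ, E) ∞ X]
  {m : ℕ} {S : SasakianStructure E X m}
  {V : Type*} [NormedAddCommGroup V] [NormedSpace ℂ V]
  {H : Type*} [TopologicalSpace H] [ChartedSpace V H] [Group H]
  {N : Type*} [NormedAddCommGroup N] [NormedSpace ℝ N]
  {P : Type*} [TopologicalSpace P] [ChartedSpace N P] [IsManifold 𝓘(ℝ, N) ∞ P]
  {V' : Type*} [NormedAddCommGroup V'] [NormedSpace ℂ V']
  {G : Type*} [TopologicalSpace G] [ChartedSpace V' G] [Group G]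
  {N' : Type*} [NormedAddCommGroup N'] [NormedSpace ℝ N']
  {Q : Type*} [TopologicalSpace Q] [ChartedSpace N' Q] [IsManifold 𝓘(ℝ, N') ∞ Q]

/-- `BG` is the holomorphic principal `G`-bundle obtained from `BH` by extending the structure
group along `ι`; `j` is the canonical map `z ↦ [z, 1]` from `P` to `Q = P ×^H G`.
A smooth equivariant map over `X` determines the principal bundle
`Q`, since `(z, g) ↦ j(z) g` identifies `P ×^H G` with `Q`; the complex structure on the fibres of
`Q` is determined by that of `G`, and the two partial connections of `Q` are, along `j(P)`,
the images of those of `P` (and elsewhere the translates of these). -/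
structure IsExtension (ι : H →* G) (BH : HolPrincipalBundle S V H N P)
    (BG : HolPrincipalBundle S V' G N' Q) (j : P → Q) : Prop where
  smooth : ContMDiff 𝓘(ℝ, N) 𝓘(ℝ, N') ∞ j
  proj_eq : ∀ z, BG.proj (j z) = BH.proj z
  equivariant : ∀ z h, j (BH.act z h) = BG.act (j z) (ι h)
  xiT_eq : ∀ z, BG.xiT (j z) = (BH.xiT z).map (mfderiv 𝓘(ℝ, N) 𝓘(ℝ, N') j z).toLinearMap
  calF_eq : ∀ z, BG.calF (j z) = (BH.calF z).map (cdiff N N' j z)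

variable {ι : H →* G} {BH : HolPrincipalBundle S V H N P}
  {BG : HolPrincipalBundle S V' G N' Q} {j : P → Q}

/-- `ι₁(u) = v` for the homomorphism `ι₁ : ad(BH) → ad(BG)` induced by the inclusion of
Lie algebras, that is, by `dj : 𝕂^{1,0} → 𝕂^{1,0}`. -/
def AdExtEq (hj : IsExtension ι BH BG j) {x : X} (u : BH.ad.Fiber x) (v : BG.ad.Fiber x) : Prop :=
  ∀ (z : P) (hz : BH.proj z = x),
    BG.adVal v (j z) ((hj.proj_eq z).trans hz) = cdiff N N' j z (BH.adVal u z hz)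

/-- A branched holomorphic Cartan geometry of type `(G, H)` on the principal bundle `BH`. -/
structure BranchedCartanGeometry (hj : IsExtension ι BH BG j) where
  phi : HolHom S BH.At BG.ad
  /-- `φ` is an isomorphism over a nonempty subset of `X` -/
  iso_somewhere : ∃ x, Function.Bijective (phi.toFun x)
  /-- `φ(ι₂(u)) = ι₁(u)` -/
  compat : ∀ (x : X) (u : BH.ad.Fiber x), AdExtEq hj u (phi.toFun x (BH.adToAt x u))

/-- `α : ad(BG) ⊕ At(BH) → At(BG)` is the sum of the inclusion of `ad(BG)` and of the
homomorphism `At(BH) → At(BG)` induced by `dj`. -/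
def IsAtSum (hj : IsExtension ι BH BG j)
    (α : HolHom S (BG.ad.prod BH.At) BG.At) : Prop :=
  ∀ (x : X) (v : BG.ad.Fiber x) (w : BH.At.Fiber x) (z : P) (hz : BH.proj z = x),
    BG.atVal (α.toFun x (v, w)) (j z) ((hj.proj_eq z).trans hz)
      = BG.adVal v (j z) ((hj.proj_eq z).trans hz) + cdiff N N' j z (BH.atVal w z hz)

end Extension

end BranchedCartan

end

open scoped Manifold ContDiff TensorProduct

noncomputable section

set_option linter.unusedSectionVars false

/-! Compare two homomorphisms from `At(E_H)` to `At(E_G)`: the map `j_*` induced by `dj`, which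
respects the projections to `F^{1,0}`, and `φ` followed by the inclusion of `ad(E_G)`, which
projects to zero. The condition `φ ∘ ι₂ = ι₁` says that they agree on `ad(E_H)`, the kernel of
`d'p`. Hence `j_* - φ` factors as `D ∘ d'p`, and `D : F^{1,0} → At(E_G)` is a right inverse of
`d'p'`. Then `β' = Id - D ∘ d'p'` takes values in `ad(E_G)`, and `β'(v + j_* w) = v + j_* w - D(d'p
w) = v + φ(w)`. Since `a - j_* w` is vertical whenever `w` and `a` have the same projection, `α` is
surjective, so `β'` is unique; `D` is unique because `d'p'` is surjective.

The analytic work is in two places. One is that `j_*` is smooth and intertwines the partial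
connections (`jStar_smooth`, `jStar_isDerivAt`). These connections are Lie brackets modulo `calF ⊕
𝕂^{0,1}`. The differential `dj` respects `calF` by the definition of an extension, and it respects
types because orbit maps and `ι` are holomorphic (`J_mfderiv`). Points of `Q` outside `j(P)` have
the form `j(z) g`; for fixed `g` the map `y ↦ j(y) g` relates the invariant fields on `P` to those
on `Q`, and brackets of related fields are related (`cdiff_cBracket_of_related`).

The other is that `D` is holomorphic (`connection_isDerivAt`). It is written as `(j_* - φ) ∘
horLift`, where `horLift` is the smooth splitting of `d'p` with image `conj 𝔽 / H`. No holomorphy of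
`horLift` is needed: the lifted section has some derivative in `At(E_H)`, this derivative projects
to that of the original section, and `j_* - φ` depends only on the projection. -/

namespace BranchedCartan

/-! ### Real parts, imaginary parts and conjugation on `ℂ ⊗ V`. -/

section Complexification

variable {V W : Type*} [AddCommGroup V] [Module ℝ V] [AddCommGroup W] [Module ℝ W]

@[simp] theorem cRe_tmul (a : ℂ) (v : V) : cRe (a ⊗ₜ[ℝ] v) = a.re • v := by
  simp [cRe]

@[simp] theorem cIm_tmul (a : ℂ) (v : V) : cIm (a ⊗ₜ[ℝ] v) = a.im • v := by
  simp [cIm]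

@[simp] theorem cConj_tmul (a : ℂ) (v : V) :
    cConj (a ⊗ₜ[ℝ] v) = (starRingEnd ℂ a) ⊗ₜ[ℝ] v := by
  simp [cConj]

theorem tmul_cRe_add_tmul_cIm (u : ℂ ⊗[ℝ] V) :
    (1 : ℂ) ⊗ₜ[ℝ] cRe u + Complex.I ⊗ₜ[ℝ] cIm u = u := by
  induction u using TensorProduct.induction_on with
  | zero => simp
  | tmul a v =>
    rw [cRe_tmul, cIm_tmul, ← TensorProduct.smul_tmul, ← TensorProduct.smul_tmul,
      ← TensorProduct.add_tmul]
    congr 1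
    apply Complex.ext <;> simp
  | add u v hu hv =>
    rw [map_add, map_add, TensorProduct.tmul_add, TensorProduct.tmul_add]
    nth_rw 3 [← hu]
    nth_rw 3 [← hv]
    abel

theorem complexify_ext {u u' : ℂ ⊗[ℝ] V} (hr : cRe u = cRe u') (hi : cIm u = cIm u') :
    u = u' := by
  rw [← tmul_cRe_add_tmul_cIm u, ← tmul_cRe_add_tmul_cIm u', hr, hi]

theorem cRe_smul (c : ℂ) (u : ℂ ⊗[ℝ] V) : cRe (c • u) = c.re • cRe u - c.im • cIm u := by
  induction u using TensorProduct.induction_on with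
  | zero => simp
  | tmul a v => simp [TensorProduct.smul_tmul', sub_smul, mul_smul]
  | add u v hu hv => simp only [smul_add, map_add, hu, hv]; abel

theorem cIm_smul (c : ℂ) (u : ℂ ⊗[ℝ] V) : cIm (c • u) = c.re • cIm u + c.im • cRe u := by
  induction u using TensorProduct.induction_on with
  | zero => simp
  | tmul a v => simp [TensorProduct.smul_tmul', add_smul, mul_smul]
  | add u v hu hv => simp only [smul_add, map_add, hu, hv]; abel

@[simp] theorem cRe_cConj (u : ℂ ⊗[ℝ] V) : cRe (cConj u) = cRe u := by
  induction u using TensorProduct.induction_on with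
  | zero => simp
  | tmul a v => simp
  | add u v hu hv => simp only [map_add, hu, hv]

@[simp] theorem cIm_cConj (u : ℂ ⊗[ℝ] V) : cIm (cConj u) = -cIm u := by
  induction u using TensorProduct.induction_on with
  | zero => simp
  | tmul a v => simp
  | add u v hu hv => simp only [map_add, hu, hv]; abel

@[simp] theorem cConj_cConj (u : ℂ ⊗[ℝ] V) : cConj (cConj u) = u :=
  complexify_ext (by simp) (by simp)

theorem cConj_smul (c : ℂ) (u : ℂ ⊗[ℝ] V) :
    cConj (c • u) = (starRingEnd ℂ c) • cConj u :=
  complexify_ext (by simp [cRe_smul]) (by simp [cIm_smul, add_comm])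

/-- The conjugates of the elements of `D` already form a complex subspace, so the span in the
definition adds nothing. -/
theorem mem_conjSubmodule {D : Submodule ℂ (ℂ ⊗[ℝ] V)} {u : ℂ ⊗[ℝ] V} :
    u ∈ conjSubmodule D ↔ cConj u ∈ D := by
  constructor
  · intro hu
    induction hu using Submodule.span_induction with
    | mem x hx => obtain ⟨y, hy, rfl⟩ := hx; simpa using hy
    | zero => simp
    | add x y _ _ hx hy => rw [map_add]; exact add_mem hx hy
    | smul a x _ hx => rw [cConj_smul]; exact Submodule.smul_mem _ _ hx
  · intro hu
    exact Submodule.subset_span ⟨_, hu, cConj_cConj u⟩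

theorem cRe_baseChange (f : V →ₗ[ℝ] W) (u : ℂ ⊗[ℝ] V) :
    cRe (f.baseChange ℂ u) = f (cRe u) := by
  induction u using TensorProduct.induction_on with
  | zero => simp
  | tmul a v => simp
  | add u v hu hv => simp only [map_add, hu, hv]

theorem cIm_baseChange (f : V →ₗ[ℝ] W) (u : ℂ ⊗[ℝ] V) :
    cIm (f.baseChange ℂ u) = f (cIm u) := by
  induction u using TensorProduct.induction_on with
  | zero => simp
  | tmul a v => simp
  | add u v hu hv => simp only [map_add, hu, hv]

theorem cConj_baseChange (f : V →ₗ[ℝ] W) (u : ℂ ⊗[ℝ] V) :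
    cConj (f.baseChange ℂ u) = f.baseChange ℂ (cConj u) :=
  complexify_ext (by simp [cRe_baseChange]) (by simp [cIm_baseChange])

end Complexification

/-! ### Lie brackets of vector fields related by a smooth map. -/

section RelatedFields

/-- By symmetry of the second derivative, `Df [A, B] = D(Df B) A - D(Df A) B`. Relatedness turns `Df
B` and `Df A` into `B' ∘ f` and `A' ∘ f` near `x`, and the chain rule gives the bracket of `A'` and
`B'`. Invertibility of `Df` plays no role, so this covers bundle projections and the map `j`. -/
theorem fderiv_lieBracket_of_related {E F : Type*} [NormedAddCommGroup E] [NormedSpace ℝ E]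
    [NormedAddCommGroup F] [NormedSpace ℝ F] {f : E → F} {x : E} {A B : E → E} {A' B' : F → F}
    (hf : ContDiffAt ℝ 2 f x)
    (hA : DifferentiableAt ℝ A x) (hB : DifferentiableAt ℝ B x)
    (hA' : DifferentiableAt ℝ A' (f x)) (hB' : DifferentiableAt ℝ B' (f x))
    (hAA' : ∀ᶠ y in nhds x, fderiv ℝ f y (A y) = A' (f y))
    (hBB' : ∀ᶠ y in nhds x, fderiv ℝ f y (B y) = B' (f y)) :
    fderiv ℝ f x (VectorField.lieBracket ℝ A B x) = VectorField.lieBracket ℝ A' B' (f x) := by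
  have hfd : DifferentiableAt ℝ f x := hf.differentiableAt (by norm_num)
  have hcomp : ∀ {C' : F → F}, DifferentiableAt ℝ C' (f x) →
      fderiv ℝ (fun y => C' (f y)) x = (fderiv ℝ C' (f x)).comp (fderiv ℝ f x) :=
    fun h => fderiv_comp x h hfd
  rw [VectorField.fderiv_apply_lieBracket hf (by simp) hB hA, Filter.EventuallyEq.fderiv_eq hAA',
    Filter.EventuallyEq.fderiv_eq hBB', hcomp hA', hcomp hB']
  simp only [ContinuousLinearMap.comp_apply, hAA'.self_of_nhds, hBB'.self_of_nhds,
    VectorField.lieBracket]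

variable {E : Type*} [NormedAddCommGroup E] [NormedSpace ℝ E] [CompleteSpace E]
  {M : Type*} [TopologicalSpace M] [ChartedSpace E M] [IsManifold 𝓘(ℝ, E) ∞ M]
  {E' : Type*} [NormedAddCommGroup E'] [NormedSpace ℝ E'] [CompleteSpace E']
  {M' : Type*} [TopologicalSpace M'] [ChartedSpace E' M'] [IsManifold 𝓘(ℝ, E') ∞ M']

open VectorField Filter

/-- A vector field read in the preferred chart at `x`. -/
def chartField (A : ∀ y : M, TangentSpace 𝓘(ℝ, E) y) (x : M) (y : E) : E :=
  mpullbackWithin 𝓘(ℝ, E) 𝓘(ℝ, E) (extChartAt 𝓘(ℝ, E) x).symm A Set.univ y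

/-- The preferred chart at `x` has the identity as its derivative at `x`, so pulling the bracket
back to the manifold changes nothing at that point. -/
theorem mlieBracket_eq_lieBracket_chartField (A B : ∀ y : M, TangentSpace 𝓘(ℝ, E) y) (x : M) :
    mlieBracket 𝓘(ℝ, E) A B x
      = lieBracket ℝ (chartField A x) (chartField B x) (extChartAt 𝓘(ℝ, E) x x) := by
  rw [← mlieBracketWithin_univ, mlieBracketWithin_apply, mfderiv_extChartAt_self]
  rw [Set.preimage_univ, Set.univ_inter, ModelWithCorners.range_eq_univ]
  change (ContinuousLinearMap.id ℝ E).inverse (lieBracketWithin ℝ _ _ Set.univ _) = _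
  rw [ContinuousLinearMap.inverse_id]
  exact congrFun (lieBracketWithin_univ (V := chartField A x) (W := chartField B x)) _

theorem DiffVFAt.chartField {A : ∀ y : M, TangentSpace 𝓘(ℝ, E) y} {x : M} (hA : DiffVFAt A x) :
    DifferentiableAt ℝ (chartField A x) (extChartAt 𝓘(ℝ, E) x x) := by
  have h : MDifferentiableWithinAt 𝓘(ℝ, E) 𝓘(ℝ, E).tangent
      (fun x => (⟨x, A x⟩ : TangentBundle 𝓘(ℝ, E) M)) Set.univ x := hA.mdifferentiableWithinAt
  have h' := h.differentiableWithinAt_mpullbackWithin_vectorField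
  rw [Set.preimage_univ, Set.univ_inter, ModelWithCorners.range_eq_univ] at h'
  exact differentiableWithinAt_univ.1 h'

theorem chartField_of_mem_target (A : ∀ y : M, TangentSpace 𝓘(ℝ, E) y) {x : M} {y : E}
    (hy : y ∈ (extChartAt 𝓘(ℝ, E) x).target) :
    chartField A x y = mfderiv 𝓘(ℝ, E) 𝓘(ℝ, E) (extChartAt 𝓘(ℝ, E) x)
      ((extChartAt 𝓘(ℝ, E) x).symm y) (A ((extChartAt 𝓘(ℝ, E) x).symm y)) := by
  have h1 := mfderiv_extChartAt_comp_mfderivWithin_extChartAt_symm (I := 𝓘(ℝ, E)) hy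
  have h2 := mfderivWithin_extChartAt_symm_comp_mfderiv_extChartAt (I := 𝓘(ℝ, E)) hy
  simp only [ModelWithCorners.range_eq_univ] at h1 h2
  rw [chartField, mpullbackWithin_apply, ContinuousLinearMap.inverse_eq h2 h1]
  rfl

/-- In the preferred charts at `x` and `f x` this becomes the statement for vector spaces, applied
to the coordinate expression of `f`. -/
theorem mfderiv_mlieBracket_of_related {f : M → M'} {x : M}
    {A B : ∀ y : M, TangentSpace 𝓘(ℝ, E) y} {A' B' : ∀ y : M', TangentSpace 𝓘(ℝ, E') y}
    (hf : ContMDiffAt 𝓘(ℝ, E) 𝓘(ℝ, E') ∞ f x)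
    (hA : DiffVFAt A x) (hB : DiffVFAt B x) (hA' : DiffVFAt A' (f x)) (hB' : DiffVFAt B' (f x))
    (hAA' : ∀ᶠ y in nhds x, mfderiv 𝓘(ℝ, E) 𝓘(ℝ, E') f y (A y) = A' (f y))
    (hBB' : ∀ᶠ y in nhds x, mfderiv 𝓘(ℝ, E) 𝓘(ℝ, E') f y (B y) = B' (f y)) :
    mfderiv 𝓘(ℝ, E) 𝓘(ℝ, E') f x (mlieBracket 𝓘(ℝ, E) A B x)
      = mlieBracket 𝓘(ℝ, E') A' B' (f x) := by
  set φ := extChartAt 𝓘(ℝ, E) x with hφ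
  set ψ := extChartAt 𝓘(ℝ, E') (f x) with hψ
  set F : E → E' := ψ ∘ f ∘ φ.symm with hF
  have hsymm : φ.symm (φ x) = x := extChartAt_to_inv x
  have hFx : F (φ x) = ψ (f x) := by simp [hF, hsymm]
  have htarget : ∀ᶠ y in nhds (φ x), y ∈ φ.target := extChartAt_target_mem_nhds x
  have htend : Tendsto φ.symm (nhds (φ x)) (nhds x) := by
    have := (continuousAt_extChartAt_symm (I := 𝓘(ℝ, E)) x).tendsto
    rwa [← hφ, hsymm] at this
  have hsource : ∀ᶠ z in nhds x, f z ∈ ψ.source :=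
    hf.continuousAt.eventually_mem (extChartAt_source_mem_nhds (f x))
  have hmd : ∀ᶠ z in nhds x, MDifferentiableAt 𝓘(ℝ, E) 𝓘(ℝ, E') f z := by
    have h1 : ContMDiffAt 𝓘(ℝ, E) 𝓘(ℝ, E') 1 f x := hf.of_le (by simp)
    exact ((contMDiffAt_iff_contMDiffAt_nhds (by simp)).1 h1).mono
      fun z hz => hz.mdifferentiableAt (by simp)
  -- Relatedness passes to chart fields on a whole neighbourhood of `φ x`, as the bracket requires:
  -- the chart differentials of `φ.symm` and `φ` cancel in the middle.
  have hrel : ∀ (C : ∀ y : M, TangentSpace 𝓘(ℝ, E) y) (C' : ∀ y : M', TangentSpace 𝓘(ℝ, E') y),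
      (∀ᶠ y in nhds x, mfderiv 𝓘(ℝ, E) 𝓘(ℝ, E') f y (C y) = C' (f y)) →
      ∀ᶠ y in nhds (φ x), fderiv ℝ F y (chartField C x y) = chartField C' (f x) (F y) := by
    intro C C' hC
    filter_upwards [htarget, htend.eventually hC, htend.eventually hsource,
      htend.eventually hmd] with y hy hCy hsy hmy
    have hFt : F y ∈ ψ.target := ψ.map_source hsy
    have hψF : ψ.symm (F y) = f (φ.symm y) := ψ.left_inv hsy
    have hsy' : f (φ.symm y) ∈ (chartAt E' (f x)).source := by
      simpa [hψ] using hsy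
    rw [chartField_of_mem_target C hy, chartField_of_mem_target C' hFt, ← hφ, ← hψ, hψF, ← hCy,
      ← mfderiv_eq_fderiv]
    have h1 : MDifferentiableAt 𝓘(ℝ, E) 𝓘(ℝ, E) φ.symm y := by
      have := mdifferentiableWithinAt_extChartAt_symm (I := 𝓘(ℝ, E)) hy
      rw [ModelWithCorners.range_eq_univ] at this
      exact mdifferentiableWithinAt_univ.1 this
    have h2 := mfderivWithin_extChartAt_symm_comp_mfderiv_extChartAt (I := 𝓘(ℝ, E)) hy
    simp only [ModelWithCorners.range_eq_univ, mfderivWithin_univ] at h2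
    have h3 : MDifferentiableAt 𝓘(ℝ, E') 𝓘(ℝ, E') ψ (f (φ.symm y)) :=
      mdifferentiableAt_extChartAt hsy'
    rw [hF, mfderiv_comp y h3 (hmy.comp y h1), mfderiv_comp y hmy h1]
    exact congrArg (fun v => mfderiv 𝓘(ℝ, E') 𝓘(ℝ, E') ψ (f (φ.symm y))
      (mfderiv 𝓘(ℝ, E) 𝓘(ℝ, E') f (φ.symm y) v)) (DFunLike.congr_fun h2 (C (φ.symm y)))
  have hFc : ContDiffAt ℝ 2 F (φ x) := by
    have h := (contMDiffAt_iff.1 hf).2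
    simp only [ModelWithCorners.range_eq_univ, contDiffWithinAt_univ] at h
    exact h.of_le (WithTop.coe_le_coe.2 le_top)
  have hmain := fderiv_lieBracket_of_related (f := F) (x := φ x) hFc hA.chartField hB.chartField
    (by rw [hFx]; exact hA'.chartField) (by rw [hFx]; exact hB'.chartField)
    (hrel A A' hAA') (hrel B B' hBB')
  rw [mlieBracket_eq_lieBracket_chartField, mlieBracket_eq_lieBracket_chartField, ← hφ, ← hψ,
    ← hFx, ← hmain]
  have hfd : mfderiv 𝓘(ℝ, E) 𝓘(ℝ, E') f x = fderiv ℝ F (φ x) := by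
    refine hmd.self_of_nhds.mfderiv.trans ?_
    rw [ModelWithCorners.range_eq_univ]
    exact congrFun (fderivWithin_univ (𝕜 := ℝ) (f := F)) (φ x)
  exact DFunLike.congr_fun hfd _

end RelatedFields

/-! ### Smoothness and brackets of complex vector fields. -/

section ComplexBracket

variable {E : Type*} [NormedAddCommGroup E] [NormedSpace ℝ E]
  {M : Type*} [TopologicalSpace M] [ChartedSpace E M]
  {E' : Type*} [NormedAddCommGroup E'] [NormedSpace ℝ E']
  {M' : Type*} [TopologicalSpace M'] [ChartedSpace E' M']

theorem cRe_cdiff (f : M → M') (x : M) (u : CTan E x) :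
    cRe (cdiff E E' f x u) = mfderiv 𝓘(ℝ, E) 𝓘(ℝ, E') f x (cRe u) :=
  cRe_baseChange _ u

theorem cIm_cdiff (f : M → M') (x : M) (u : CTan E x) :
    cIm (cdiff E E' f x u) = mfderiv 𝓘(ℝ, E) 𝓘(ℝ, E') f x (cIm u) :=
  cIm_baseChange _ u

theorem cConj_cdiff (f : M → M') (x : M) (u : CTan E x) :
    cConj (cdiff E E' f x u) = cdiff E E' f x (cConj u) :=
  cConj_baseChange _ u

theorem cdiff_tmul (f : M → M') (x : M) (a : ℂ) (v : TangentSpace 𝓘(ℝ, E) x) :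
    cdiff E E' f x (a ⊗ₜ[ℝ] v) = a ⊗ₜ[ℝ] mfderiv 𝓘(ℝ, E) 𝓘(ℝ, E') f x v := rfl

theorem cdiff_comp {E'' : Type*} [NormedAddCommGroup E''] [NormedSpace ℝ E'']
    {M'' : Type*} [TopologicalSpace M''] [ChartedSpace E'' M''] {g : M' → M''} {f : M → M'} {x : M}
    (hg : MDifferentiableAt 𝓘(ℝ, E') 𝓘(ℝ, E'') g (f x))
    (hf : MDifferentiableAt 𝓘(ℝ, E) 𝓘(ℝ, E') f x) (u : CTan E x) :
    cdiff E E'' (fun y => g (f y)) x u = cdiff E' E'' g (f x) (cdiff E E' f x u) := by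
  have h : (mfderiv 𝓘(ℝ, E) 𝓘(ℝ, E'') (fun y => g (f y)) x).toLinearMap
      = (mfderiv 𝓘(ℝ, E') 𝓘(ℝ, E'') g (f x)).toLinearMap
        ∘ₗ (mfderiv 𝓘(ℝ, E) 𝓘(ℝ, E') f x).toLinearMap :=
    congrArg ContinuousLinearMap.toLinearMap (mfderiv_comp x hg hf)
  rw [cdiff, h, LinearMap.baseChange_comp]
  rfl

@[simp] theorem cRe_cBracket (A B : ∀ x : M, CTan E x) (x : M) :
    cRe (cBracket A B x)
      = VectorField.mlieBracket 𝓘(ℝ, E) (fun y => cRe (A y)) (fun y => cRe (B y)) x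
        - VectorField.mlieBracket 𝓘(ℝ, E) (fun y => cIm (A y)) (fun y => cIm (B y)) x := by
  simp [cBracket]

@[simp] theorem cIm_cBracket (A B : ∀ x : M, CTan E x) (x : M) :
    cIm (cBracket A B x)
      = VectorField.mlieBracket 𝓘(ℝ, E) (fun y => cRe (A y)) (fun y => cIm (B y)) x
        + VectorField.mlieBracket 𝓘(ℝ, E) (fun y => cIm (A y)) (fun y => cRe (B y)) x := by
  simp [cBracket]

theorem mlieBracket_congr {A A' B B' : ∀ x : M, TangentSpace 𝓘(ℝ, E) x} {x : M}
    (hA : ∀ᶠ y in nhds x, A y = A' y) (hB : ∀ᶠ y in nhds x, B y = B' y) :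
    VectorField.mlieBracket 𝓘(ℝ, E) A B x = VectorField.mlieBracket 𝓘(ℝ, E) A' B' x :=
  Filter.EventuallyEq.mlieBracket_vectorField_eq hA hB

theorem cBracket_congr {A A' B B' : ∀ x : M, CTan E x} {x : M}
    (hA : ∀ᶠ y in nhds x, A y = A' y) (hB : ∀ᶠ y in nhds x, B y = B' y) :
    cBracket A B x = cBracket A' B' x := by
  have hAr := hA.mono fun y h => congrArg cRe h
  have hAi := hA.mono fun y h => congrArg cIm h
  have hBr := hB.mono fun y h => congrArg cRe h
  have hBi := hB.mono fun y h => congrArg cIm h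
  rw [cBracket, cBracket, mlieBracket_congr hAr hBr, mlieBracket_congr hAr hBi,
    mlieBracket_congr hAi hBr, mlieBracket_congr hAi hBi]

variable [IsManifold 𝓘(ℝ, E) ∞ M] [IsManifold 𝓘(ℝ, E') ∞ M']

/-- A section of `TM ⊗ ℂ` is differentiable at `x` if its real and imaginary parts are. -/
def DiffCVFAt (A : ∀ x : M, CTan E x) (x : M) : Prop :=
  DiffVFAt (fun y => cRe (A y)) x ∧ DiffVFAt (fun y => cIm (A y)) x

theorem SmoothVF.diffVFAt {U : Set M} {A : ∀ x : M, TangentSpace 𝓘(ℝ, E) x}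
    (hA : SmoothVF U A) (hU : IsOpen U) {x : M} (hx : x ∈ U) : DiffVFAt A x :=
  (hA.contMDiffAt (hU.mem_nhds hx)).mdifferentiableAt (by simp)

theorem SmoothCVF.diffCVFAt {U : Set M} {A : ∀ x : M, CTan E x}
    (hA : SmoothCVF U A) (hU : IsOpen U) {x : M} (hx : x ∈ U) : DiffCVFAt A x :=
  ⟨hA.1.diffVFAt hU hx, hA.2.diffVFAt hU hx⟩

theorem SmoothVF.congr {U : Set M} {A B : ∀ x : M, TangentSpace 𝓘(ℝ, E) x}
    (hA : SmoothVF U A) (h : ∀ x ∈ U, B x = A x) : SmoothVF U B :=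
  ContMDiffOn.congr hA fun x hx => by rw [h x hx]

theorem SmoothCVF.congr {U : Set M} {A B : ∀ x : M, CTan E x}
    (hA : SmoothCVF U A) (h : ∀ x ∈ U, B x = A x) : SmoothCVF U B :=
  ⟨hA.1.congr fun x hx => by rw [h x hx], hA.2.congr fun x hx => by rw [h x hx]⟩

theorem SmoothCVF.add {U : Set M} {A B : ∀ x : M, CTan E x}
    (hA : SmoothCVF U A) (hB : SmoothCVF U B) : SmoothCVF U (fun x => A x + B x) :=
  ⟨(hA.1.add_section hB.1).congr fun x _ => by simp,
    (hA.2.add_section hB.2).congr fun x _ => by simp⟩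

theorem SmoothCVF.neg {U : Set M} {A : ∀ x : M, CTan E x}
    (hA : SmoothCVF U A) : SmoothCVF U (fun x => -A x) :=
  ⟨hA.1.neg_section.congr fun x _ => by simp, hA.2.neg_section.congr fun x _ => by simp⟩

theorem SmoothCVF.sub {U : Set M} {A B : ∀ x : M, CTan E x}
    (hA : SmoothCVF U A) (hB : SmoothCVF U B) : SmoothCVF U (fun x => A x - B x) :=
  (hA.add hB.neg).congr fun _ _ => sub_eq_add_neg _ _

theorem SmoothCVF.conj {U : Set M} {A : ∀ x : M, CTan E x}
    (hA : SmoothCVF U A) : SmoothCVF U (fun x => cConj (A x)) :=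
  ⟨hA.1.congr fun x _ => by simp, hA.2.neg_section.congr fun x _ => by simp⟩

theorem smoothCVF_of_locally {U : Set M} {A : ∀ x : M, CTan E x}
    (h : ∀ x ∈ U, ∃ W : Set M, IsOpen W ∧ x ∈ W ∧ SmoothCVF (U ∩ W) A) : SmoothCVF U A := by
  constructor
  · apply contMDiffOn_of_locally_contMDiffOn
    intro x hx
    obtain ⟨W, hW, hxW, h⟩ := h x hx
    exact ⟨W, hW, hxW, h.1⟩
  · apply contMDiffOn_of_locally_contMDiffOn
    intro x hx
    obtain ⟨W, hW, hxW, h⟩ := h x hx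
    exact ⟨W, hW, hxW, h.2⟩

theorem cBracket_add_right {A B B' : ∀ x : M, CTan E x} {x : M}
    [CompleteSpace E] (hB : DiffCVFAt B x) (hB' : DiffCVFAt B' x) :
    cBracket A (fun y => B y + B' y) x = cBracket A B x + cBracket A B' x := by
  have key : ∀ C : ∀ x : M, TangentSpace 𝓘(ℝ, E) x,
      VectorField.mlieBracket 𝓘(ℝ, E) C (fun y => cRe (B y + B' y)) x
        = VectorField.mlieBracket 𝓘(ℝ, E) C (fun y => cRe (B y)) x
          + VectorField.mlieBracket 𝓘(ℝ, E) C (fun y => cRe (B' y)) x ∧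
      VectorField.mlieBracket 𝓘(ℝ, E) C (fun y => cIm (B y + B' y)) x
        = VectorField.mlieBracket 𝓘(ℝ, E) C (fun y => cIm (B y)) x
          + VectorField.mlieBracket 𝓘(ℝ, E) C (fun y => cIm (B' y)) x := fun C => by
    constructor
    · simp only [map_add]
      exact VectorField.mlieBracket_add_right hB.1 hB'.1
    · simp only [map_add]
      exact VectorField.mlieBracket_add_right hB.2 hB'.2
  apply complexify_ext
  · rw [map_add, cRe_cBracket, cRe_cBracket, cRe_cBracket, (key _).1, (key _).2]
    abel
  · rw [map_add, cIm_cBracket, cIm_cBracket, cIm_cBracket, (key _).1, (key _).2]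
    abel

theorem cBracket_neg_right [CompleteSpace E] {A B : ∀ x : M, CTan E x} {x : M}
    (hB : DiffCVFAt B x) : cBracket A (fun y => -B y) x = -cBracket A B x := by
  have key : ∀ C D : ∀ x : M, TangentSpace 𝓘(ℝ, E) x, DiffVFAt D x →
      VectorField.mlieBracket 𝓘(ℝ, E) C (fun y => -D y) x
        = -VectorField.mlieBracket 𝓘(ℝ, E) C D x := fun C D hD => by
    have := VectorField.mlieBracket_const_smul_right (V := C) (c := (-1 : ℝ)) hD
    simpa using! this
  apply complexify_ext
  · simp only [map_neg, cRe_cBracket, key _ _ hB.1, key _ _ hB.2]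
    abel
  · simp only [map_neg, cIm_cBracket, key _ _ hB.1, key _ _ hB.2]
    abel

theorem cdiff_cBracket_of_related [CompleteSpace E] [CompleteSpace E'] {f : M → M'} {x : M}
    {A B : ∀ y : M, CTan E y} {A' B' : ∀ y : M', CTan E' y}
    (hf : ContMDiffAt 𝓘(ℝ, E) 𝓘(ℝ, E') ∞ f x)
    (hA : DiffCVFAt A x) (hB : DiffCVFAt B x) (hA' : DiffCVFAt A' (f x)) (hB' : DiffCVFAt B' (f x))
    (hAA' : ∀ᶠ y in nhds x, cdiff E E' f y (A y) = A' (f y))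
    (hBB' : ∀ᶠ y in nhds x, cdiff E E' f y (B y) = B' (f y)) :
    cdiff E E' f x (cBracket A B x) = cBracket A' B' (f x) := by
  have hAr := hAA'.mono fun y h => (cRe_cdiff f y (A y)).symm.trans (congrArg cRe h)
  have hAi := hAA'.mono fun y h => (cIm_cdiff f y (A y)).symm.trans (congrArg cIm h)
  have hBr := hBB'.mono fun y h => (cRe_cdiff f y (B y)).symm.trans (congrArg cRe h)
  have hBi := hBB'.mono fun y h => (cIm_cdiff f y (B y)).symm.trans (congrArg cIm h)
  apply complexify_ext
  · rw [cRe_cdiff, cRe_cBracket, cRe_cBracket, map_sub,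
      mfderiv_mlieBracket_of_related hf hA.1 hB.1 hA'.1 hB'.1 hAr hBr,
      mfderiv_mlieBracket_of_related hf hA.2 hB.2 hA'.2 hB'.2 hAi hBi]
  · rw [cIm_cdiff, cIm_cBracket, cIm_cBracket, map_add,
      mfderiv_mlieBracket_of_related hf hA.1 hB.2 hA'.1 hB'.2 hAr hBi,
      mfderiv_mlieBracket_of_related hf hA.2 hB.1 hA'.2 hB'.1 hAi hBr]

end ComplexBracket

/-! ### The splitting `TX ⊗ ℂ = F^{1,0} ⊕ 𝓕^{0,1}` as eigenspaces of `Φ`. -/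

section SasakianAlgebra

variable {E : Type*} [NormedAddCommGroup E] [NormedSpace ℝ E] [FiniteDimensional ℝ E]
  {X : Type*} [TopologicalSpace X] [ChartedSpace E X] [IsManifold 𝓘(ℝ, E) ∞ X]

namespace SasakianStructure

variable {m : ℕ} (S : SasakianStructure E X m)

theorem diffVFAt_xi (x : X) : DiffVFAt S.xi x :=
  S.xi_smooth.diffVFAt isOpen_univ (Set.mem_univ x)

/-- Extend `v` and `w` to local fields and expand `ξ g(Y, Z)` twice, by metric compatibility and by
the Killing equation. Writing `[ξ, Y]` as `∇_ξ Y - ∇_Y ξ`, the terms `∇_ξ Y` and `∇_ξ Z` cancel. -/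
theorem inner_nabla_xi_skew (x : X) (v w : TangentSpace 𝓘(ℝ, E) x) :
    S.g.inner x (S.nabla S.xi x v) w + S.g.inner x v (S.nabla S.xi x w) = 0 := by
  let Y : ∀ y : X, TangentSpace 𝓘(ℝ, E) y := FiberBundle.extend E v
  let Z : ∀ y : X, TangentSpace 𝓘(ℝ, E) y := FiberBundle.extend E w
  have hY : DiffVFAt Y x := FiberBundle.mdifferentiableAt_extend 𝓘(ℝ, E) E v
  have hZ : DiffVFAt Z x := FiberBundle.mdifferentiableAt_extend 𝓘(ℝ, E) E w
  have hYx : Y x = v := FiberBundle.extend_apply_self E v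
  have hZx : Z x = w := FiberBundle.extend_apply_self E w
  have h1 := S.nabla_metric Y Z x (S.xi x) hY hZ
  have h2 := S.xi_killing Y Z x hY hZ
  have h3 := S.nabla_torsion S.xi Y x (S.diffVFAt_xi x) hY
  have h4 := S.nabla_torsion S.xi Z x (S.diffVFAt_xi x) hZ
  rw [h1, ← h3, ← h4, map_sub, map_sub, sub_apply, hYx, hZx] at h2
  have h5 : ∀ a b c d : ℝ, a + b = a - c + (b - d) → c + d = 0 := fun a b c d h => by linarith
  exact h5 _ _ _ _ h2

theorem inner_nabla_xi_xi (x : X) (v : TangentSpace 𝓘(ℝ, E) x) :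
    S.g.inner x (S.nabla S.xi x v) (S.xi x) = 0 := by
  have h := S.nabla_metric S.xi S.xi x v (S.diffVFAt_xi x) (S.diffVFAt_xi x)
  have h0 : (fun y => S.g.inner y (S.xi y) (S.xi y)) = fun _ => (1 : ℝ) := funext S.xi_unit
  rw [h0, mfderiv_const] at h
  have h' : (0 : ℝ) = S.g.inner x (S.nabla S.xi x v) (S.xi x)
      + S.g.inner x (S.xi x) (S.nabla S.xi x v) := h
  rw [S.g.symm x (S.xi x)] at h'
  linarith

/-- Skewness applied to `ξ` and `∇_ξ ξ` gives `|∇_ξ ξ|² = 0`, since every `∇_v ξ` is orthogonal to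
`ξ`. -/
theorem nabla_xi_xi (x : X) : S.nabla S.xi x (S.xi x) = 0 := by
  by_contra h
  have h1 := S.g.pos x _ h
  have h2 := S.inner_nabla_xi_skew x (S.xi x) (S.nabla S.xi x (S.xi x))
  rw [S.g.symm x (S.xi x), S.inner_nabla_xi_xi, add_zero] at h2
  exact h1.ne' h2

theorem Phi_apply (x : X) (v : TangentSpace 𝓘(ℝ, E) x) : S.Phi x v = -S.nabla S.xi x v := rfl

theorem Phi_xi (x : X) : S.Phi x (S.xi x) = 0 := by
  rw [Phi_apply, nabla_xi_xi, neg_zero]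

theorem mem_F {x : X} {v : TangentSpace 𝓘(ℝ, E) x} : v ∈ S.F x ↔ S.g.inner x (S.xi x) v = 0 :=
  Iff.rfl

/-- This is the Sasakian identity for `W = ξ`: since `Φ(ξ)` vanishes identically, the only term left
on the left-hand side is `∇_{∇_v ξ} ξ`, which is `Φ(Φ(v))`. -/
theorem Phi_Phi (x : X) (v : TangentSpace 𝓘(ℝ, E) x) :
    S.Phi x (S.Phi x v) = S.g.inner x (S.xi x) v • S.xi x - v := by
  have h := S.nabla_Phi S.xi x v (S.diffVFAt_xi x)
  have h0 : (fun y => -(S.nabla S.xi y (S.xi y))) = 0 :=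
    funext fun y => by rw [nabla_xi_xi, neg_zero]; rfl
  rw [h0, CovariantDerivative.zero, S.xi_unit, one_smul, S.g.symm x v] at h
  rw [← h, Phi_apply, Phi_apply, map_neg]
  simp

theorem Phi_Phi_of_mem_F {x : X} {v : TangentSpace 𝓘(ℝ, E) x} (hv : v ∈ S.F x) :
    S.Phi x (S.Phi x v) = -v := by
  rw [Phi_Phi, S.mem_F.1 hv, zero_smul, zero_sub]

/-- The complexification of `Φ`. -/
def cPhi (x : X) : CTan E x →ₗ[ℂ] CTan E x := (S.Phi x).baseChange ℂ

theorem cPhi_tmul (x : X) (a : ℂ) (v : TangentSpace 𝓘(ℝ, E) x) :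
    S.cPhi x (a ⊗ₜ[ℝ] v) = a ⊗ₜ[ℝ] S.Phi x v := rfl

theorem cPhi_of_mem_F10 {x : X} {w : CTan E x} (hw : w ∈ S.F10 x) :
    S.cPhi x w = Complex.I • w := by
  have h : S.F10 x ≤ LinearMap.ker (S.cPhi x - Complex.I • LinearMap.id) := by
    refine Submodule.span_le.2 ?_
    rintro _ ⟨v, hv, rfl⟩
    rw [SetLike.mem_coe, LinearMap.mem_ker, LinearMap.sub_apply, map_sub, cPhi_tmul, cPhi_tmul,
      S.Phi_Phi_of_mem_F hv]
    simp only [LinearMap.smul_apply, LinearMap.id_apply, smul_sub, TensorProduct.smul_tmul',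
      smul_eq_mul, Complex.I_mul_I, mul_one, TensorProduct.tmul_neg, TensorProduct.neg_tmul]
    abel
  exact sub_eq_zero.1 (h hw)

theorem cPhi_of_mem_F01 {x : X} {w : CTan E x} (hw : w ∈ S.F01 x) :
    S.cPhi x w = -(Complex.I • w) := by
  have h : S.F01 x ≤ LinearMap.ker (S.cPhi x + Complex.I • LinearMap.id) := by
    refine Submodule.span_le.2 ?_
    rintro _ ⟨v, hv, rfl⟩
    rw [SetLike.mem_coe, LinearMap.mem_ker, LinearMap.add_apply, map_add, cPhi_tmul, cPhi_tmul,
      S.Phi_Phi_of_mem_F hv]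
    simp only [LinearMap.smul_apply, LinearMap.id_apply, smul_add, TensorProduct.smul_tmul',
      smul_eq_mul, Complex.I_mul_I, mul_one, TensorProduct.tmul_neg, TensorProduct.neg_tmul]
    abel
  exact eq_neg_of_add_eq_zero_left (h hw)

/-- On `F^{1,0}`, `F^{0,1}` and `ℂ ξ` the map `Φ` acts by the distinct scalars `i`, `-i` and `0`.
For `w = a + b` this yields `2a + b = 0`, and another application of `Φ` kills `a`. -/
theorem F10_disjoint_calF01 (x : X) : Disjoint (S.F10 x) (S.calF01 x) := by
  rw [Submodule.disjoint_def]
  intro w hw hw'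
  obtain ⟨a, ha, b, hb, rfl⟩ := Submodule.mem_sup.1 hw'
  have hb0 : S.cPhi x b = 0 := by
    obtain ⟨c, rfl⟩ := Submodule.mem_span_singleton.1 hb
    rw [map_smul, cPhi_tmul, Phi_xi, TensorProduct.tmul_zero, smul_zero]
  have h1 := S.cPhi_of_mem_F10 hw
  rw [map_add, hb0, S.cPhi_of_mem_F01 ha, add_zero] at h1
  have h2 : (2 : ℂ) • a + b = 0 := by
    have h3 : Complex.I • ((2 : ℂ) • a + b) = 0 := by
      have : Complex.I • ((2 : ℂ) • a + b) = Complex.I • (a + b) - -(Complex.I • a) := by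
        module
      rw [this, h1, sub_self]
    exact (smul_eq_zero.1 h3).resolve_left Complex.I_ne_zero
  have h4 : a = 0 := by
    have h5 := congrArg (S.cPhi x) h2
    rw [map_add, map_smul, hb0, S.cPhi_of_mem_F01 ha, add_zero, map_zero, smul_neg, neg_eq_zero,
      smul_smul] at h5
    exact (smul_eq_zero.1 h5).resolve_left (by simp)
  rw [h4, smul_zero, zero_add] at h2
  rw [h4, h2, add_zero]

theorem cConj_mem_F01 {x : X} {w : CTan E x} (hw : w ∈ S.F10 x) : cConj w ∈ S.F01 x := by
  induction hw using Submodule.span_induction with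
  | mem y hy =>
    obtain ⟨v, hv, rfl⟩ := hy
    exact Submodule.subset_span ⟨v, hv, by simp [TensorProduct.neg_tmul]⟩
  | zero => simp
  | add y z _ _ hy hz => rw [map_add]; exact add_mem hy hz
  | smul a y _ hy => rw [cConj_smul]; exact Submodule.smul_mem _ _ hy

theorem cConj_mem_F10 {x : X} {w : CTan E x} (hw : w ∈ S.F01 x) : cConj w ∈ S.F10 x := by
  induction hw using Submodule.span_induction with
  | mem y hy =>
    obtain ⟨v, hv, rfl⟩ := hy
    exact Submodule.subset_span ⟨v, hv, by simp [TensorProduct.neg_tmul, sub_eq_add_neg]⟩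
  | zero => simp
  | add y z _ _ hy hz => rw [map_add]; exact add_mem hy hz
  | smul a y _ hy => rw [cConj_smul]; exact Submodule.smul_mem _ _ hy

theorem F01_le_calF01 (x : X) : S.F01 x ≤ S.calF01 x := le_sup_left

/-- A vector of `F` is half the sum of its `(1,0)` and `(0,1)` vectors; the component along `ξ` lies
in `𝓕^{0,1}`. -/
theorem tmul_mem_sup {x : X} (v : TangentSpace 𝓘(ℝ, E) x) :
    (1 : ℂ) ⊗ₜ[ℝ] v ∈ S.F10 x ⊔ S.calF01 x := by
  have key : ∀ u ∈ S.F x, (1 : ℂ) ⊗ₜ[ℝ] u ∈ S.F10 x ⊔ S.calF01 x := by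
    intro u hu
    have h1 : (1 : ℂ) ⊗ₜ[ℝ] u - Complex.I ⊗ₜ[ℝ] S.Phi x u ∈ S.F10 x ⊔ S.calF01 x :=
      Submodule.mem_sup_left (Submodule.subset_span ⟨u, hu, rfl⟩)
    have h2 : (1 : ℂ) ⊗ₜ[ℝ] u + Complex.I ⊗ₜ[ℝ] S.Phi x u ∈ S.F10 x ⊔ S.calF01 x :=
      Submodule.mem_sup_right (S.F01_le_calF01 x (Submodule.subset_span ⟨u, hu, rfl⟩))
    have h3 := Submodule.smul_mem _ (1 / 2 : ℂ) (add_mem h1 h2)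
    have h4 : (1 / 2 : ℂ) • ((1 : ℂ) ⊗ₜ[ℝ] u - Complex.I ⊗ₜ[ℝ] S.Phi x u
        + ((1 : ℂ) ⊗ₜ[ℝ] u + Complex.I ⊗ₜ[ℝ] S.Phi x u)) = (1 : ℂ) ⊗ₜ[ℝ] u := by
      module
    rwa [h4] at h3
  have hv : v = (v - S.g.inner x (S.xi x) v • S.xi x) + S.g.inner x (S.xi x) v • S.xi x := by
    abel
  rw [hv, TensorProduct.tmul_add]
  refine add_mem (key _ ?_) ?_
  · rw [mem_F, map_sub, map_smul, S.xi_unit, smul_eq_mul, mul_one, sub_self]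
  · refine Submodule.mem_sup_right (Submodule.mem_sup_right ?_)
    rw [← TensorProduct.smul_tmul, Submodule.mem_span_singleton]
    exact ⟨((S.g.inner x (S.xi x) v : ℝ) : ℂ), by
      rw [TensorProduct.smul_tmul']; simp⟩

theorem F10_sup_calF01 (x : X) : S.F10 x ⊔ S.calF01 x = ⊤ := by
  refine eq_top_iff.2 fun u _ => ?_
  rw [← tmul_cRe_add_tmul_cIm u]
  refine add_mem (S.tmul_mem_sup _) ?_
  have h := Submodule.smul_mem _ Complex.I (S.tmul_mem_sup (cIm u))
  rwa [TensorProduct.smul_tmul', smul_eq_mul, mul_one] at h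

end SasakianStructure

end SasakianAlgebra

/-! ### Complex Lie groups and holomorphic maps regarded over the reals. -/

section RestrictScalars

variable {V : Type*} [NormedAddCommGroup V] [NormedSpace ℂ V]
  {H : Type*} [TopologicalSpace H] [ChartedSpace V H]
  {V' : Type*} [NormedAddCommGroup V'] [NormedSpace ℂ V']
  {G : Type*} [TopologicalSpace G] [ChartedSpace V' G]

/-- Both models use the same charts, so it suffices to restrict scalars in the coordinate
expression. -/
theorem contMDiff_real_of_complex {f : H → G} (hf : ContMDiff 𝓘(ℂ, V) 𝓘(ℂ, V') ∞ f) :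
    ContMDiff 𝓘(ℝ, V) 𝓘(ℝ, V') ∞ f := fun x =>
  ⟨(hf x).1, ContDiffWithinAt.restrict_scalars ℝ (hf x).2⟩

theorem contMDiff_real_of_complex_prod {f : H × H → G}
    (hf : ContMDiff (𝓘(ℂ, V).prod 𝓘(ℂ, V)) 𝓘(ℂ, V') ∞ f) :
    ContMDiff (𝓘(ℝ, V).prod 𝓘(ℝ, V)) 𝓘(ℝ, V') ∞ f := fun x =>
  ⟨(hf x).1, ContDiffWithinAt.restrict_scalars ℝ (hf x).2⟩

theorem mfderiv_real_smul_I {f : H → G} {h : H}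
    (hf : MDifferentiableAt 𝓘(ℂ, V) 𝓘(ℂ, V') f h) (η : V) :
    mfderiv 𝓘(ℝ, V) 𝓘(ℝ, V') f h (Complex.I • η : V)
      = (Complex.I • (show V' from mfderiv 𝓘(ℝ, V) 𝓘(ℝ, V') f h η) : V') := by
  obtain ⟨hc, hd⟩ := hf.hasMFDerivAt
  let L : V →L[ℂ] V' := mfderiv 𝓘(ℂ, V) 𝓘(ℂ, V') f h
  have h' : HasMFDerivAt 𝓘(ℝ, V) 𝓘(ℝ, V') f h (L.restrictScalars ℝ) :=
    ⟨hc, HasFDerivWithinAt.restrictScalars ℝ hd⟩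
  rw [h'.mfderiv]
  exact L.map_smul Complex.I η

theorem contMDiff_real_mul [Group H] [LieGroup 𝓘(ℂ, V) ∞ H] :
    ContMDiff (𝓘(ℝ, V).prod 𝓘(ℝ, V)) 𝓘(ℝ, V) ∞ (fun p : H × H => p.1 * p.2) :=
  contMDiff_real_of_complex_prod (contMDiff_mul 𝓘(ℂ, V) ∞)

theorem contMDiff_real_inv [Group H] [LieGroup 𝓘(ℂ, V) ∞ H] :
    ContMDiff 𝓘(ℝ, V) 𝓘(ℝ, V) ∞ (fun p : H => p⁻¹) :=
  contMDiff_real_of_complex (contMDiff_inv 𝓘(ℂ, V) ∞)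

end RestrictScalars

/-! ### Complexified differentials of equal maps. -/

section Congruence

variable {E : Type*} [NormedAddCommGroup E] [NormedSpace ℝ E]
  {M : Type*} [TopologicalSpace M] [ChartedSpace E M]
  {E' : Type*} [NormedAddCommGroup E'] [NormedSpace ℝ E']
  {M' : Type*} [TopologicalSpace M'] [ChartedSpace E' M']

theorem cdiff_congr {f g : M → M'} (h : f = g) (x : M) (u : CTan E x) :
    cdiff E E' f x u = cdiff E E' g x u := by
  subst h
  rfl

theorem cdiff_of_eq_id {f : M → M} (h : f = id) (x : M) (u : CTan E x) :
    cdiff E E f x u = u := by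
  subst h
  have h1 : mfderiv 𝓘(ℝ, E) 𝓘(ℝ, E) (id : M → M) x = ContinuousLinearMap.id ℝ _ := mfderiv_id
  rw [cdiff, h1]
  exact DFunLike.congr_fun (LinearMap.baseChange_id (R := ℝ) (A := ℂ) (M := E)) u

end Congruence

/-! ### Fibres, translations and vertical vectors of a principal bundle. -/

section PrincipalBundles

variable {E : Type*} [NormedAddCommGroup E] [NormedSpace ℝ E] [FiniteDimensional ℝ E]
  {X : Type*} [TopologicalSpace X] [ChartedSpace E X] [IsManifold 𝓘(ℝ, E) ∞ X]
  {V : Type*} [NormedAddCommGroup V] [NormedSpace ℂ V]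
  {H : Type*} [TopologicalSpace H] [ChartedSpace V H] [Group H]
  {N : Type*} [NormedAddCommGroup N] [NormedSpace ℝ N]
  {P : Type*} [TopologicalSpace P] [ChartedSpace N P]

namespace PrincipalBundle

variable (B : PrincipalBundle E X V H N P)

theorem exists_proj_eq (x : X) : ∃ z, B.proj z = x := by
  obtain ⟨U, _, hx, σ, _, _, _, hσ, _⟩ := B.locally_trivial x
  exact ⟨σ x, hσ x hx⟩

theorem exists_act_eq {z z' : P} (h : B.proj z = B.proj z') : ∃ k, B.act z k = z' := by
  obtain ⟨U, _, hx, σ, τ, _, _, hσ, hτ, _⟩ := B.locally_trivial (B.proj z)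
  refine ⟨(τ z)⁻¹ * τ z', ?_⟩
  have h1 := hτ z hx
  have h2 := hτ z' (h ▸ hx)
  rw [← h] at h2
  calc B.act z ((τ z)⁻¹ * τ z')
      = B.act (B.act (σ (B.proj z)) (τ z)) ((τ z)⁻¹ * τ z') := by rw [h1]
    _ = z' := by rw [← B.act_mul, mul_inv_cancel_left, h2]

theorem act_injective (z : P) : Function.Injective (B.act z) := by
  obtain ⟨U, _, hx, σ, τ, _, _, hσ, hτ, hτ'⟩ := B.locally_trivial (B.proj z)
  intro h k hhk
  have key : ∀ g, τ (B.act z g) = τ z * g := fun g => by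
    calc τ (B.act z g) = τ (B.act (B.act (σ (B.proj z)) (τ z)) g) := by rw [hτ z hx]
      _ = τ z * g := by rw [← B.act_mul, hτ' _ hx]
  have h1 := congrArg τ hhk
  rw [key, key] at h1
  exact mul_left_cancel h1

theorem act_act_inv (z : P) (h : H) : B.act (B.act z h) h⁻¹ = z := by
  rw [← B.act_mul, mul_inv_cancel, B.act_one]

theorem contMDiff_act_right (h : H) : ContMDiff 𝓘(ℝ, N) 𝓘(ℝ, N) ∞ (fun y => B.act y h) :=
  B.act_smooth.comp (contMDiff_id.prodMk contMDiff_const)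

theorem contMDiff_orbit (z : P) : ContMDiff 𝓘(ℝ, V) 𝓘(ℝ, N) ∞ (fun k => B.act z k) :=
  B.act_smooth.comp (contMDiff_const.prodMk contMDiff_id)

theorem mdifferentiableAt_act_right (h : H) (z : P) :
    MDifferentiableAt 𝓘(ℝ, N) 𝓘(ℝ, N) (fun y => B.act y h) z :=
  (B.contMDiff_act_right h z).mdifferentiableAt (by simp)

theorem mdifferentiableAt_proj (z : P) : MDifferentiableAt 𝓘(ℝ, N) 𝓘(ℝ, E) B.proj z :=
  (B.proj_smooth z).mdifferentiableAt (by simp)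

theorem cdp_cdR (h : H) (z : P) (u : CTan N z) :
    B.cdp (B.act z h) (B.cdR h z u) = B.cdp z u := by
  have h1 := cdiff_comp (f := fun y => B.act y h) (B.mdifferentiableAt_proj (B.act z h))
    (B.mdifferentiableAt_act_right h z) u
  exact h1.symm.trans (cdiff_congr (funext fun y => B.proj_act y h) z u)

theorem cdR_mul (h k : H) (z : P) (u : CTan N z) :
    B.cdR (h * k) z u = B.cdR k (B.act z h) (B.cdR h z u) := by
  have h1 := cdiff_comp (f := fun y => B.act y h) (g := fun y => B.act y k)
    (B.mdifferentiableAt_act_right k (B.act z h)) (B.mdifferentiableAt_act_right h z) u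
  exact (cdiff_congr (funext fun y => B.act_mul y h k) z u).trans h1

theorem cdR_one (z : P) (u : CTan N z) : B.cdR 1 z u = u :=
  cdiff_of_eq_id (funext B.act_one) z u

/-- Differentiate `y = σ(p(y)) τ(y)` at `z`. The part coming from `σ ∘ p` kills a vertical vector,
so `v` is the image of `dτ(v)` under an orbit map. In this form the complex structure `J` can be
read off from that of the group. -/
theorem exists_orbit_of_mem_vert {z : P} {v : TangentSpace 𝓘(ℝ, N) z} (hv : v ∈ B.vert z) :
    ∃ (z₀ : P) (h : H) (η : V), B.act z₀ h = z ∧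
      (v : N) = mfderiv 𝓘(ℝ, V) 𝓘(ℝ, N) (fun k => B.act z₀ k) h η := by
  obtain ⟨U, hU, hx, σ, τ, hσs, hτs, hσ, hτ, hτ'⟩ := B.locally_trivial (B.proj z)
  have hU' : IsOpen (B.proj ⁻¹' U) := hU.preimage B.proj_smooth.continuous
  have hσd : MDifferentiableAt 𝓘(ℝ, E) 𝓘(ℝ, N) σ (B.proj z) :=
    (hσs.contMDiffAt (hU.mem_nhds hx)).mdifferentiableAt (by simp)
  have hτd : MDifferentiableAt 𝓘(ℝ, N) 𝓘(ℝ, V) τ z :=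
    (hτs.contMDiffAt (hU'.mem_nhds hx)).mdifferentiableAt (by simp)
  have hs : MDifferentiableAt 𝓘(ℝ, N) 𝓘(ℝ, N) (fun y => σ (B.proj y)) z :=
    hσd.comp z (B.mdifferentiableAt_proj z)
  have hs0 : mfderiv 𝓘(ℝ, N) 𝓘(ℝ, N) (fun y => σ (B.proj y)) z v = 0 := by
    have h1 : mfderiv 𝓘(ℝ, N) 𝓘(ℝ, N) (fun y => σ (B.proj y)) z
        = (mfderiv 𝓘(ℝ, E) 𝓘(ℝ, N) σ (B.proj z)).comp (mfderiv 𝓘(ℝ, N) 𝓘(ℝ, E) B.proj z) :=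
      mfderiv_comp z hσd (B.mdifferentiableAt_proj z)
    have hv' : mfderiv 𝓘(ℝ, N) 𝓘(ℝ, E) B.proj z v = 0 := hv
    rw [h1, ContinuousLinearMap.comp_apply, hv', map_zero]
  have ha : MDifferentiableAt (𝓘(ℝ, N).prod 𝓘(ℝ, V)) 𝓘(ℝ, N) (fun q : P × H => B.act q.1 q.2)
      (σ (B.proj z), τ z) := (B.act_smooth _).mdifferentiableAt (by simp)
  refine ⟨σ (B.proj z), τ z, mfderiv 𝓘(ℝ, N) 𝓘(ℝ, V) τ z v, hτ z hx, ?_⟩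
  have hid : mfderiv 𝓘(ℝ, N) 𝓘(ℝ, N)
      ((fun q : P × H => B.act q.1 q.2) ∘ fun y => (σ (B.proj y), τ y)) z
      = ContinuousLinearMap.id ℝ N := by
    have : ((fun q : P × H => B.act q.1 q.2) ∘ fun y => (σ (B.proj y), τ y)) =ᶠ[nhds z] id :=
      Filter.eventually_of_mem (hU'.mem_nhds hx) fun y hy => hτ y hy
    rw [this.mfderiv_eq]
    exact mfderiv_id
  rw [mfderiv_comp z ha (hs.prodMk hτd), mfderiv_prodMk hs hτd] at hid
  have h3 := DFunLike.congr_fun hid v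
  refine h3.symm.trans ?_
  refine (mfderiv_prod_eq_add_apply ha).trans ?_
  have h4 : mfderiv 𝓘(ℝ, N) 𝓘(ℝ, N) (fun y => B.act y (τ z)) (σ (B.proj z))
      (mfderiv 𝓘(ℝ, N) 𝓘(ℝ, N) (fun y => σ (B.proj y)) z v) = 0 := by
    rw [hs0]; exact map_zero _
  exact (congrArg (· + _) h4).trans (zero_add _)

end PrincipalBundle

end PrincipalBundles

/-! ### The splitting `TP ⊗ ℂ = 𝕋 ⊕ (calF ⊕ 𝕂^{0,1})`. -/

section HolomorphicPrincipal

variable {E : Type*} [NormedAddCommGroup E] [NormedSpace ℝ E] [FiniteDimensional ℝ E]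
  {X : Type*} [TopologicalSpace X] [ChartedSpace E X] [IsManifold 𝓘(ℝ, E) ∞ X]
  {m : ℕ} {S : SasakianStructure E X m}
  {V : Type*} [NormedAddCommGroup V] [NormedSpace ℂ V]
  {H : Type*} [TopologicalSpace H] [ChartedSpace V H] [Group H]
  {N : Type*} [NormedAddCommGroup N] [NormedSpace ℝ N]
  {P : Type*} [TopologicalSpace P] [ChartedSpace N P] [IsManifold 𝓘(ℝ, N) ∞ P]

namespace ComplexPrincipalBundle

variable (B : ComplexPrincipalBundle S V H N P)

/-- The vector `v - √-1 J(v)` of type `(1,0)` of a vertical vector `v`. -/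
def vec10 (z : P) (v : B.vert z) : CTan N z :=
  (1 : ℂ) ⊗ₜ[ℝ] (v : TangentSpace 𝓘(ℝ, N) z)
    - Complex.I ⊗ₜ[ℝ] (B.J z v : TangentSpace 𝓘(ℝ, N) z)

theorem vec10_add (z : P) (v w : B.vert z) :
    B.vec10 z (v + w) = B.vec10 z v + B.vec10 z w := by
  simp only [vec10, map_add, Submodule.coe_add, TensorProduct.tmul_add]
  abel

/-- Multiplication by `i` on type `(1,0)` corresponds to `J` on real vertical vectors. Thus the
vectors `v - √-1 J(v)` are closed under complex scalars, and `mem_K10` needs no span. -/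
theorem vec10_smul (z : P) (a : ℂ) (v : B.vert z) :
    B.vec10 z (a.re • v + a.im • B.J z v) = a • B.vec10 z v := by
  apply complexify_ext
  · simp [vec10, cRe_smul]
  · simp [vec10, cIm_smul, B.J_sq]
    abel

theorem mem_K10 {z : P} {w : CTan N z} : w ∈ B.K10 z ↔ ∃ v, w = B.vec10 z v := by
  constructor
  · intro hw
    induction hw using Submodule.span_induction with
    | mem x hx => exact hx
    | zero => exact ⟨0, by simp [vec10]⟩
    | add x y _ _ hx hy =>
      obtain ⟨v, rfl⟩ := hx
      obtain ⟨w, rfl⟩ := hy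
      exact ⟨v + w, (B.vec10_add z v w).symm⟩
    | smul a x _ hx =>
      obtain ⟨v, rfl⟩ := hx
      exact ⟨_, (B.vec10_smul z a v).symm⟩
  · rintro ⟨v, rfl⟩
    exact Submodule.subset_span ⟨v, rfl⟩

theorem cConj_vec10 (z : P) (v : B.vert z) :
    cConj (B.vec10 z v) = (1 : ℂ) ⊗ₜ[ℝ] (v : TangentSpace 𝓘(ℝ, N) z)
      + Complex.I ⊗ₜ[ℝ] (B.J z v : TangentSpace 𝓘(ℝ, N) z) := by
  simp [vec10, TensorProduct.neg_tmul]

theorem cConj_mem_K10 {z : P} {w : CTan N z} (hw : w ∈ B.K01 z) : cConj w ∈ B.K10 z := by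
  have h : B.K01 z ≤ conjSubmodule (B.K10 z) := by
    refine Submodule.span_le.2 ?_
    rintro _ ⟨v, rfl⟩
    rw [← B.cConj_vec10, SetLike.mem_coe, mem_conjSubmodule, cConj_cConj]
    exact B.mem_K10.2 ⟨v, rfl⟩
  exact mem_conjSubmodule.1 (h hw)

theorem mem_K01 {z : P} {w : CTan N z} : w ∈ B.K01 z ↔ cConj w ∈ B.K10 z := by
  refine ⟨B.cConj_mem_K10, fun h => ?_⟩
  obtain ⟨v, hv⟩ := B.mem_K10.1 h
  rw [← cConj_cConj w, hv, B.cConj_vec10]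
  exact Submodule.subset_span ⟨v, rfl⟩

/-- If the conjugate of `v - √-1 J(v)` is `v' - √-1 J(v')`, the real parts give `v = v'` and the
imaginary parts `J(v) = -J(v)`. So `J(v) = 0`, and `J² = -1` gives `v = 0`. -/
theorem K10_disjoint_K01 (z : P) : Disjoint (B.K10 z) (B.K01 z) := by
  rw [Submodule.disjoint_def]
  intro w hw hw'
  obtain ⟨v, rfl⟩ := B.mem_K10.1 hw
  obtain ⟨v', hv'⟩ := B.mem_K10.1 (B.mem_K01.1 hw')
  rw [B.cConj_vec10] at hv'
  have h1 := congrArg cRe hv'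
  have h2 := congrArg cIm hv'
  simp only [vec10, map_add, map_sub, cRe_tmul, cIm_tmul, Complex.one_re, Complex.one_im,
    Complex.I_re, Complex.I_im, one_smul, zero_smul, add_zero, sub_zero, zero_add,
    zero_sub] at h1 h2
  have h3 : v = v' := Subtype.ext h1
  subst h3
  have h4 : (B.J z v : TangentSpace 𝓘(ℝ, N) z) = 0 := by
    have h5 : (2 : ℝ) • (B.J z v : TangentSpace 𝓘(ℝ, N) z) = 0 := by
      rw [two_smul]
      exact eq_neg_iff_add_eq_zero.1 h2
    exact (smul_eq_zero.1 h5).resolve_left two_ne_zero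
  have h5 : B.J z v = 0 := Subtype.ext h4
  have h6 : v = 0 := by
    have := B.J_sq z v
    rw [h5, map_zero] at this
    exact (neg_eq_zero.1 this.symm)
  subst h6
  simp [vec10]

theorem cdp_vec10 (z : P) (v : B.vert z) : B.cdp z (B.vec10 z v) = 0 := by
  have h : ∀ u : B.vert z, mfderiv 𝓘(ℝ, N) 𝓘(ℝ, E) B.proj z u = 0 := fun u => u.2
  rw [vec10, map_sub, PrincipalBundle.cdp, cdiff_tmul, cdiff_tmul, h, h, TensorProduct.tmul_zero,
    TensorProduct.tmul_zero, sub_zero]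

theorem cdp_of_mem_K10 {z : P} {w : CTan N z} (hw : w ∈ B.K10 z) : B.cdp z w = 0 := by
  obtain ⟨v, rfl⟩ := B.mem_K10.1 hw
  exact B.cdp_vec10 z v

theorem cdp_cConj (z : P) (w : CTan N z) : B.cdp z (cConj w) = cConj (B.cdp z w) :=
  (cConj_cdiff _ _ _).symm

theorem cdp_of_mem_K01 {z : P} {w : CTan N z} (hw : w ∈ B.K01 z) : B.cdp z w = 0 := by
  have := B.cdp_of_mem_K10 (B.mem_K01.1 hw)
  rw [cdp_cConj] at this
  rw [← cConj_cConj (B.cdp z w), this, map_zero]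

theorem tmul_mem_K10_sup_K01 {z : P} (v : B.vert z) :
    (1 : ℂ) ⊗ₜ[ℝ] (v : TangentSpace 𝓘(ℝ, N) z) ∈ B.K10 z ⊔ B.K01 z := by
  have h1 : B.vec10 z v ∈ B.K10 z ⊔ B.K01 z := Submodule.mem_sup_left (B.mem_K10.2 ⟨v, rfl⟩)
  have h2 : cConj (B.vec10 z v) ∈ B.K10 z ⊔ B.K01 z :=
    Submodule.mem_sup_right (B.mem_K01.2 (by rw [cConj_cConj]; exact B.mem_K10.2 ⟨v, rfl⟩))
  have h3 := Submodule.smul_mem _ (1 / 2 : ℂ) (add_mem h1 h2)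
  have h4 : (1 / 2 : ℂ) • (B.vec10 z v + cConj (B.vec10 z v))
      = (1 : ℂ) ⊗ₜ[ℝ] (v : TangentSpace 𝓘(ℝ, N) z) := by
    rw [B.cConj_vec10, vec10]
    module
  rwa [h4] at h3

theorem mem_K10_sup_K01_of_cdp_eq_zero {z : P} {w : CTan N z} (hw : B.cdp z w = 0) :
    w ∈ B.K10 z ⊔ B.K01 z := by
  have hr : cRe w ∈ B.vert z := (cRe_cdiff B.proj z w).symm.trans ((congrArg cRe hw).trans
    (map_zero _))
  have hi : cIm w ∈ B.vert z := (cIm_cdiff B.proj z w).symm.trans ((congrArg cIm hw).trans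
    (map_zero _))
  rw [← tmul_cRe_add_tmul_cIm w]
  refine add_mem (B.tmul_mem_K10_sup_K01 ⟨_, hr⟩) ?_
  have h := Submodule.smul_mem _ Complex.I (B.tmul_mem_K10_sup_K01 ⟨_, hi⟩)
  rwa [TensorProduct.smul_tmul', smul_eq_mul, mul_one] at h

theorem dR_mem_vert (h : H) {z : P} {v : TangentSpace 𝓘(ℝ, N) z} (hv : v ∈ B.vert z) :
    B.dR h z v ∈ B.vert (B.act z h) := by
  have h1 := mfderiv_comp z (B.mdifferentiableAt_proj (B.act z h))
    (B.mdifferentiableAt_act_right h z)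
  have h2 : B.proj ∘ (fun y => B.act y h) = B.proj := funext fun y => B.proj_act y h
  rw [h2] at h1
  exact (DFunLike.congr_fun h1 v).symm.trans hv

theorem cdR_mem_K10 (h : H) {z : P} {w : CTan N z} (hw : w ∈ B.K10 z) :
    B.cdR h z w ∈ B.K10 (B.act z h) := by
  obtain ⟨v, rfl⟩ := B.mem_K10.1 hw
  refine B.mem_K10.2 ⟨⟨B.dR h z v, B.dR_mem_vert h v.2⟩, ?_⟩
  have hJ := B.J_translation z h v ⟨B.dR h z v, B.dR_mem_vert h v.2⟩ rfl
  rw [vec10, vec10, hJ, map_sub]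
  rfl

theorem cdR_cConj (h : H) (z : P) (w : CTan N z) : B.cdR h z (cConj w) = cConj (B.cdR h z w) :=
  (cConj_cdiff _ _ _).symm

theorem cdR_mem_K01 (h : H) {z : P} {w : CTan N z} (hw : w ∈ B.K01 z) :
    B.cdR h z w ∈ B.K01 (B.act z h) := by
  rw [mem_K01] at hw ⊢
  rw [← cdR_cConj]
  exact B.cdR_mem_K10 h hw

end ComplexPrincipalBundle

namespace HolPrincipalBundle

variable (B : HolPrincipalBundle S V H N P)

theorem cdp_injOn_calF (z : P) : Set.InjOn (B.cdp z) (B.calF z) := (B.calF_iso z).injOn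

theorem cdp_mem_calF01 {z : P} {w : CTan N z} (hw : w ∈ B.calF z) :
    B.cdp z w ∈ S.calF01 (B.proj z) := (B.calF_iso z).mapsTo hw

theorem exists_calF_lift (z : P) {c : CTan E (B.proj z)} (hc : c ∈ S.calF01 (B.proj z)) :
    ∃ w ∈ B.calF z, B.cdp z w = c := (B.calF_iso z).surjOn hc

theorem cdR_mem_calF (h : H) {z : P} {w : CTan N z} (hw : w ∈ B.calF z) :
    B.cdR h z w ∈ B.calF (B.act z h) :=
  (B.calF_invariant z h) ▸ Submodule.mem_map_of_mem hw

theorem cdR_mem_calF_sup_K01 (h : H) {z : P} {w : CTan N z} (hw : w ∈ B.calF z ⊔ B.K01 z) :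
    B.cdR h z w ∈ B.calF (B.act z h) ⊔ B.K01 (B.act z h) := by
  obtain ⟨a, ha, b, hb, rfl⟩ := Submodule.mem_sup.1 hw
  rw [map_add]
  exact add_mem (Submodule.mem_sup_left (B.cdR_mem_calF h ha))
    (Submodule.mem_sup_right (B.cdR_mem_K01 h hb))

theorem mem_conj_FF {z : P} {w : CTan N z} :
    w ∈ conjSubmodule (B.FF z) ↔ cConj w ∈ B.calF z ∧ B.cdp z w ∈ S.F10 (B.proj z) := by
  rw [mem_conjSubmodule]
  constructor
  · rintro ⟨h1, h2⟩
    refine ⟨h1, ?_⟩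
    have h3 := S.cConj_mem_F10 (show B.cdp z (cConj w) ∈ S.F01 (B.proj z) from h2)
    rwa [B.cdp_cConj, cConj_cConj] at h3
  · rintro ⟨h1, h2⟩
    refine ⟨h1, ?_⟩
    have h3 := S.cConj_mem_F01 h2
    rw [← B.cdp_cConj] at h3
    exact h3

theorem eq_of_mem_conj_FF {z : P} {w w' : CTan N z} (hw : w ∈ conjSubmodule (B.FF z))
    (hw' : w' ∈ conjSubmodule (B.FF z)) (h : B.cdp z w = B.cdp z w') : w = w' := by
  have h1 := B.cdp_injOn_calF z (B.mem_conj_FF.1 hw).1 (B.mem_conj_FF.1 hw').1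
    (by rw [B.cdp_cConj, B.cdp_cConj, h])
  rw [← cConj_cConj w, h1, cConj_cConj]

theorem exists_conj_FF_lift (z : P) {f : CTan E (B.proj z)} (hf : f ∈ S.F10 (B.proj z)) :
    ∃ w ∈ conjSubmodule (B.FF z), B.cdp z w = f := by
  obtain ⟨u, hu, huf⟩ := B.exists_calF_lift z (S.F01_le_calF01 _ (S.cConj_mem_F01 hf))
  have h : B.cdp z (cConj u) = f := by rw [B.cdp_cConj, huf, cConj_cConj]
  exact ⟨cConj u, B.mem_conj_FF.2 ⟨by rwa [cConj_cConj], h ▸ hf⟩, h⟩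

theorem cdR_mem_conj_FF (h : H) {z : P} {w : CTan N z} (hw : w ∈ conjSubmodule (B.FF z)) :
    B.cdR h z w ∈ conjSubmodule (B.FF (B.act z h)) := by
  rw [mem_conj_FF] at hw ⊢
  refine ⟨?_, ?_⟩
  · rw [← B.cdR_cConj]
    exact B.cdR_mem_calF h hw.1
  · have h1 := hw.2
    rw [← B.cdp_cdR h z w] at h1
    rw [B.proj_act]
    exact h1

theorem cdR_mem_TT (h : H) {z : P} {w : CTan N z} (hw : w ∈ B.TT z) :
    B.cdR h z w ∈ B.TT (B.act z h) := by
  obtain ⟨a, ha, b, hb, rfl⟩ := Submodule.mem_sup.1 hw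
  rw [map_add]
  exact add_mem (Submodule.mem_sup_left (B.cdR_mem_K10 h ha))
    (Submodule.mem_sup_right (B.cdR_mem_conj_FF h hb))

theorem cdp_mem_F10 {z : P} {w : CTan N z} (hw : w ∈ B.TT z) :
    B.cdp z w ∈ S.F10 (B.proj z) := by
  obtain ⟨a, ha, b, hb, rfl⟩ := Submodule.mem_sup.1 hw
  rw [map_add, B.cdp_of_mem_K10 ha, zero_add]
  exact (B.mem_conj_FF.1 hb).2

/-- Exactness of the Atiyah sequence in the middle, before division by the group: `dp` is injective
on `conj 𝔽`. -/
theorem mem_K10_of_mem_TT {z : P} {w : CTan N z} (hw : w ∈ B.TT z) (h : B.cdp z w = 0) :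
    w ∈ B.K10 z := by
  obtain ⟨a, ha, b, hb, rfl⟩ := Submodule.mem_sup.1 hw
  rw [map_add, B.cdp_of_mem_K10 ha, zero_add] at h
  have hb0 : b = 0 := B.eq_of_mem_conj_FF hb (zero_mem _) (by rw [h, map_zero])
  rwa [hb0, add_zero]

theorem K10_le_TT (z : P) : B.K10 z ≤ B.TT z := le_sup_left

theorem conj_FF_le_TT (z : P) : conjSubmodule (B.FF z) ≤ B.TT z := le_sup_right

theorem cdp_mem_calF01_of_mem_sup {z : P} {w : CTan N z} (hw : w ∈ B.calF z ⊔ B.K01 z) :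
    B.cdp z w ∈ S.calF01 (B.proj z) := by
  obtain ⟨a, ha, b, hb, rfl⟩ := Submodule.mem_sup.1 hw
  rw [map_add, B.cdp_of_mem_K01 hb, add_zero]
  exact B.cdp_mem_calF01 ha

theorem mem_K01_of_mem_sup {z : P} {w : CTan N z} (hw : w ∈ B.calF z ⊔ B.K01 z)
    (h : B.cdp z w = 0) : w ∈ B.K01 z := by
  obtain ⟨a, ha, b, hb, rfl⟩ := Submodule.mem_sup.1 hw
  rw [map_add, B.cdp_of_mem_K01 hb, add_zero] at h
  have ha0 : a = 0 := B.cdp_injOn_calF z ha (zero_mem _) (by rw [h, map_zero])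
  rwa [ha0, zero_add]

/-- Project to `X`, where `F^{1,0}` and `𝓕^{0,1}` meet in zero. A common vector is therefore
vertical, of both types at once. -/
theorem TT_disjoint (z : P) : Disjoint (B.TT z) (B.calF z ⊔ B.K01 z) := by
  rw [Submodule.disjoint_def]
  intro w hw hw'
  have h := (Submodule.disjoint_def.1 (S.F10_disjoint_calF01 (B.proj z))) _ (B.cdp_mem_F10 hw)
    (B.cdp_mem_calF01_of_mem_sup hw')
  exact (Submodule.disjoint_def.1 (B.K10_disjoint_K01 z)) _ (B.mem_K10_of_mem_TT hw h)
    (B.mem_K01_of_mem_sup hw' h)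

/-- Split `dp(u)` on the base and lift its two parts to `conj 𝔽` and `calF`. What remains of `u` is
vertical and splits by type. -/
theorem exists_TT_component (z : P) (u : CTan N z) :
    ∃ w ∈ B.TT z, u - w ∈ B.calF z ⊔ B.K01 z := by
  have hu : B.cdp z u ∈ S.F10 (B.proj z) ⊔ S.calF01 (B.proj z) := by
    rw [S.F10_sup_calF01]; trivial
  obtain ⟨f, hf, c, hc, hfc⟩ := Submodule.mem_sup.1 hu
  obtain ⟨a, ha, haf⟩ := B.exists_conj_FF_lift z hf
  obtain ⟨b, hb, hbc⟩ := B.exists_calF_lift z hc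
  have h0 : B.cdp z (u - a - b) = 0 := by
    rw [map_sub, map_sub, haf, hbc, ← hfc]
    abel
  obtain ⟨k, hk, l, hl, hkl⟩ := Submodule.mem_sup.1 (B.mem_K10_sup_K01_of_cdp_eq_zero h0)
  refine ⟨k + a, add_mem (B.K10_le_TT z hk) (B.conj_FF_le_TT z ha), ?_⟩
  have h1 : u - (k + a) = b + l := by
    have h2 : u = (k + l) + a + b := by rw [hkl]; abel
    rw [h2]
    abel
  rw [h1]
  exact add_mem (Submodule.mem_sup_left hb) (Submodule.mem_sup_right hl)

theorem eq_of_TT_components {z : P} {u w w' : CTan N z} (hw : w ∈ B.TT z) (hw' : w' ∈ B.TT z)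
    (h : u - w ∈ B.calF z ⊔ B.K01 z) (h' : u - w' ∈ B.calF z ⊔ B.K01 z) : w = w' := by
  have h1 := sub_mem h' h
  have h2 : u - w' - (u - w) = w - w' := by abel
  rw [h2] at h1
  exact sub_eq_zero.1 ((Submodule.disjoint_def.1 (B.TT_disjoint z)) _ (sub_mem hw hw') h1)

end HolPrincipalBundle

end HolomorphicPrincipal

/-! ### Smooth dependence of coefficients, by Cramer's rule. -/

section Coefficients

variable {E : Type*} [NormedAddCommGroup E] [NormedSpace ℝ E]
  {M : Type*} [TopologicalSpace M] [ChartedSpace E M]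
  {F : Type*} [NormedAddCommGroup F] [NormedSpace ℝ F] [FiniteDimensional ℝ F]

theorem contDiff_matrix_det (r : ℕ) :
    ContDiff ℝ ∞ (fun A : Fin r → Fin r → ℂ => (Matrix.of A).det) := by
  simp only [Matrix.det_apply, Matrix.of_apply]
  refine ContDiff.sum fun σ _ => ContDiff.const_smul _ (contDiff_prod fun i _ => ?_)
  exact (contDiff_apply ℝ ℂ i).comp (contDiff_apply ℝ (Fin r → ℂ) (σ i))

theorem contMDiffAt_matrix_det {r : ℕ} {A : M → Matrix (Fin r) (Fin r) ℂ} {z₀ : M}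
    (hA : ∀ i j, ContMDiffAt 𝓘(ℝ, E) 𝓘(ℝ, ℂ) ∞ (fun z => A z i j) z₀) :
    ContMDiffAt 𝓘(ℝ, E) 𝓘(ℝ, ℂ) ∞ (fun z => (A z).det) z₀ := by
  have h : ContMDiffAt 𝓘(ℝ, E) 𝓘(ℝ, Fin r → Fin r → ℂ) ∞
      (fun z i j => A z i j) z₀ :=
    contMDiffAt_pi_space.2 fun i => contMDiffAt_pi_space.2 fun j => hA i j
  exact ContMDiffAt.comp (g := fun A : Fin r → Fin r → ℂ => (Matrix.of A).det)
    (f := fun z i j => A z i j) z₀ (contDiff_matrix_det r).contDiffAt.contMDiffAt h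

/-- The coefficients of a smooth vector with respect to smooth independent vectors are smooth. -/
theorem contMDiffAt_coefficients {r : ℕ} {c : M → Fin r → ℂ} {β : M → Fin r → ℂ ⊗[ℝ] F}
    {b : M → ℂ ⊗[ℝ] F} {z₀ : M}
    (hβr : ∀ i, ContMDiffAt 𝓘(ℝ, E) 𝓘(ℝ, F) ∞ (fun z => cRe (β z i)) z₀)
    (hβi : ∀ i, ContMDiffAt 𝓘(ℝ, E) 𝓘(ℝ, F) ∞ (fun z => cIm (β z i)) z₀)
    (hbr : ContMDiffAt 𝓘(ℝ, E) 𝓘(ℝ, F) ∞ (fun z => cRe (b z)) z₀)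
    (hbi : ContMDiffAt 𝓘(ℝ, E) 𝓘(ℝ, F) ∞ (fun z => cIm (b z)) z₀)
    (hsum : ∀ᶠ z in nhds z₀, ∑ i, c z i • β z i = b z) (hli : LinearIndependent ℂ (β z₀))
    (i : Fin r) : ContMDiffAt 𝓘(ℝ, E) 𝓘(ℝ, ℂ) ∞ (fun z => c z i) z₀ := by
  -- `L` is a fixed left inverse of the frame at `z₀`. Being constant in `z`, it preserves
  -- smoothness and turns the frame into a square matrix.
  obtain ⟨L, hL⟩ := (Fintype.linearCombination ℂ (β z₀)).exists_leftInverse_of_injective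
    (LinearMap.ker_eq_bot.2 (linearIndependent_iff_injective_fintypeLinearCombination.1 hli))
  have smooth_L : ∀ (w : M → ℂ ⊗[ℝ] F) (k : Fin r),
      ContMDiffAt 𝓘(ℝ, E) 𝓘(ℝ, F) ∞ (fun z => cRe (w z)) z₀ →
      ContMDiffAt 𝓘(ℝ, E) 𝓘(ℝ, F) ∞ (fun z => cIm (w z)) z₀ →
      ContMDiffAt 𝓘(ℝ, E) 𝓘(ℝ, ℂ) ∞ (fun z => L (w z) k) z₀ := by
    intro w k hr hi
    let ℓ : F →ₗ[ℝ] ℂ := (LinearMap.proj k ∘ₗ L).restrictScalars ℝ ∘ₗ TensorProduct.mk ℝ ℂ F 1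
    let ℓc : F →L[ℝ] ℂ := LinearMap.toContinuousLinearMap ℓ
    have hℓ : ∀ z, L (w z) k = ℓc (cRe (w z)) + Complex.I * ℓc (cIm (w z)) := by
      intro z
      have h1 : L (Complex.I ⊗ₜ[ℝ] cIm (w z)) k = Complex.I * L ((1 : ℂ) ⊗ₜ[ℝ] cIm (w z)) k := by
        have h2 : Complex.I ⊗ₜ[ℝ] cIm (w z) = Complex.I • ((1 : ℂ) ⊗ₜ[ℝ] cIm (w z)) := by
          rw [TensorProduct.smul_tmul', smul_eq_mul, mul_one]
        rw [h2, map_smul, Pi.smul_apply, smul_eq_mul]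
      conv_lhs => rw [← tmul_cRe_add_tmul_cIm (w z)]
      rw [map_add, Pi.add_apply, h1]
      rfl
    have h3 : ContMDiffAt 𝓘(ℝ, E) 𝓘(ℝ, ℂ) ∞
        (fun z => ℓc (cRe (w z)) + Complex.I * ℓc (cIm (w z))) z₀ := by
      have h4 : ContDiff ℝ ∞ (fun p : F × F => ℓc p.1 + Complex.I * ℓc p.2) := by fun_prop
      exact h4.contDiffAt.contMDiffAt.comp z₀ (hr.prodMk_space hi)
    exact h3.congr_of_eventuallyEq (Filter.Eventually.of_forall hℓ)
  -- This matrix is the identity at `z₀`, so its determinant does not vanish nearby.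
  let A : M → Matrix (Fin r) (Fin r) ℂ := fun z => Matrix.of fun k i => L (β z i) k
  have hA : ∀ k i, ContMDiffAt 𝓘(ℝ, E) 𝓘(ℝ, ℂ) ∞ (fun z => A z k i) z₀ := fun k i =>
    smooth_L (fun z => β z i) k (hβr i) (hβi i)
  have hA0 : A z₀ = 1 := by
    ext k i
    have h1 := DFunLike.congr_fun hL (Pi.single i 1)
    simp only [LinearMap.comp_apply, Fintype.linearCombination_apply_single, one_smul,
      LinearMap.id_apply] at h1
    simp only [A, Matrix.of_apply, h1, Matrix.one_apply, Pi.single_apply]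
  have hdet := contMDiffAt_matrix_det hA
  have hdet0 : (A z₀).det ≠ 0 := by rw [hA0, Matrix.det_one]; exact one_ne_zero
  have hcr : ContMDiffAt 𝓘(ℝ, E) 𝓘(ℝ, ℂ) ∞
      (fun z => ((A z).updateCol i (L (b z))).det) z₀ := by
    refine contMDiffAt_matrix_det fun k l => ?_
    by_cases hl : l = i
    · subst hl
      simpa only [Matrix.updateCol_self] using smooth_L b k hbr hbi
    · simpa only [Matrix.updateCol_ne hl] using hA k l
  have hquot : ContMDiffAt 𝓘(ℝ, E) 𝓘(ℝ, ℂ) ∞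
      (fun z => (A z).det⁻¹ * ((A z).updateCol i (L (b z))).det) z₀ := by
    have h4 : ContDiffAt ℝ ∞ (fun p : ℂ × ℂ => p.1⁻¹ * p.2)
        ((A z₀).det, ((A z₀).updateCol i (L (b z₀))).det) :=
      (contDiffAt_fst.inv hdet0).mul contDiffAt_snd
    exact h4.contMDiffAt.comp z₀ (hdet.prodMk_space hcr)
  refine hquot.congr_of_eventuallyEq ?_
  filter_upwards [hsum, hdet.continuousAt.eventually_ne hdet0] with z hz hz0
  have h1 : L (b z) = (A z).mulVec (c z) := by
    rw [← hz, map_sum]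
    ext k
    simp only [map_smul, Finset.sum_apply, Pi.smul_apply, smul_eq_mul, Matrix.mulVec, dotProduct, A,
      Matrix.of_apply, mul_comm]
  -- The coefficients solve `A(z) c(z) = L(b(z))`; Cramer's rule exhibits them as quotients of
  -- smooth determinants.
  have h2 : Matrix.cramer (A z) (L (b z)) = (A z).det • c z := by
    rw [h1, Matrix.cramer_eq_adjugate_mulVec, Matrix.mulVec_mulVec, Matrix.adjugate_mul,
      Matrix.smul_mulVec, Matrix.one_mulVec]
  have h3 := congrFun h2 i
  rw [Matrix.cramer_apply, Pi.smul_apply, smul_eq_mul] at h3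
  rw [h3, inv_mul_cancel_left₀ hz0]

end Coefficients

/-! ### Smoothness of lifts to a complex distribution. -/

section SmoothLifts

variable {E : Type*} [NormedAddCommGroup E] [NormedSpace ℝ E]
  {M : Type*} [TopologicalSpace M] [ChartedSpace E M] [IsManifold 𝓘(ℝ, E) ∞ M]
  {E' : Type*} [NormedAddCommGroup E'] [NormedSpace ℝ E'] [FiniteDimensional ℝ E']
  {M' : Type*} [TopologicalSpace M'] [ChartedSpace E' M'] [IsManifold 𝓘(ℝ, E') ∞ M']

/-- A section of a smooth complex distribution on which the differential of `f` is injective is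
smooth if its image under the differential of `f` is smooth along `f`. -/
theorem smoothCVF_of_cdiff_smooth {f : M → M'} (hf : ContMDiff 𝓘(ℝ, E) 𝓘(ℝ, E') ∞ f) {r : ℕ}
    {D : ∀ z : M, Submodule ℂ (CTan E z)} (hD : IsSmoothCDistribution D r)
    (hinj : ∀ z, ∀ w ∈ D z, cdiff E E' f z w = 0 → w = 0) {W : Set M} (hW : IsOpen W)
    {A : ∀ z : M, CTan E z} (hA : ∀ z ∈ W, A z ∈ D z)
    (hr : ContMDiffOn 𝓘(ℝ, E) 𝓘(ℝ, E').tangent ∞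
      (fun z => (⟨f z, cRe (cdiff E E' f z (A z))⟩ : TangentBundle 𝓘(ℝ, E') M')) W)
    (hi : ContMDiffOn 𝓘(ℝ, E) 𝓘(ℝ, E').tangent ∞
      (fun z => (⟨f z, cIm (cdiff E E' f z (A z))⟩ : TangentBundle 𝓘(ℝ, E') M')) W) :
    SmoothCVF W A := by
  suffices h : ∀ z₀ ∈ W,
      ContMDiffAt 𝓘(ℝ, E) 𝓘(ℝ, E).tangent ∞
        (fun z => (⟨z, cRe (A z)⟩ : TangentBundle 𝓘(ℝ, E) M)) z₀ ∧
      ContMDiffAt 𝓘(ℝ, E) 𝓘(ℝ, E).tangent ∞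
        (fun z => (⟨z, cIm (A z)⟩ : TangentBundle 𝓘(ℝ, E) M)) z₀ from
    ⟨fun z hz => (h z hz).1.contMDiffWithinAt, fun z hz => (h z hz).2.contMDiffWithinAt⟩
  intro z₀ hz₀
  obtain ⟨U, hU, hzU, e, he, hspan⟩ := hD z₀
  have hUn : ∀ᶠ z in nhds z₀, z ∈ U := hU.mem_nhds hzU
  have hWn : ∀ᶠ z in nhds z₀, z ∈ W := hW.mem_nhds hz₀
  -- The coefficients are chosen pointwise, with value `0` outside `U ∩ W`. Their smoothness is
  -- derived below from their uniqueness.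
  have hex : ∀ z, ∃ c : Fin r → ℂ, z ∈ U → z ∈ W → ∑ i, c i • e i z = A z := by
    intro z
    by_cases hz : z ∈ U ∧ z ∈ W
    · have h1 := hA z hz.2
      rw [← (hspan z hz.1).2] at h1
      obtain ⟨c, hc⟩ := (Submodule.mem_span_range_iff_exists_fun ℂ).1 h1
      exact ⟨c, fun _ _ => hc⟩
    · exact ⟨0, fun h h' => absurd ⟨h, h'⟩ hz⟩
  choose c hc using hex
  let t := trivializationAt E' (fun y : M' => TangentSpace 𝓘(ℝ, E') y) (f z₀)
  have ht : ∀ᶠ z in nhds z₀, f z ∈ t.baseSet :=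
    hf.continuous.continuousAt.eventually_mem
      (t.open_baseSet.mem_nhds (FiberBundle.mem_baseSet_trivializationAt' (f z₀)))
  -- `T z` is `df` read in a trivialization of the target's tangent bundle, so it takes values in a
  -- fixed space. It is injective on `D z₀` and keeps the frame independent there.
  let T : ∀ z : M, CTan E z →ₗ[ℂ] ℂ ⊗[ℝ] E' := fun z =>
    (t.linearMapAt ℝ (f z)).baseChange ℂ ∘ₗ cdiff E E' f z
  have hTr : ∀ z (u : CTan E z), cRe (T z u) = t.linearMapAt ℝ (f z) (cRe (cdiff E E' f z u)) :=
    fun z u => cRe_baseChange _ _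
  have hTi : ∀ z (u : CTan E z), cIm (T z u) = t.linearMapAt ℝ (f z) (cIm (cdiff E E' f z u)) :=
    fun z u => cIm_baseChange _ _
  have hcoord : ∀ u : ∀ z : M, TangentSpace 𝓘(ℝ, E') (f z),
      ContMDiffAt 𝓘(ℝ, E) 𝓘(ℝ, E').tangent ∞
        (fun z => (⟨f z, u z⟩ : TangentBundle 𝓘(ℝ, E') M')) z₀ →
      ContMDiffAt 𝓘(ℝ, E) 𝓘(ℝ, E') ∞ (fun z => t.linearMapAt ℝ (f z) (u z)) z₀ := by
    intro u hu
    refine (Bundle.contMDiffAt_totalSpace.1 hu).2.congr_of_eventuallyEq ?_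
    filter_upwards [ht] with z hz
    rw [t.coe_linearMapAt_of_mem hz]
  have htan : ∀ u : ∀ z : M, TangentSpace 𝓘(ℝ, E) z, SmoothVF U u →
      ContMDiffAt 𝓘(ℝ, E) 𝓘(ℝ, E').tangent ∞
        (fun z => (⟨f z, mfderiv 𝓘(ℝ, E) 𝓘(ℝ, E') f z (u z)⟩ : TangentBundle 𝓘(ℝ, E') M')) z₀ :=
    fun u hu => (hf.contMDiff_tangentMap (m := ∞) le_rfl).contMDiffAt.comp z₀
      (hu.contMDiffAt (hU.mem_nhds hzU))
  have hcoef : ∀ i, ContMDiffAt 𝓘(ℝ, E) 𝓘(ℝ, ℂ) ∞ (fun z => c z i) z₀ := by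
    refine contMDiffAt_coefficients (β := fun z i => T z (e i z)) (b := fun z => T z (A z))
      (fun i => ?_) (fun i => ?_) ?_ ?_ ?_ ?_
    · simp only [hTr, cRe_cdiff]
      exact hcoord _ (htan _ (he i).1)
    · simp only [hTi, cIm_cdiff]
      exact hcoord _ (htan _ (he i).2)
    · simp only [hTr]
      exact hcoord _ (hr.contMDiffAt (hW.mem_nhds hz₀))
    · simp only [hTi]
      exact hcoord _ (hi.contMDiffAt (hW.mem_nhds hz₀))
    · filter_upwards [hUn, hWn] with z h1 h2
      rw [← hc z h1 h2, map_sum]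
      simp only [map_smul]
    · have h1 := (hspan z₀ hzU).1
      refine LinearIndependent.map_injOn (v := fun i => e i z₀) h1 (T z₀) ?_
      rw [(hspan z₀ hzU).2]
      intro u hu u' hu' huu'
      refine sub_eq_zero.1 (hinj z₀ _ (sub_mem hu hu') ?_)
      have h2 : T z₀ (u - u') = 0 := by rw [map_sub, huu', sub_self]
      have htinj : ∀ y : TangentSpace 𝓘(ℝ, E') (f z₀), t.linearMapAt ℝ (f z₀) y = 0 → y = 0 := by
        intro y hy
        have h3 := t.symmₗ_linearMapAt (R := ℝ) ht.self_of_nhds y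
        rw [hy, map_zero] at h3
        exact h3.symm
      apply complexify_ext
      · rw [map_zero]
        exact htinj _ ((hTr _ _).symm.trans ((congrArg cRe h2).trans (map_zero _)))
      · rw [map_zero]
        exact htinj _ ((hTi _ _).symm.trans ((congrArg cIm h2).trans (map_zero _)))
  have hre : ∀ i, ContMDiffAt 𝓘(ℝ, E) 𝓘(ℝ, ℝ) ∞ (fun z => (c z i).re) z₀ := fun i =>
    Complex.reCLM.contDiff.contDiffAt.contMDiffAt.comp z₀ (hcoef i)
  have him : ∀ i, ContMDiffAt 𝓘(ℝ, E) 𝓘(ℝ, ℝ) ∞ (fun z => (c z i).im) z₀ := fun i =>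
    Complex.imCLM.contDiff.contDiffAt.contMDiffAt.comp z₀ (hcoef i)
  have her := fun i => (he i).1.contMDiffAt (hU.mem_nhds hzU)
  have hei := fun i => (he i).2.contMDiffAt (hU.mem_nhds hzU)
  constructor
  · refine ContMDiffAt.congr_of_eventuallyEq (ContMDiffAt.sum_section (s := Finset.univ)
      (t := fun i z => (c z i).re • cRe (e i z) - (c z i).im • cIm (e i z)) fun i _ =>
        ((hre i).smul_section (her i)).sub_section ((him i).smul_section (hei i))) ?_
    filter_upwards [hUn, hWn] with z h1 h2
    simp only [← hc z h1 h2, map_sum, cRe_smul]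
  · refine ContMDiffAt.congr_of_eventuallyEq (ContMDiffAt.sum_section (s := Finset.univ)
      (t := fun i z => (c z i).re • cIm (e i z) + (c z i).im • cRe (e i z)) fun i _ =>
        ((hre i).smul_section (hei i)).add_section ((him i).smul_section (her i))) ?_
    filter_upwards [hUn, hWn] with z h1 h2
    simp only [← hc z h1 h2, map_sum, cIm_smul]

end SmoothLifts

/-! ### Invariant fields, the projection `d'p` and its smooth splitting. -/

section AtiyahBundle

variable {E : Type*} [NormedAddCommGroup E] [NormedSpace ℝ E] [FiniteDimensional ℝ E]
  {X : Type*} [TopologicalSpace X] [ChartedSpace E X] [IsManifold 𝓘(ℝ, E) ∞ X]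
  {m : ℕ} {S : SasakianStructure E X m}
  {V : Type*} [NormedAddCommGroup V] [NormedSpace ℂ V]
  {H : Type*} [TopologicalSpace H] [ChartedSpace V H] [Group H]
  {N : Type*} [NormedAddCommGroup N] [NormedSpace ℝ N]
  {P : Type*} [TopologicalSpace P] [ChartedSpace N P] [IsManifold 𝓘(ℝ, N) ∞ P]

namespace HolPrincipalBundle

variable (B : HolPrincipalBundle S V H N P)

/-- `vT` lifts the section `v` of `𝓕^{0,1}` to `calF` over `U`. -/
def IsLift (U : Set X) (v : ∀ x : X, CTan E x) (vT : ∀ z : P, CTan N z) : Prop :=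
  ∀ z, B.proj z ∈ U → vT z ∈ B.calF z ∧ B.cdp z (vT z) = v (B.proj z)

variable {B}

theorem isOpen_preimage {U : Set X} (hU : IsOpen U) : IsOpen (B.proj ⁻¹' U) :=
  hU.preimage B.proj_smooth.continuous

/-- The image of the lift under `dp` is `v ∘ p`, which is smooth, and `dp` is injective on the
smooth distribution `calF`. -/
theorem IsLift.smooth {U : Set X} (hU : IsOpen U) {v : ∀ x : X, CTan E x} (hv : SmoothCVF U v)
    {vT : ∀ z : P, CTan N z} (h : B.IsLift U v vT) : SmoothCVF (B.proj ⁻¹' U) vT := by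
  refine smoothCVF_of_cdiff_smooth B.proj_smooth B.calF_smooth (fun z w hw h0 =>
    B.cdp_injOn_calF z hw (zero_mem _) (h0.trans (map_zero (B.cdp z)).symm)) (isOpen_preimage hU)
    (fun z hz => (h z hz).1) ?_ ?_
  · refine ContMDiffOn.congr (ContMDiffOn.comp hv.1 B.proj_smooth.contMDiffOn fun z hz => hz) ?_
    intro z hz
    have h1 : cdiff N E B.proj z (vT z) = v (B.proj z) := (h z hz).2
    simp only [h1, Function.comp_apply]
  · refine ContMDiffOn.congr (ContMDiffOn.comp hv.2 B.proj_smooth.contMDiffOn fun z hz => hz) ?_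
    intro z hz
    have h1 : cdiff N E B.proj z (vT z) = v (B.proj z) := (h z hz).2
    simp only [h1, Function.comp_apply]

theorem exists_isLift {U : Set X} {v : ∀ x : X, CTan E x} (hv : ∀ x ∈ U, v x ∈ S.calF01 x) :
    ∃ vT, B.IsLift U v vT := by
  have h : ∀ z, ∃ w : CTan N z, B.proj z ∈ U → w ∈ B.calF z ∧ B.cdp z w = v (B.proj z) := by
    intro z
    by_cases hz : B.proj z ∈ U
    · obtain ⟨w, hw⟩ := B.exists_calF_lift z (hv _ hz)
      exact ⟨w, fun _ => hw⟩
    · exact ⟨0, fun h => absurd h hz⟩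
  choose vT hvT using h
  exact ⟨vT, hvT⟩

theorem IsLift.eq {U : Set X} {v : ∀ x : X, CTan E x} {vT vT' : ∀ z : P, CTan N z}
    (h : B.IsLift U v vT) (h' : B.IsLift U v vT') {z : P} (hz : B.proj z ∈ U) : vT z = vT' z :=
  B.cdp_injOn_calF z (h z hz).1 (h' z hz).1 ((h z hz).2.trans (h' z hz).2.symm)

/-- Both sides lie in the invariant distribution `calF` and project to the same vector, so
injectivity of `dp` on `calF` identifies them. -/
theorem IsLift.equivariant {U : Set X} {v : ∀ x : X, CTan E x} {vT : ∀ z : P, CTan N z}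
    (h : B.IsLift U v vT) {z : P} (hz : B.proj z ∈ U) (k : H) :
    B.cdR k z (vT z) = vT (B.act z k) := by
  have hz' : B.proj (B.act z k) ∈ U := by rwa [B.proj_act]
  refine B.cdp_injOn_calF _ (B.cdR_mem_calF k (h z hz).1) (h _ hz').1 ?_
  refine (B.cdp_cdR k z (vT z)).trans ((h z hz).2.trans (Eq.trans ?_ (h _ hz').2.symm))
  have h1 : ∀ x x' : X, x = x' → (v x : ℂ ⊗[ℝ] E) = v x' := by rintro x _ rfl; rfl
  exact h1 _ _ (B.proj_act z k).symm

variable (B)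

/-- The invariant section of `D` over `P` given by a section of `D / H`. -/
def secField {D : ∀ z : P, Submodule ℂ (CTan N z)} (s : ∀ x, B.quotFiber D x) (z : P) : CTan N z :=
  (s (B.proj z)).1 ⟨z, rfl⟩

variable {B}

theorem secField_eq {D : ∀ z : P, Submodule ℂ (CTan N z)} (s : ∀ x, B.quotFiber D x) {z : P}
    {x : X} (hz : B.proj z = x) : B.secField s z = (s x).1 ⟨z, hz⟩ := by
  subst hz
  rfl

theorem secField_equivariant {D : ∀ z : P, Submodule ℂ (CTan N z)} (s : ∀ x, B.quotFiber D x)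
    (z : P) (k : H) : B.cdR k z (B.secField s z) = B.secField s (B.act z k) := by
  rw [secField_eq s (B.proj_act z k)]
  exact ((s (B.proj z)).2.2 ⟨z, rfl⟩ k).symm

/-- The group acts transitively on the fibre, so an equivariant choice is determined by its value at
one point. -/
theorem quotFiber_ext {D : ∀ z : P, Submodule ℂ (CTan N z)} {x : X} {w w' : B.quotFiber D x}
    (z : P) (hz : B.proj z = x) (h : w.1 ⟨z, hz⟩ = w'.1 ⟨z, hz⟩) : w = w' := by
  refine Subtype.ext (funext ?_)
  rintro ⟨y, hy⟩
  obtain ⟨k, rfl⟩ := B.exists_act_eq (hz.trans hy.symm)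
  rw [w.2.2 ⟨z, hz⟩ k, w'.2.2 ⟨z, hz⟩ k, h]

theorem exists_quotFiber_eq {D : ∀ z : P, Submodule ℂ (CTan N z)}
    (hD : ∀ (h : H) (z : P), ∀ w ∈ D z, B.cdR h z w ∈ D (B.act z h)) {x : X} (z₀ : P)
    (hz₀ : B.proj z₀ = x) {u : CTan N z₀} (hu : u ∈ D z₀) :
    ∃ w : B.quotFiber D x, w.1 ⟨z₀, hz₀⟩ = u := by
  have hex : ∀ z : {z : P // B.proj z = x}, ∃ k, B.act z₀ k = z.1 := fun z =>
    B.exists_act_eq (hz₀.trans z.2.symm)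
  -- `k z` is the group element carrying `z₀` to `z`. Freeness of the action makes it unique, which
  -- gives `k(z l) = k(z) l` and hence equivariance.
  choose k hk using hex
  have hval : ∀ (g : H) (y : P), B.act z₀ g = y → (show CTan N y from B.cdR g z₀ u) ∈ D y := by
    rintro g _ rfl
    exact hD g z₀ u hu
  have hcomp : ∀ (g l : H) (y : P), B.act z₀ g = y →
      B.cdR l y (show CTan N y from B.cdR g z₀ u)
        = (show CTan N (B.act y l) from B.cdR (g * l) z₀ u) := by
    rintro g l _ rfl
    exact (B.cdR_mul g l z₀ u).symm
  have hkk : ∀ g g' : H, g = g' →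
      (show ℂ ⊗[ℝ] N from B.cdR g z₀ u) = (show ℂ ⊗[ℝ] N from B.cdR g' z₀ u) := by
    rintro g _ rfl
    rfl
  refine ⟨⟨fun z => B.cdR (k z) z₀ u, fun z => hval _ _ (hk z), fun z l => ?_⟩, ?_⟩
  · have h1 : k ⟨B.act z.1 l, (B.proj_act z.1 l).trans z.2⟩ = k z * l := by
      apply B.act_injective z₀
      rw [B.act_mul, hk, hk]
    exact (hkk _ _ h1).trans (hcomp (k z) l z.1 (hk z)).symm
  · have h1 : k ⟨z₀, hz₀⟩ = 1 := by
      apply B.act_injective z₀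
      rw [hk, B.act_one]
    exact (hkk _ _ h1).trans (B.cdR_one z₀ u)

theorem cBracket_lift_congr {U : Set X} (hU : IsOpen U) {v : ∀ x : X, CTan E x}
    {vT vT' : ∀ z : P, CTan N z} (h : B.IsLift U v vT) (h' : B.IsLift U v vT')
    (A : ∀ z : P, CTan N z) {z : P} (hz : B.proj z ∈ U) : cBracket vT A z = cBracket vT' A z :=
  cBracket_congr (Filter.eventually_of_mem ((isOpen_preimage hU).mem_nhds hz)
    fun _ hy => h.eq h' hy) (Filter.Eventually.of_forall fun _ => rfl)

variable [FiniteDimensional ℝ N]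

/-- Right translation relates the lift and the invariant section each to itself, hence also their
bracket. -/
theorem cBracket_equivariant {U : Set X} (hU : IsOpen U) {v : ∀ x : X, CTan E x}
    (hv : SmoothCVF U v) {vT : ∀ z : P, CTan N z} (h : B.IsLift U v vT)
    {D : ∀ z : P, Submodule ℂ (CTan N z)} {s : ∀ x, B.quotFiber D x}
    (hs : SmoothCVF (B.proj ⁻¹' U) (B.secField s)) {z : P} (hz : B.proj z ∈ U) (k : H) :
    B.cdR k z (cBracket vT (B.secField s) z) = cBracket vT (B.secField s) (B.act z k) := by
  have hz' : B.proj (B.act z k) ∈ U := by rwa [B.proj_act]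
  have ho := isOpen_preimage (B := B) hU
  have hvT := h.smooth hU hv
  exact cdiff_cBracket_of_related (f := fun y => B.act y k) (B.contMDiff_act_right k).contMDiffAt
    (hvT.diffCVFAt ho hz) (hs.diffCVFAt ho hz) (hvT.diffCVFAt ho hz') (hs.diffCVFAt ho hz')
    (Filter.eventually_of_mem (ho.mem_nhds hz) fun y hy => h.equivariant hy k)
    (Filter.Eventually.of_forall fun y => secField_equivariant s y k)

theorem cdp_cBracket {U : Set X} (hU : IsOpen U) {v : ∀ x : X, CTan E x}
    (hv : SmoothCVF U v) {vT : ∀ z : P, CTan N z} (h : B.IsLift U v vT)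
    {A : ∀ z : P, CTan N z} (hA : SmoothCVF (B.proj ⁻¹' U) A) {f : ∀ x : X, CTan E x}
    (hf : SmoothCVF U f) (hAf : ∀ z, B.proj z ∈ U → B.cdp z (A z) = f (B.proj z))
    {z : P} (hz : B.proj z ∈ U) :
    B.cdp z (cBracket vT A z) = cBracket v f (B.proj z) := by
  have ho := isOpen_preimage (B := B) hU
  exact cdiff_cBracket_of_related B.proj_smooth.contMDiffAt
    ((h.smooth hU hv).diffCVFAt ho hz) (hA.diffCVFAt ho hz) (hv.diffCVFAt hU hz)
    (hf.diffCVFAt hU hz)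
    (Filter.eventually_of_mem (ho.mem_nhds hz) fun y hy => (h y hy).2)
    (Filter.eventually_of_mem (ho.mem_nhds hz) fun y hy => hAf y hy)

/-- A smooth section of the Atiyah bundle is differentiable along `𝓕^{0,1}`. -/
theorem exists_isDerivAt_At {U : Set X} (hU : IsOpen U) {s : ∀ x, B.quotFiber B.TT x}
    (hs : SmoothCVF (B.proj ⁻¹' U) (B.secField s)) {v : ∀ x : X, CTan E x} (hv : SmoothCVF U v)
    (hv' : ∀ x ∈ U, v x ∈ S.calF01 x) {x : X} (hx : x ∈ U) : ∃ t, B.At.IsDerivAt U v s x t := by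
  obtain ⟨vT₀, h₀⟩ := exists_isLift (B := B) hv'
  -- The derivative is the `𝕋`-component of the bracket, taken pointwise; uniqueness of components
  -- makes it equivariant.
  choose t ht htu using fun z : {z : P // B.proj z = x} =>
    B.exists_TT_component z.1 (cBracket vT₀ (B.secField s) z.1)
  refine ⟨⟨t, ht, fun z k => ?_⟩, fun vT hvT z => ?_⟩
  · have hz : B.proj z.1 ∈ U := by rw [z.2]; exact hx
    refine B.eq_of_TT_components (ht _) (B.cdR_mem_TT k (ht z)) (htu _) ?_
    rw [← cBracket_equivariant hU hv h₀ hs hz k, ← map_sub]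
    exact B.cdR_mem_calF_sup_K01 k (htu z)
  · have hz : B.proj z.1 ∈ U := by rw [z.2]; exact hx
    -- An arbitrary lift agrees with `vT₀` on the open set over `U`, so the bracket does not depend
    -- on the lift.
    have h1 := cBracket_lift_congr hU hvT h₀ (B.secField s) hz
    have h2 := htu z
    rw [← h1] at h2
    exact h2

/-- The projection `d'p : At → F^{1,0}`. -/
def atProj (B : HolPrincipalBundle S V H N P) (x : X) : B.quotFiber B.TT x →ₗ[ℂ] S.F10 x where
  -- The value is computed at a chosen point of the fibre; invariance of `dp` under translation
  -- removes the choice in `atProj_eq`.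
  toFun w := ⟨B.cdp (B.exists_proj_eq x).choose
      (w.1 ⟨(B.exists_proj_eq x).choose, (B.exists_proj_eq x).choose_spec⟩), by
    have h1 : ∀ (z : P) (hz : B.proj z = x),
        (show CTan E x from B.cdp z (w.1 ⟨z, hz⟩)) ∈ S.F10 x := by
      rintro z rfl
      exact B.cdp_mem_F10 (w.2.1 ⟨z, rfl⟩)
    exact h1 _ _⟩
  map_add' w w' := Subtype.ext (map_add (B.cdp _) _ _)
  map_smul' c w := Subtype.ext (map_smul (B.cdp _) _ _)

theorem atProj_eq {x : X} (w : B.quotFiber B.TT x) (z : P) (hz : B.proj z = x) :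
    ((B.atProj x w : S.F10 x) : CTan E x) = B.cdp z (w.1 ⟨z, hz⟩) := by
  obtain ⟨k, hk⟩ := B.exists_act_eq ((B.exists_proj_eq x).choose_spec.trans hz.symm)
  subst hk
  rw [w.2.2 ⟨_, (B.exists_proj_eq x).choose_spec⟩ k]
  exact (B.cdp_cdR k _ _).symm

theorem cdp_secField (s : ∀ x, B.quotFiber B.TT x) (z : P) :
    B.cdp z (B.secField s z) = (B.atProj _ (s (B.proj z)) : S.F10 (B.proj z)) :=
  (atProj_eq _ z rfl).symm

/-- Along a local smooth section `σ` of the bundle, the projected section is `x ↦ dp(s(σ(x)))`. -/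
theorem atProj_smooth {U : Set X} {s : ∀ x, B.quotFiber B.TT x}
    (hs : SmoothCVF (B.proj ⁻¹' U) (B.secField s)) :
    SmoothCVF U (fun x => ((B.atProj x (s x) : S.F10 x) : CTan E x)) := by
  refine smoothCVF_of_locally fun x₀ _ => ?_
  obtain ⟨W, hW, hx₀, σ, τ, hσ, -, hσp, -⟩ := B.locally_trivial x₀
  have htan : ContMDiff 𝓘(ℝ, N).tangent 𝓘(ℝ, E).tangent ∞ (tangentMap 𝓘(ℝ, N) 𝓘(ℝ, E) B.proj) :=
    B.proj_smooth.contMDiff_tangentMap le_rfl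
  have hmaps : Set.MapsTo σ (U ∩ W) (B.proj ⁻¹' U) := fun x hx => by
    rw [Set.mem_preimage, hσp x hx.2]; exact hx.1
  refine ⟨W, hW, hx₀, ?_, ?_⟩
  · refine ContMDiffOn.congr (htan.comp_contMDiffOn (ContMDiffOn.comp hs.1
      (hσ.mono Set.inter_subset_right) hmaps)) fun x hx => ?_
    have h1 : ∀ (z : P) (y : X), B.proj z = y →
        (⟨y, cRe ((B.atProj y (s y) : S.F10 y) : CTan E y)⟩ : TangentBundle 𝓘(ℝ, E) X)
          = tangentMap 𝓘(ℝ, N) 𝓘(ℝ, E) B.proj ⟨z, cRe (B.secField s z)⟩ := by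
      rintro z _ rfl
      rw [← cdp_secField, PrincipalBundle.cdp, cRe_cdiff]
      rfl
    exact h1 (σ x) x (hσp x hx.2)
  · refine ContMDiffOn.congr (htan.comp_contMDiffOn (ContMDiffOn.comp hs.2
      (hσ.mono Set.inter_subset_right) hmaps)) fun x hx => ?_
    have h1 : ∀ (z : P) (y : X), B.proj z = y →
        (⟨y, cIm ((B.atProj y (s y) : S.F10 y) : CTan E y)⟩ : TangentBundle 𝓘(ℝ, E) X)
          = tangentMap 𝓘(ℝ, N) 𝓘(ℝ, E) B.proj ⟨z, cIm (B.secField s z)⟩ := by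
      rintro z _ rfl
      rw [← cdp_secField, PrincipalBundle.cdp, cIm_cdiff]
      rfl
    exact h1 (σ x) x (hσp x hx.2)

/-- The lift of a vector of type `(1,0)` to `conj 𝔽`. -/
def vecLift (B : HolPrincipalBundle S V H N P) (z : P) {x : X} (hz : B.proj z = x)
    (f : S.F10 x) : CTan N z :=
  (B.exists_conj_FF_lift z (f := (f : CTan E x)) (by subst hz; exact f.2)).choose

theorem vecLift_mem (z : P) {x : X} (hz : B.proj z = x) (f : S.F10 x) :
    B.vecLift z hz f ∈ conjSubmodule (B.FF z) :=
  (B.exists_conj_FF_lift z (f := (f : CTan E x)) (by subst hz; exact f.2)).choose_spec.1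

theorem cdp_vecLift (z : P) {x : X} (hz : B.proj z = x) (f : S.F10 x) :
    B.cdp z (B.vecLift z hz f) = (f : CTan E x) :=
  (B.exists_conj_FF_lift z (f := (f : CTan E x)) (by subst hz; exact f.2)).choose_spec.2

theorem eq_vecLift {z : P} {x : X} (hz : B.proj z = x) {f : S.F10 x} {w : CTan N z}
    (hw : w ∈ conjSubmodule (B.FF z)) (h : B.cdp z w = (f : CTan E x)) : w = B.vecLift z hz f :=
  B.eq_of_mem_conj_FF hw (vecLift_mem (B := B) z hz f) (h.trans (cdp_vecLift (B := B) z hz f).symm)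

/-- The smooth splitting `F^{1,0} → At` of the Atiyah sequence with image `conj 𝔽 / H`. -/
def horLift (B : HolPrincipalBundle S V H N P) (x : X) : S.F10 x →ₗ[ℂ] B.quotFiber B.TT x where
  toFun f := ⟨fun z => B.vecLift z.1 z.2 f,
    fun z => B.conj_FF_le_TT _ (vecLift_mem (B := B) z.1 z.2 f),
    -- Equivariance here, and additivity and homogeneity below, all come from uniqueness of the lift
    -- to `conj 𝔽`.
    fun z k => (eq_vecLift (B := B) ((B.proj_act z.1 k).trans z.2)
      (B.cdR_mem_conj_FF k (vecLift_mem (B := B) z.1 z.2 f))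
      ((B.cdp_cdR k z.1 _).trans (cdp_vecLift (B := B) z.1 z.2 f))).symm⟩
  map_add' f f' := Subtype.ext (funext fun z => (eq_vecLift (B := B) z.2
    (add_mem (vecLift_mem (B := B) z.1 z.2 f) (vecLift_mem (B := B) z.1 z.2 f'))
    ((map_add (B.cdp z.1) _ _).trans (congrArg₂ (· + ·) (cdp_vecLift (B := B) z.1 z.2 f)
      (cdp_vecLift (B := B) z.1 z.2 f')))).symm)
  map_smul' c f := Subtype.ext (funext fun z => (eq_vecLift (B := B) z.2
    (Submodule.smul_mem _ c (vecLift_mem (B := B) z.1 z.2 f))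
    ((map_smul (B.cdp z.1) c _).trans (congrArg (c • ·) (cdp_vecLift (B := B) z.1 z.2 f)))).symm)

theorem horLift_mem {x : X} (f : S.F10 x) (z : P) (hz : B.proj z = x) :
    (B.horLift x f).1 ⟨z, hz⟩ ∈ conjSubmodule (B.FF z) :=
  vecLift_mem (B := B) z hz f

theorem cdp_horLift {x : X} (f : S.F10 x) (z : P) (hz : B.proj z = x) :
    B.cdp z ((B.horLift x f).1 ⟨z, hz⟩) = (f : CTan E x) :=
  cdp_vecLift (B := B) z hz f

theorem atProj_horLift (x : X) (f : S.F10 x) : B.atProj x (B.horLift x f) = f := by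
  obtain ⟨z, hz⟩ := B.exists_proj_eq x
  exact Subtype.ext ((atProj_eq (B := B) _ z hz).trans (cdp_horLift f z hz))

/-- The conjugate of the horizontal lift of `f` is the lift of `conj f` to `calF`, so
`IsLift.smooth` applies. -/
theorem horLift_smooth {U : Set X} (hU : IsOpen U) {f : ∀ x, S.F10 x}
    (hf : SmoothCVF U (fun x => (f x : CTan E x))) :
    SmoothCVF (B.proj ⁻¹' U) (B.secField fun x => B.horLift x (f x)) := by
  have h : B.IsLift U (fun x => cConj (f x : CTan E x))
      (fun z => cConj (B.secField (fun x => B.horLift x (f x)) z)) := by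
    intro z _
    have h1 : B.secField (fun x => B.horLift x (f x)) z ∈ conjSubmodule (B.FF z) :=
      horLift_mem (f (B.proj z)) z rfl
    refine ⟨(B.mem_conj_FF.1 h1).1, ?_⟩
    rw [B.cdp_cConj]
    exact congrArg cConj (cdp_horLift (f (B.proj z)) z rfl)
  exact (h.smooth hU hf.conj).conj.congr fun z _ => (cConj_cConj _).symm

end HolPrincipalBundle

end AtiyahBundle

/-! ### The differential of `j` and the distributions it preserves. -/

section ExtensionMaps

variable {E : Type*} [NormedAddCommGroup E] [NormedSpace ℝ E] [FiniteDimensional ℝ E]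
  {X : Type*} [TopologicalSpace X] [ChartedSpace E X] [IsManifold 𝓘(ℝ, E) ∞ X]
  {m : ℕ} {S : SasakianStructure E X m}
  {V : Type*} [NormedAddCommGroup V] [NormedSpace ℂ V]
  {H : Type*} [TopologicalSpace H] [ChartedSpace V H] [Group H]
  {N : Type*} [NormedAddCommGroup N] [NormedSpace ℝ N]
  {P : Type*} [TopologicalSpace P] [ChartedSpace N P] [IsManifold 𝓘(ℝ, N) ∞ P]
  {V' : Type*} [NormedAddCommGroup V'] [NormedSpace ℂ V']
  {G : Type*} [TopologicalSpace G] [ChartedSpace V' G] [Group G]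
  {N' : Type*} [NormedAddCommGroup N'] [NormedSpace ℝ N']
  {Q : Type*} [TopologicalSpace Q] [ChartedSpace N' Q] [IsManifold 𝓘(ℝ, N') ∞ Q]

theorem ComplexPrincipalBundle.J_eq_of_orbit (B : ComplexPrincipalBundle S V H N P) {z₀ : P} {h : H}
    {z : P} (hz : B.act z₀ h = z) {η : V} {v : B.vert z}
    (hv : (v.1 : N) = mfderiv 𝓘(ℝ, V) 𝓘(ℝ, N) (fun k => B.act z₀ k) h η) :
    ((B.J z v).1 : N) = mfderiv 𝓘(ℝ, V) 𝓘(ℝ, N) (fun k => B.act z₀ k) h (Complex.I • η : V) := by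
  subst hz
  exact B.J_orbit z₀ h η v hv

namespace IsExtension

variable {ι : H →* G} {BH : HolPrincipalBundle S V H N P}
  {BG : HolPrincipalBundle S V' G N' Q} {j : P → Q}

theorem mdifferentiableAt (hj : IsExtension ι BH BG j) (z : P) :
    MDifferentiableAt 𝓘(ℝ, N) 𝓘(ℝ, N') j z :=
  (hj.smooth z).mdifferentiableAt (by simp)

theorem cdp_cdj (hj : IsExtension ι BH BG j) (z : P) (u : CTan N z) :
    (BG.cdp (j z) (cdiff N N' j z u) : ℂ ⊗[ℝ] E) = BH.cdp z u := by
  have h1 := cdiff_comp (f := j) (BG.mdifferentiableAt_proj (j z)) (hj.mdifferentiableAt z) u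
  exact h1.symm.trans (cdiff_congr (funext hj.proj_eq) z u)

theorem cdj_cdR (hj : IsExtension ι BH BG j) (h : H) (z : P) (u : CTan N z) :
    (cdiff N N' j (BH.act z h) (BH.cdR h z u) : ℂ ⊗[ℝ] N')
      = BG.cdR (ι h) (j z) (cdiff N N' j z u) := by
  have h1 := cdiff_comp (f := fun y => BH.act y h) (hj.mdifferentiableAt (BH.act z h))
    (BH.mdifferentiableAt_act_right h z) u
  have h2 := cdiff_comp (g := fun y => BG.act y (ι h)) (f := j)
    (BG.mdifferentiableAt_act_right (ι h) (j z)) (hj.mdifferentiableAt z) u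
  exact h1.symm.trans ((cdiff_congr (funext fun y => hj.equivariant y h) z u).trans h2)

theorem mfderiv_orbit (hj : IsExtension ι BH BG j) (hι : IsComplexLieSubgroup (V := V) (V' := V') ι)
    (z : P) (h : H) (η : V) :
    (mfderiv 𝓘(ℝ, N) 𝓘(ℝ, N') j (BH.act z h)
        (mfderiv 𝓘(ℝ, V) 𝓘(ℝ, N) (fun k => BH.act z k) h η) : N')
      = mfderiv 𝓘(ℝ, V') 𝓘(ℝ, N') (fun k => BG.act (j z) k) (ι h)
        (mfderiv 𝓘(ℝ, V) 𝓘(ℝ, V') ι h η) := by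
  have h1 := mfderiv_comp h (hj.mdifferentiableAt (BH.act z h))
    ((BH.contMDiff_orbit z h).mdifferentiableAt (by simp))
  have h2 := mfderiv_comp h ((BG.contMDiff_orbit (j z) (ι h)).mdifferentiableAt (by simp))
    ((contMDiff_real_of_complex hι.holomorphic h).mdifferentiableAt (by simp))
  have h3 : j ∘ (fun k => BH.act z k) = (fun k => BG.act (j z) k) ∘ ι :=
    funext fun k => hj.equivariant z k
  have h4 : ∀ f g : H → Q, f = g → (mfderiv 𝓘(ℝ, V) 𝓘(ℝ, N') f h η : N')
      = mfderiv 𝓘(ℝ, V) 𝓘(ℝ, N') g h η := by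
    rintro f _ rfl
    rfl
  exact (DFunLike.congr_fun h1 η).symm.trans ((h4 _ _ h3).trans (DFunLike.congr_fun h2 η))

theorem mfderiv_mem_vert (hj : IsExtension ι BH BG j) {z : P} {v : TangentSpace 𝓘(ℝ, N) z}
    (hv : v ∈ BH.vert z) : mfderiv 𝓘(ℝ, N) 𝓘(ℝ, N') j z v ∈ BG.vert (j z) := by
  have h1 := mfderiv_comp z (BG.mdifferentiableAt_proj (j z)) (hj.mdifferentiableAt z)
  have h2 : BG.proj ∘ j = BH.proj := funext hj.proj_eq
  rw [h2] at h1
  exact (DFunLike.congr_fun h1 v).symm.trans hv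

/-- A vertical vector is tangent to an orbit map, and `j` carries orbit maps of `H` to orbit maps of
`G` composed with `ι`. Both kinds of orbit map are holomorphic, and the differential of `ι` commutes
with `i`. -/
theorem J_mfderiv (hj : IsExtension ι BH BG j) (hι : IsComplexLieSubgroup (V := V) (V' := V') ι)
    {z : P} (v : BH.vert z) :
    ((BG.J (j z) ⟨mfderiv 𝓘(ℝ, N) 𝓘(ℝ, N') j z v, hj.mfderiv_mem_vert v.2⟩).1 : N')
      = mfderiv 𝓘(ℝ, N) 𝓘(ℝ, N') j z (BH.J z v) := by
  obtain ⟨z₀, h, η, rfl, hv⟩ := BH.exists_orbit_of_mem_vert v.2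
  have hJ := BH.J_eq_of_orbit rfl hv
  have h1 : (mfderiv 𝓘(ℝ, N) 𝓘(ℝ, N') j (BH.act z₀ h) v : N')
      = mfderiv 𝓘(ℝ, V') 𝓘(ℝ, N') (fun k => BG.act (j z₀) k) (ι h)
        (mfderiv 𝓘(ℝ, V) 𝓘(ℝ, V') ι h η) :=
    (congrArg (mfderiv 𝓘(ℝ, N) 𝓘(ℝ, N') j (BH.act z₀ h)) hv).trans (hj.mfderiv_orbit hι z₀ h η)
  have h2 : (mfderiv 𝓘(ℝ, N) 𝓘(ℝ, N') j (BH.act z₀ h) (BH.J _ v) : N')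
      = mfderiv 𝓘(ℝ, V') 𝓘(ℝ, N') (fun k => BG.act (j z₀) k) (ι h)
        (mfderiv 𝓘(ℝ, V) 𝓘(ℝ, V') ι h (Complex.I • η : V)) :=
    (congrArg (mfderiv 𝓘(ℝ, N) 𝓘(ℝ, N') j (BH.act z₀ h)) hJ).trans
      (hj.mfderiv_orbit hι z₀ h (Complex.I • η : V))
  have h3 := mfderiv_real_smul_I ((hι.holomorphic h).mdifferentiableAt (by simp)) η
  refine (BG.J_eq_of_orbit (hj.equivariant z₀ h).symm h1).trans (Eq.trans ?_ h2.symm)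
  exact congrArg (mfderiv 𝓘(ℝ, V') 𝓘(ℝ, N') (fun k => BG.act (j z₀) k) (ι h)) h3.symm

theorem cdj_mem_K10 (hj : IsExtension ι BH BG j)
    (hι : IsComplexLieSubgroup (V := V) (V' := V') ι) {z : P} {w : CTan N z} (hw : w ∈ BH.K10 z) :
    cdiff N N' j z w ∈ BG.K10 (j z) := by
  obtain ⟨v, rfl⟩ := BH.mem_K10.1 hw
  refine BG.mem_K10.2 ⟨⟨mfderiv 𝓘(ℝ, N) 𝓘(ℝ, N') j z v, hj.mfderiv_mem_vert v.2⟩, ?_⟩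
  have hJ : (BG.J (j z) ⟨mfderiv 𝓘(ℝ, N) 𝓘(ℝ, N') j z v, hj.mfderiv_mem_vert v.2⟩).1
      = mfderiv 𝓘(ℝ, N) 𝓘(ℝ, N') j z (BH.J z v) := hj.J_mfderiv hι v
  rw [ComplexPrincipalBundle.vec10, ComplexPrincipalBundle.vec10, hJ, map_sub, cdiff_tmul,
    cdiff_tmul]

theorem cdj_mem_calF (hj : IsExtension ι BH BG j) {z : P} {w : CTan N z} (hw : w ∈ BH.calF z) :
    cdiff N N' j z w ∈ BG.calF (j z) :=
  (hj.calF_eq z).symm ▸ Submodule.mem_map_of_mem hw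

theorem cdj_mem_conj_FF (hj : IsExtension ι BH BG j) {z : P} {w : CTan N z}
    (hw : w ∈ conjSubmodule (BH.FF z)) : cdiff N N' j z w ∈ conjSubmodule (BG.FF (j z)) := by
  rw [BH.mem_conj_FF] at hw
  refine BG.mem_conj_FF.2 ⟨?_, ?_⟩
  · rw [cConj_cdiff]
    exact hj.cdj_mem_calF hw.1
  · have h1 : ∀ (x x' : X) (u u' : ℂ ⊗[ℝ] E), x = x' → u = u' → u ∈ (show Submodule ℂ (ℂ ⊗[ℝ] E)
        from S.F10 x) → u' ∈ (show Submodule ℂ (ℂ ⊗[ℝ] E) from S.F10 x') := by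
      rintro x _ u _ rfl rfl h
      exact h
    exact h1 _ _ _ _ (hj.proj_eq z).symm (hj.cdp_cdj z w).symm hw.2

theorem cdj_mem_TT (hj : IsExtension ι BH BG j)
    (hι : IsComplexLieSubgroup (V := V) (V' := V') ι) {z : P} {w : CTan N z} (hw : w ∈ BH.TT z) :
    cdiff N N' j z w ∈ BG.TT (j z) := by
  obtain ⟨a, ha, b, hb, rfl⟩ := Submodule.mem_sup.1 hw
  rw [map_add]
  exact add_mem (Submodule.mem_sup_left (hj.cdj_mem_K10 hι ha))
    (Submodule.mem_sup_right (hj.cdj_mem_conj_FF hb))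

theorem cdj_mem_calF_sup_K01 (hj : IsExtension ι BH BG j)
    (hι : IsComplexLieSubgroup (V := V) (V' := V') ι) {z : P} {w : CTan N z}
    (hw : w ∈ BH.calF z ⊔ BH.K01 z) :
    cdiff N N' j z w ∈ BG.calF (j z) ⊔ BG.K01 (j z) := by
  obtain ⟨a, ha, b, hb, rfl⟩ := Submodule.mem_sup.1 hw
  rw [map_add]
  refine add_mem (Submodule.mem_sup_left (hj.cdj_mem_calF ha)) (Submodule.mem_sup_right ?_)
  rw [BG.mem_K01, cConj_cdiff]
  exact hj.cdj_mem_K10 hι (BH.mem_K01.1 hb)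

theorem exists_act_eq (hj : IsExtension ι BH BG j) {z : P} {q : Q}
    (h : BH.proj z = BG.proj q) : ∃ g, BG.act (j z) g = q :=
  BG.exists_act_eq ((hj.proj_eq z).trans h)

/-- For fixed `g`, the map `z ↦ j(z) g`. -/
theorem cdiff_act_j (hj : IsExtension ι BH BG j) (g : G) (z : P) (u : CTan N z) :
    cdiff N N' (fun y => BG.act (j y) g) z u = BG.cdR g (j z) (cdiff N N' j z u) :=
  cdiff_comp (g := fun y => BG.act y g) (f := j)
    (BG.mdifferentiableAt_act_right g (j z)) (hj.mdifferentiableAt z) u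

theorem contMDiff_act_j (hj : IsExtension ι BH BG j) (g : G) :
    ContMDiff 𝓘(ℝ, N) 𝓘(ℝ, N') ∞ (fun y => BG.act (j y) g) :=
  (BG.contMDiff_act_right g).comp hj.smooth

end IsExtension

/-- The map of fibres `At(E_H) → At(E_G)` induced by `dj`. -/
theorem IsExtension.exists_jStar {ι : H →* G} {BH : HolPrincipalBundle S V H N P}
    {BG : HolPrincipalBundle S V' G N' Q} {j : P → Q} (hj : IsExtension ι BH BG j)
    {D : ∀ z : P, Submodule ℂ (CTan N z)} {D' : ∀ z : Q, Submodule ℂ (CTan N' z)}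
    (hD' : ∀ (h : G) (z : Q), ∀ w ∈ D' z, BG.cdR h z w ∈ D' (BG.act z h))
    (hDD' : ∀ z, ∀ w ∈ D z, cdiff N N' j z w ∈ D' (j z)) (x : X) :
    ∃ L : BH.quotFiber D x →ₗ[ℂ] BG.quotFiber D' x, ∀ w (z : P) (hz : BH.proj z = x),
      (L w).1 ⟨j z, (hj.proj_eq z).trans hz⟩ = cdiff N N' j z (w.1 ⟨z, hz⟩) := by
  obtain ⟨z₀, hz₀⟩ := BH.exists_proj_eq x
  -- The image is prescribed at the single point `j(z₀)` and spread over the fibre by `G`; linearity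
  -- is then checked at `j(z₀)` alone.
  choose L hL using fun w : BH.quotFiber D x =>
    HolPrincipalBundle.exists_quotFiber_eq (B := BG) hD' (j z₀) ((hj.proj_eq z₀).trans hz₀)
      (hDD' z₀ _ (w.2.1 ⟨z₀, hz₀⟩))
  refine ⟨{ toFun := L, map_add' := fun w w' => ?_, map_smul' := fun c w => ?_ }, ?_⟩
  · refine HolPrincipalBundle.quotFiber_ext (j z₀) ((hj.proj_eq z₀).trans hz₀) ?_
    refine (hL _).trans ((map_add (cdiff N N' j z₀) _ _).trans ?_)
    exact congrArg₂ (· + ·) (hL w).symm (hL w').symm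
  · refine HolPrincipalBundle.quotFiber_ext (j z₀) ((hj.proj_eq z₀).trans hz₀) ?_
    refine (hL _).trans ((map_smul (cdiff N N' j z₀) c _).trans ?_)
    exact congrArg (c • ·) (hL w).symm
  · intro w z hz
    -- Any other point over `x` is `z₀ k`, and `j(z₀ k) = j(z₀) ι(k)` reduces the formula to the one
    -- at `z₀`.
    obtain ⟨k, rfl⟩ := BH.exists_act_eq (hz₀.trans hz.symm)
    have h1 := w.2.2 ⟨z₀, hz₀⟩ k
    have h2 := (L w).2.2 ⟨j z₀, (hj.proj_eq z₀).trans hz₀⟩ (ι k)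
    have h3 : ∀ q q' : Q, (hq : BG.proj q = x) → (hq' : BG.proj q' = x) → q = q' →
        ((L w).1 ⟨q, hq⟩ : ℂ ⊗[ℝ] N') = (L w).1 ⟨q', hq'⟩ := by
      rintro q _ _ _ rfl
      rfl
    refine (h3 _ _ _ ((BG.proj_act _ _).trans ((hj.proj_eq z₀).trans hz₀))
      (hj.equivariant z₀ k)).trans ?_
    refine h2.trans ?_
    refine (congrArg (BG.cdR (ι k) (j z₀)) (hL w)).trans ?_
    refine (hj.cdj_cdR k z₀ _).symm.trans ?_
    exact congrArg (cdiff N N' j (BH.act z₀ k)) h1.symm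

end ExtensionMaps

/-! ### The homomorphism `j_*` is smooth and intertwines the partial connections. -/

section AtiyahExtension

variable {E : Type*} [NormedAddCommGroup E] [NormedSpace ℝ E] [FiniteDimensional ℝ E]
  {X : Type*} [TopologicalSpace X] [ChartedSpace E X] [IsManifold 𝓘(ℝ, E) ∞ X]
  {m : ℕ} {S : SasakianStructure E X m}
  {V : Type*} [NormedAddCommGroup V] [NormedSpace ℂ V]
  {H : Type*} [TopologicalSpace H] [ChartedSpace V H] [Group H]
  {N : Type*} [NormedAddCommGroup N] [NormedSpace ℝ N]
  {P : Type*} [TopologicalSpace P] [ChartedSpace N P] [IsManifold 𝓘(ℝ, N) ∞ P]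
  {V' : Type*} [NormedAddCommGroup V'] [NormedSpace ℂ V']
  {G : Type*} [TopologicalSpace G] [ChartedSpace V' G] [Group G]
  {N' : Type*} [NormedAddCommGroup N'] [NormedSpace ℝ N']
  {Q : Type*} [TopologicalSpace Q] [ChartedSpace N' Q] [IsManifold 𝓘(ℝ, N') ∞ Q]

namespace IsExtension

variable {ι : H →* G} {BH : HolPrincipalBundle S V H N P}
  {BG : HolPrincipalBundle S V' G N' Q} {j : P → Q}

/-- The map of fibres `At(E_H) → At(E_G)` induced by `dj`. -/
def jStar (hj : IsExtension ι BH BG j) (hι : IsComplexLieSubgroup (V := V) (V' := V') ι) (x : X) :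
    BH.quotFiber BH.TT x →ₗ[ℂ] BG.quotFiber BG.TT x :=
  (hj.exists_jStar (fun h _ _ hw => BG.cdR_mem_TT h hw) (fun _ _ hw => hj.cdj_mem_TT hι hw) x).choose

theorem jStar_val (hj : IsExtension ι BH BG j) (hι : IsComplexLieSubgroup (V := V) (V' := V') ι)
    {x : X} (w : BH.quotFiber BH.TT x) (z : P) (hz : BH.proj z = x) :
    (hj.jStar hι x w).1 ⟨j z, (hj.proj_eq z).trans hz⟩ = cdiff N N' j z (w.1 ⟨z, hz⟩) :=
  (hj.exists_jStar (fun h _ _ hw => BG.cdR_mem_TT h hw)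
    (fun _ _ hw => hj.cdj_mem_TT hι hw) x).choose_spec w z hz

theorem jStar_val_act (hj : IsExtension ι BH BG j)
    (hι : IsComplexLieSubgroup (V := V) (V' := V') ι)
    {x : X} (w : BH.quotFiber BH.TT x) (z : P) (hz : BH.proj z = x) (g : G) :
    cdiff N N' (fun y => BG.act (j y) g) z (w.1 ⟨z, hz⟩) = (hj.jStar hι x w).1
      ⟨BG.act (j z) g, (BG.proj_act _ _).trans ((hj.proj_eq z).trans hz)⟩ := by
  refine (hj.cdiff_act_j g z _).trans ?_
  refine Eq.trans ?_ ((hj.jStar hι x w).2.2 ⟨j z, (hj.proj_eq z).trans hz⟩ g).symm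
  exact congrArg (BG.cdR g (j z)) (hj.jStar_val hι w z hz).symm

theorem secField_jStar (hj : IsExtension ι BH BG j)
    (hι : IsComplexLieSubgroup (V := V) (V' := V') ι) (s : ∀ x, BH.quotFiber BH.TT x) (g : G)
    (z : P) :
    cdiff N N' (fun y => BG.act (j y) g) z (BH.secField s z)
      = BG.secField (fun x => hj.jStar hι x (s x)) (BG.act (j z) g) := by
  refine (hj.jStar_val_act hι (s (BH.proj z)) z rfl g).trans ?_
  exact (HolPrincipalBundle.secField_eq (B := BG) (fun x => hj.jStar hι x (s x))
    ((BG.proj_act (j z) g).trans (hj.proj_eq z))).symm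

/-- Both vectors lie in `calF` and have the same projection, and `dp` is injective there. -/
theorem isLift_related (hj : IsExtension ι BH BG j) {U : Set X} {v : ∀ x : X, CTan E x}
    {vT : ∀ z : P, CTan N z} (h : BH.IsLift U v vT) {vT' : ∀ z : Q, CTan N' z}
    (h' : BG.IsLift U v vT') (g : G) {z : P} (hz : BH.proj z ∈ U) :
    cdiff N N' (fun y => BG.act (j y) g) z (vT z) = vT' (BG.act (j z) g) := by
  have hp : BG.proj (BG.act (j z) g) = BH.proj z := (BG.proj_act _ _).trans (hj.proj_eq z)
  have hz' : BG.proj (BG.act (j z) g) ∈ U := by rwa [hp]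
  refine (hj.cdiff_act_j g z _).trans ?_
  refine BG.cdp_injOn_calF _ (BG.cdR_mem_calF g (hj.cdj_mem_calF (h z hz).1)) (h' _ hz').1 ?_
  refine (BG.cdp_cdR g (j z) _).trans ((hj.cdp_cdj z _).trans ((h z hz).2.trans ?_))
  have h1 : ∀ x x' : X, x = x' → (v x : ℂ ⊗[ℝ] E) = v x' := by rintro x _ rfl; rfl
  exact (h1 _ _ hp.symm).trans (h' _ hz').2.symm

/-- Locally on the base, `q = j(s(q)) c(q)` with smooth `s` and `c`. -/
theorem exists_smooth_factorization [LieGroup 𝓘(ℂ, V') ∞ G] (hj : IsExtension ι BH BG j) (q₀ : Q) :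
    ∃ (s : Q → P) (c : Q → G), ContMDiffAt 𝓘(ℝ, N') 𝓘(ℝ, N) ∞ s q₀ ∧
      ContMDiffAt 𝓘(ℝ, N') 𝓘(ℝ, V') ∞ c q₀ ∧ BH.proj (s q₀) = BG.proj q₀ ∧
      ∀ᶠ q in nhds q₀, BG.act (j (s q)) (c q) = q := by
  obtain ⟨W, hW, hx₀, σ, -, hσ, -, hσp, -⟩ := BH.locally_trivial (BG.proj q₀)
  obtain ⟨W', hW', hx₀', σ', τ, -, hτ, -, hτσ, -⟩ := BG.locally_trivial (BG.proj q₀)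
  have hpq : ContMDiffAt 𝓘(ℝ, N') 𝓘(ℝ, E) ∞ BG.proj q₀ := BG.proj_smooth q₀
  have hs : ContMDiffAt 𝓘(ℝ, N') 𝓘(ℝ, N) ∞ (fun q => σ (BG.proj q)) q₀ :=
    (hσ.contMDiffAt (hW.mem_nhds hx₀)).comp q₀ hpq
  have hpz₀ : BG.proj (j (σ (BG.proj q₀))) = BG.proj q₀ := (hj.proj_eq _).trans (hσp _ hx₀)
  have hτo : ∀ q, BG.proj q ∈ W' → ContMDiffAt 𝓘(ℝ, N') 𝓘(ℝ, V') ∞ τ q := fun q hq =>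
    hτ.contMDiffAt ((hW'.preimage BG.proj_smooth.continuous).mem_nhds hq)
  have hτ1 : ContMDiffAt 𝓘(ℝ, N') 𝓘(ℝ, V') ∞ (fun q => τ (j (σ (BG.proj q)))) q₀ :=
    ContMDiffAt.comp q₀ (g := τ) (f := fun q => j (σ (BG.proj q)))
      (hτo _ (by rw [hpz₀]; exact hx₀'))
      (ContMDiffAt.comp q₀ (g := j) (f := fun q => σ (BG.proj q)) (hj.smooth _) hs)
  -- In the trivialization of `Q`, the points `q` and `j(s(q))` have the same base component, so
  -- they differ by the quotient of their `G`-components.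
  have hc : ContMDiffAt 𝓘(ℝ, N') 𝓘(ℝ, V') ∞
      (fun q => (τ (j (σ (BG.proj q))))⁻¹ * τ q) q₀ := by
    have h1 : ContMDiffAt 𝓘(ℝ, N') 𝓘(ℝ, V') ∞ (fun q => (τ (j (σ (BG.proj q))))⁻¹) q₀ :=
      ContMDiffAt.comp q₀ (g := fun g : G => g⁻¹) (contMDiff_real_inv _) hτ1
    exact ContMDiffAt.comp q₀ (g := fun p : G × G => p.1 * p.2) (contMDiff_real_mul _)
      (h1.prodMk (hτo q₀ hx₀'))
  refine ⟨_, _, hs, hc, hσp _ hx₀, Filter.eventually_of_mem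
    (((hW.inter hW').preimage BG.proj_smooth.continuous).mem_nhds ⟨hx₀, hx₀'⟩) fun q hq => ?_⟩
  have hp : BG.proj (j (σ (BG.proj q))) = BG.proj q := (hj.proj_eq _).trans (hσp _ hq.1)
  have h1 := hτσ (j (σ (BG.proj q))) (by rw [hp]; exact hq.2)
  rw [hp] at h1
  rw [BG.act_mul]
  have h2 : BG.act (j (σ (BG.proj q))) (τ (j (σ (BG.proj q))))⁻¹ = σ' (BG.proj q) := by
    have h3 := BG.act_act_inv (σ' (BG.proj q)) (τ (j (σ (BG.proj q))))
    rwa [h1] at h3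
  rw [h2, hτσ q hq.2]

theorem contMDiffAt_act_j_uncurry (hj : IsExtension ι BH BG j) {c : Q → G} {q₀ : Q}
    (hc : ContMDiffAt 𝓘(ℝ, N') 𝓘(ℝ, V') ∞ c q₀) (z₀ : P) :
    ContMDiffAt (𝓘(ℝ, N').prod 𝓘(ℝ, N)) 𝓘(ℝ, N') ∞
      (Function.uncurry fun (q : Q) (z : P) => BG.act (j z) (c q)) (q₀, z₀) := by
  have h1 : ContMDiffAt (𝓘(ℝ, N').prod 𝓘(ℝ, N)) 𝓘(ℝ, N') ∞ (fun p : Q × P => j p.2) (q₀, z₀) :=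
    ContMDiffAt.comp (q₀, z₀) (g := j) (f := Prod.snd) (hj.smooth z₀) contMDiffAt_snd
  have h2 : ContMDiffAt (𝓘(ℝ, N').prod 𝓘(ℝ, N)) 𝓘(ℝ, V') ∞ (fun p : Q × P => c p.1) (q₀, z₀) :=
    ContMDiffAt.comp (q₀, z₀) (g := c) (f := Prod.fst) hc contMDiffAt_fst
  exact ContMDiffAt.comp (q₀, z₀) (g := fun p : Q × G => BG.act p.1 p.2)
    (f := fun p : Q × P => (j p.2, c p.1)) (BG.act_smooth (j z₀, c q₀)) (h1.prodMk h2)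

/-- Relatedness is given only for fixed `g`. Near `q₀` the factorization writes `A'(q)` as the
differential of `z ↦ j(z) c(q)` at `s(q)`, applied to `A(s(q))`; this is smooth in `q` by joint
smoothness in the parameter and the point. -/
theorem smoothVF_of_related [LieGroup 𝓘(ℂ, V') ∞ G] (hj : IsExtension ι BH BG j) {U : Set X}
    (hU : IsOpen U)
    {A : ∀ z : P, TangentSpace 𝓘(ℝ, N) z} {A' : ∀ q : Q, TangentSpace 𝓘(ℝ, N') q}
    (hA : SmoothVF (BH.proj ⁻¹' U) A)
    (hAA' : ∀ z g, mfderiv 𝓘(ℝ, N) 𝓘(ℝ, N') (fun y => BG.act (j y) g) z (A z)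
      = A' (BG.act (j z) g)) : SmoothVF (BG.proj ⁻¹' U) A' := by
  intro q₀ hq₀
  refine ContMDiffAt.contMDiffWithinAt ?_
  obtain ⟨s, c, hs, hc, hp, hact⟩ := hj.exists_smooth_factorization q₀
  have hf := hj.contMDiffAt_act_j_uncurry hc (s q₀)
  have hd := ContMDiffAt.mfderiv (fun (q : Q) (z : P) => BG.act (j z) (c q)) s hf hs (m := ∞) le_rfl
  have hb : ContMDiffAt 𝓘(ℝ, N') 𝓘(ℝ, N') ∞ (fun q => BG.act (j (s q)) (c q)) q₀ :=
    contMDiffAt_id.congr_of_eventuallyEq hact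
  have hz₀ : s q₀ ∈ BH.proj ⁻¹' U := by rw [Set.mem_preimage, hp]; exact hq₀
  have hAs : ContMDiffAt 𝓘(ℝ, N') 𝓘(ℝ, N).tangent ∞
      (fun q => (⟨s q, A (s q)⟩ : TangentBundle 𝓘(ℝ, N) P)) q₀ :=
    ContMDiffAt.comp q₀ (f := s) (g := fun z => (⟨z, A z⟩ : TangentBundle 𝓘(ℝ, N) P))
      (hA.contMDiffAt ((hU.preimage BH.proj_smooth.continuous).mem_nhds hz₀)) hs
  have hfin := ContMDiffAt.clm_apply_of_inCoordinates
    (b₁ := s) (b₂ := fun q => BG.act (j (s q)) (c q))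
    (E₁ := fun z : P => TangentSpace 𝓘(ℝ, N) z) (E₂ := fun z : Q => TangentSpace 𝓘(ℝ, N') z)
    (ϕ := fun q => mfderiv 𝓘(ℝ, N) 𝓘(ℝ, N') (fun z => BG.act (j z) (c q)) (s q))
    (v := fun q => A (s q)) hd hAs hb
  refine hfin.congr_of_eventuallyEq (hact.mono fun q hq => ?_)
  have h1 : ∀ (q' : Q) (u : TangentSpace 𝓘(ℝ, N') q'), q' = q → u = A' q' →
      (⟨q, A' q⟩ : TangentBundle 𝓘(ℝ, N') Q) = ⟨q', u⟩ := by
    rintro _ u rfl rfl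
    rfl
  exact h1 _ _ hq (hAA' (s q) (c q))

theorem jStar_smooth [LieGroup 𝓘(ℂ, V') ∞ G] (hj : IsExtension ι BH BG j)
    (hι : IsComplexLieSubgroup (V := V) (V' := V') ι) {U : Set X} (hU : IsOpen U)
    {s : ∀ x, BH.quotFiber BH.TT x} (hs : SmoothCVF (BH.proj ⁻¹' U) (BH.secField s)) :
    SmoothCVF (BG.proj ⁻¹' U) (BG.secField fun x => hj.jStar hι x (s x)) := by
  refine ⟨hj.smoothVF_of_related hU hs.1 fun z g => ?_,
    hj.smoothVF_of_related hU hs.2 fun z g => ?_⟩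
  · exact (cRe_cdiff _ _ _).symm.trans (congrArg cRe (hj.secField_jStar hι s g z))
  · exact (cIm_cdiff _ _ _).symm.trans (congrArg cIm (hj.secField_jStar hι s g z))

/-- Write the point of `Q` as `j(z) g`. The map `y ↦ j(y) g` relates the lifts and the invariant
sections, hence their brackets, and its differential sends `calF ⊕ 𝕂^{0,1}` to its counterpart. -/
theorem jStar_isDerivAt [LieGroup 𝓘(ℂ, V') ∞ G] [FiniteDimensional ℝ N] [FiniteDimensional ℝ N']
    (hj : IsExtension ι BH BG j)
    (hι : IsComplexLieSubgroup (V := V) (V' := V') ι) {U : Set X} (hU : IsOpen U)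
    {s : ∀ x, BH.quotFiber BH.TT x} (hs : SmoothCVF (BH.proj ⁻¹' U) (BH.secField s))
    {v : ∀ x : X, CTan E x} (hv : SmoothCVF U v) (hv' : ∀ x ∈ U, v x ∈ S.calF01 x) {x : X}
    (hx : x ∈ U) {t : BH.quotFiber BH.TT x} (ht : BH.At.IsDerivAt U v s x t) :
    BG.At.IsDerivAt U v (fun x => hj.jStar hι x (s x)) x (hj.jStar hι x t) := by
  rintro vT' h' ⟨q, hq⟩
  obtain ⟨vT, h⟩ := HolPrincipalBundle.exists_isLift (B := BH) hv'
  obtain ⟨z, hz⟩ := BH.exists_proj_eq x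
  obtain ⟨g, rfl⟩ := hj.exists_act_eq (hz.trans hq.symm)
  have hzU : BH.proj z ∈ U := by rw [hz]; exact hx
  have hqU : BG.proj (BG.act (j z) g) ∈ U := by rw [hq]; exact hx
  have ho : IsOpen (BH.proj ⁻¹' U) := HolPrincipalBundle.isOpen_preimage hU
  have ho' : IsOpen (BG.proj ⁻¹' U) := HolPrincipalBundle.isOpen_preimage hU
  have hb := cdiff_cBracket_of_related (hj.contMDiff_act_j g z)
    ((h.smooth hU hv).diffCVFAt ho hzU) (hs.diffCVFAt ho hzU)
    ((HolPrincipalBundle.IsLift.smooth hU hv h').diffCVFAt ho' hqU)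
    ((hj.jStar_smooth hι hU hs).diffCVFAt ho' hqU)
    (Filter.eventually_of_mem (ho.mem_nhds hzU) fun y hy => hj.isLift_related h h' g hy)
    (Filter.Eventually.of_forall fun y => hj.secField_jStar hι s g y)
  have ht' := hj.jStar_val_act hι t z hz g
  have h1 := BG.cdR_mem_calF_sup_K01 g (hj.cdj_mem_calF_sup_K01 hι (ht vT h ⟨z, hz⟩))
  have h2 : BG.cdR g (j z) (cdiff N N' j z (cBracket vT (BH.secField s) z - t.1 ⟨z, hz⟩))
      = cBracket vT' (BG.secField fun x => hj.jStar hι x (s x)) (BG.act (j z) g)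
        - (hj.jStar hι x t).1 ⟨BG.act (j z) g, hq⟩ := by
    refine (hj.cdiff_act_j g z _).symm.trans ((map_sub _ _ _).trans ?_)
    exact congrArg₂ (fun a b : ℂ ⊗[ℝ] N' => a - b) hb ht'
  exact h2 ▸ h1

end IsExtension

end AtiyahExtension

/-! ### Rules for the derivatives along `𝓕^{0,1}`. -/

section Derivatives

variable {E : Type*} [NormedAddCommGroup E] [NormedSpace ℝ E] [FiniteDimensional ℝ E]
  {X : Type*} [TopologicalSpace X] [ChartedSpace E X] [IsManifold 𝓘(ℝ, E) ∞ X]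
  {m : ℕ} {S : SasakianStructure E X m}
  {V : Type*} [NormedAddCommGroup V] [NormedSpace ℂ V]
  {H : Type*} [TopologicalSpace H] [ChartedSpace V H] [Group H]
  {N : Type*} [NormedAddCommGroup N] [NormedSpace ℝ N] [FiniteDimensional ℝ N]
  {P : Type*} [TopologicalSpace P] [ChartedSpace N P] [IsManifold 𝓘(ℝ, N) ∞ P]

theorem SasakianStructure.F10Bundle_isDerivAt_unique {U : Set X} {v : ∀ x : X, CTan E x}
    {s : ∀ x, S.F10 x} {x : X} {t t' : S.F10 x} (h : S.F10Bundle.IsDerivAt U v s x t)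
    (h' : S.F10Bundle.IsDerivAt U v s x t') : t = t' := by
  have h1 : (t : CTan E x) - t' ∈ S.calF01 x := by
    have h2 := sub_mem (show _ ∈ S.calF01 x from h') (show _ ∈ S.calF01 x from h)
    rwa [sub_sub_sub_cancel_left] at h2
  exact Subtype.ext (sub_eq_zero.1
    (Submodule.disjoint_def.1 (S.F10_disjoint_calF01 x) _ (sub_mem t.2 t'.2) h1))

theorem mem_submodule_of_eq {R M : Type*} [Semiring R] [AddCommMonoid M] [Module R M]
    {p : Submodule R M} {a b : M} (h : a = b) (hb : b ∈ p) : a ∈ p :=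
  h ▸ hb

namespace HolPrincipalBundle

variable {B : HolPrincipalBundle S V H N P}

variable (B) in
/-- The inclusion `ad ⊆ At`, on fibres. -/
def verticalInclusion (x : X) : B.quotFiber B.K10 x →ₗ[ℂ] B.quotFiber B.TT x :=
  Submodule.inclusion (B.quotFiber_mono (fun z => B.K10_le_TT z) x)

theorem verticalInclusion_injective (x : X) : Function.Injective (B.verticalInclusion x) :=
  Submodule.inclusion_injective _

theorem atProj_verticalInclusion {x : X} (u : B.quotFiber B.K10 x) :
    B.atProj x (B.verticalInclusion x u) = 0 := by
  obtain ⟨z, hz⟩ := B.exists_proj_eq x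
  exact Subtype.ext ((atProj_eq _ z hz).trans (B.cdp_of_mem_K10 (u.2.1 ⟨z, hz⟩)))

theorem exists_verticalInclusion_eq {x : X} {w : B.quotFiber B.TT x} (hw : B.atProj x w = 0) :
    ∃ u, B.verticalInclusion x u = w := by
  refine ⟨⟨w.1, fun z => B.mem_K10_of_mem_TT (w.2.1 z) ?_, w.2.2⟩, rfl⟩
  have h1 := atProj_eq w z.1 z.2
  rw [hw] at h1
  exact h1.symm

theorem isDerivAt_add {U : Set X} (hU : IsOpen U) {v : ∀ x : X, CTan E x}
    {s s' : ∀ x, B.quotFiber B.TT x} (hs : SmoothCVF (B.proj ⁻¹' U) (B.secField s))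
    (hs' : SmoothCVF (B.proj ⁻¹' U) (B.secField s')) {x : X} (hx : x ∈ U)
    {t t' : B.quotFiber B.TT x} (h : B.At.IsDerivAt U v s x t) (h' : B.At.IsDerivAt U v s' x t') :
    B.At.IsDerivAt U v (fun y => s y + s' y) x (t + t') := by
  intro vT hvT z
  have hz : B.proj z.1 ∈ U := by rw [z.2]; exact hx
  have ho : IsOpen (B.proj ⁻¹' U) := isOpen_preimage hU
  have hb := cBracket_add_right (A := vT) (hs.diffCVFAt ho hz) (hs'.diffCVFAt ho hz)
  have h1 := add_mem (h vT hvT z) (h' vT hvT z)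
  rw [sub_add_sub_comm] at h1
  exact mem_submodule_of_eq (congrArg (fun a : ℂ ⊗[ℝ] N => a - (show ℂ ⊗[ℝ] N from t.1 z + t'.1 z)) hb) h1

theorem isDerivAt_neg {U : Set X} (hU : IsOpen U) {v : ∀ x : X, CTan E x}
    {s : ∀ x, B.quotFiber B.TT x} (hs : SmoothCVF (B.proj ⁻¹' U) (B.secField s))
    {x : X} (hx : x ∈ U) {t : B.quotFiber B.TT x} (h : B.At.IsDerivAt U v s x t) :
    B.At.IsDerivAt U v (fun y => -s y) x (-t) := by
  intro vT hvT z
  have hz : B.proj z.1 ∈ U := by rw [z.2]; exact hx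
  have ho : IsOpen (B.proj ⁻¹' U) := isOpen_preimage hU
  have hb := cBracket_neg_right (A := vT) (hs.diffCVFAt ho hz)
  have h1 := neg_mem (h vT hvT z)
  rw [neg_sub'] at h1
  exact mem_submodule_of_eq (congrArg (fun a : ℂ ⊗[ℝ] N => a - (show ℂ ⊗[ℝ] N from -t.1 z)) hb) h1

theorem isDerivAt_sub {U : Set X} (hU : IsOpen U) {v : ∀ x : X, CTan E x}
    {s s' : ∀ x, B.quotFiber B.TT x} (hs : SmoothCVF (B.proj ⁻¹' U) (B.secField s))
    (hs' : SmoothCVF (B.proj ⁻¹' U) (B.secField s')) {x : X} (hx : x ∈ U)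
    {t t' : B.quotFiber B.TT x} (h : B.At.IsDerivAt U v s x t) (h' : B.At.IsDerivAt U v s' x t') :
    B.At.IsDerivAt U v (fun y => s y - s' y) x (t - t') := by
  have h1 := isDerivAt_add hU hs (s' := fun y => -s' y) hs'.neg hx h
    (isDerivAt_neg hU hs' hx h')
  simp only [← sub_eq_add_neg] at h1
  exact h1

/-- `d'p : At → F^{1,0}` intertwines the partial connections. -/
theorem atProj_isDerivAt {U : Set X} (hU : IsOpen U) {v : ∀ x : X, CTan E x} (hv : SmoothCVF U v)
    (hv' : ∀ x ∈ U, v x ∈ S.calF01 x) {s : ∀ x, B.quotFiber B.TT x}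
    (hs : SmoothCVF (B.proj ⁻¹' U) (B.secField s)) {x : X} (hx : x ∈ U)
    {t : B.quotFiber B.TT x} (h : B.At.IsDerivAt U v s x t) :
    S.F10Bundle.IsDerivAt U v (fun y => B.atProj y (s y)) x (B.atProj x t) := by
  obtain ⟨vT, hvT⟩ := exists_isLift (B := B) hv'
  obtain ⟨z, rfl⟩ := B.exists_proj_eq x
  have h1 := B.cdp_mem_calF01_of_mem_sup (h vT hvT ⟨z, rfl⟩)
  rw [map_sub] at h1
  -- The lift and the invariant section are `p`-related to `v` and to the projected section, so `dp`
  -- maps bracket to bracket.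
  have h2 := cdp_cBracket hU hv hvT hs (atProj_smooth hs) (fun z _ => cdp_secField s z) hx
  have h3 := atProj_eq t z rfl
  exact mem_submodule_of_eq (congrArg₂ (fun a b : ℂ ⊗[ℝ] E => a - b) h2.symm h3) h1

end HolPrincipalBundle

end Derivatives

/-! ### The homomorphism `α`, the natural connection and the splitting. -/

section NaturalConnection

variable {E : Type*} [NormedAddCommGroup E] [NormedSpace ℝ E] [FiniteDimensional ℝ E]
  {X : Type*} [TopologicalSpace X] [ChartedSpace E X] [IsManifold 𝓘(ℝ, E) ∞ X]
  {m : ℕ} {S : SasakianStructure E X m}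
  {V : Type*} [NormedAddCommGroup V] [NormedSpace ℂ V]
  {H : Type*} [TopologicalSpace H] [ChartedSpace V H] [Group H]
  {N : Type*} [NormedAddCommGroup N] [NormedSpace ℝ N] [FiniteDimensional ℝ N]
  {P : Type*} [TopologicalSpace P] [ChartedSpace N P] [IsManifold 𝓘(ℝ, N) ∞ P]
  {V' : Type*} [NormedAddCommGroup V'] [NormedSpace ℂ V']
  {G : Type*} [TopologicalSpace G] [ChartedSpace V' G] [Group G] [LieGroup 𝓘(ℂ, V') ∞ G]
  {N' : Type*} [NormedAddCommGroup N'] [NormedSpace ℝ N'] [FiniteDimensional ℝ N']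
  {Q : Type*} [TopologicalSpace Q] [ChartedSpace N' Q] [IsManifold 𝓘(ℝ, N') ∞ Q]

open HolPrincipalBundle

variable {ι : H →* G} {BH : HolPrincipalBundle S V H N P}
  {BG : HolPrincipalBundle S V' G N' Q} {j : P → Q}

namespace IsExtension

theorem atProj_jStar (hj : IsExtension ι BH BG j) (hι : IsComplexLieSubgroup (V := V) (V' := V') ι)
    {x : X} (w : BH.quotFiber BH.TT x) : BG.atProj x (hj.jStar hι x w) = BH.atProj x w := by
  obtain ⟨z, hz⟩ := BH.exists_proj_eq x
  refine Subtype.ext ((atProj_eq _ (j z) ((hj.proj_eq z).trans hz)).trans ?_)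
  refine (congrArg (BG.cdp (j z)) (hj.jStar_val hι w z hz)).trans ?_
  exact (hj.cdp_cdj z _).trans (atProj_eq w z hz).symm

/-- Elements of a fibre of `At(E_G)` are determined at a single point `j(z)`, so the pointwise
relation along `j(P)` becomes an equation between linear maps. -/
theorem adExtEq_iff (hj : IsExtension ι BH BG j) (hι : IsComplexLieSubgroup (V := V) (V' := V') ι)
    {x : X} (u : BH.quotFiber BH.K10 x) (v : BG.quotFiber BG.K10 x) :
    AdExtEq hj u v ↔ BG.verticalInclusion x v = hj.jStar hι x (BH.verticalInclusion x u) := by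
  constructor
  · intro h
    obtain ⟨z, hz⟩ := BH.exists_proj_eq x
    exact quotFiber_ext (j z) ((hj.proj_eq z).trans hz)
      ((h z hz).trans (hj.jStar_val hι (BH.verticalInclusion x u) z hz).symm)
  · intro h z hz
    have h1 : ∀ a b : BG.quotFiber BG.TT x, a = b →
        a.1 ⟨j z, (hj.proj_eq z).trans hz⟩ = b.1 ⟨j z, (hj.proj_eq z).trans hz⟩ := by
      rintro a _ rfl
      rfl
    exact (h1 _ _ h).trans (hj.jStar_val hι (BH.verticalInclusion x u) z hz)

/-- The sum `(v, w) ↦ v + j_*(w)`, on fibres. -/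
def atSum (hj : IsExtension ι BH BG j) (hι : IsComplexLieSubgroup (V := V) (V' := V') ι) (x : X) :
    BG.quotFiber BG.K10 x × BH.quotFiber BH.TT x →ₗ[ℂ] BG.quotFiber BG.TT x :=
  (BG.verticalInclusion x).coprod (hj.jStar hι x)

theorem atSum_apply (hj : IsExtension ι BH BG j)
    (hι : IsComplexLieSubgroup (V := V) (V' := V') ι) (x : X)
    (v : BG.quotFiber BG.K10 x) (w : BH.quotFiber BH.TT x) :
    hj.atSum hι x (v, w) = BG.verticalInclusion x v + hj.jStar hι x w :=
  rfl

/-- Subtracting `j_*` of a horizontal lift of its projection makes any `a` vertical. -/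
theorem atSum_surjective (hj : IsExtension ι BH BG j)
    (hι : IsComplexLieSubgroup (V := V) (V' := V') ι) (x : X) :
    Function.Surjective (hj.atSum hι x) := by
  intro a
  have h : BG.atProj x (a - hj.jStar hι x (BH.horLift x (BG.atProj x a))) = 0 := by
    rw [map_sub, hj.atProj_jStar hι, atProj_horLift, sub_self]
  obtain ⟨v, hv⟩ := exists_verticalInclusion_eq h
  exact ⟨(v, BH.horLift x (BG.atProj x a)), by rw [atSum_apply, hv, sub_add_cancel]⟩

/-- Projecting `v + j_* w = 0` to `F^{1,0}` shows that `w` is vertical; the witness `u` is minus the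
corresponding element of `ad(E_H)`. -/
theorem atSum_eq_zero_iff (hj : IsExtension ι BH BG j)
    (hι : IsComplexLieSubgroup (V := V) (V' := V') ι) (x : X)
    (v : BG.quotFiber BG.K10 x) (w : BH.quotFiber BH.TT x) :
    hj.atSum hι x (v, w) = 0 ↔
      ∃ u : BH.quotFiber BH.K10 x, AdExtEq hj u v ∧ w = -BH.verticalInclusion x u := by
  rw [atSum_apply]
  constructor
  · intro h
    have h1 := congrArg (BG.atProj x) h
    rw [map_add, atProj_verticalInclusion, zero_add, hj.atProj_jStar hι, map_zero] at h1
    obtain ⟨u, hu⟩ := exists_verticalInclusion_eq h1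
    refine ⟨-u, (hj.adExtEq_iff hι _ _).2 ?_, by rw [map_neg, neg_neg, hu]⟩
    rw [map_neg, hu, map_neg]
    exact eq_neg_of_add_eq_zero_left h
  · rintro ⟨u, hu, rfl⟩
    rw [(hj.adExtEq_iff hι u v).1 hu, map_neg, add_neg_cancel]

/-- The homomorphism `α : ad(E_G) ⊕ At(E_H) → At(E_G)`. -/
def atSumHom (hj : IsExtension ι BH BG j) (hι : IsComplexLieSubgroup (V := V) (V' := V') ι) :
    HolHom S (BG.ad.prod BH.At) BG.At where
  toFun := hj.atSum hι
  smooth _ hU s hs := SmoothCVF.add hs.1 (hj.jStar_smooth hι hU (s := fun y => (s y).2) hs.2)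
  intertwines _ hU s hs _ hv hv' _ hx t ht :=
    isDerivAt_add hU (s := fun y => BG.verticalInclusion y (s y).1) hs.1
      (hj.jStar_smooth hι hU (s := fun y => (s y).2) hs.2) hx (t := BG.verticalInclusion _ t.1) ht.1
      (hj.jStar_isDerivAt hι hU (s := fun y => (s y).2) hs.2 hv hv' hx ht.2)

end IsExtension

namespace BranchedCartanGeometry

variable {hj : IsExtension ι BH BG j}

/-- The homomorphism `φ`, as a map of fibres with values in `At(E_G)`. -/
def phiAt (C : BranchedCartanGeometry hj) (x : X) :
    BH.quotFiber BH.TT x →ₗ[ℂ] BG.quotFiber BG.TT x :=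
  BG.verticalInclusion x ∘ₗ (C.phi.toFun x : BH.quotFiber BH.TT x →ₗ[ℂ] BG.quotFiber BG.K10 x)

theorem atProj_phiAt (C : BranchedCartanGeometry hj) {x : X} (w : BH.quotFiber BH.TT x) :
    BG.atProj x (C.phiAt x w) = 0 :=
  atProj_verticalInclusion _

theorem phiAt_smooth (C : BranchedCartanGeometry hj) {U : Set X} (hU : IsOpen U)
    {s : ∀ x, BH.quotFiber BH.TT x} (hs : SmoothCVF (BH.proj ⁻¹' U) (BH.secField s)) :
    SmoothCVF (BG.proj ⁻¹' U) (BG.secField fun x => C.phiAt x (s x)) :=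
  C.phi.smooth U hU s hs

theorem phiAt_isDerivAt (C : BranchedCartanGeometry hj) {U : Set X} (hU : IsOpen U)
    {s : ∀ x, BH.quotFiber BH.TT x} (hs : SmoothCVF (BH.proj ⁻¹' U) (BH.secField s))
    {v : ∀ x : X, CTan E x} (hv : SmoothCVF U v) (hv' : ∀ x ∈ U, v x ∈ S.calF01 x) {x : X}
    (hx : x ∈ U) {t : BH.quotFiber BH.TT x} (ht : BH.At.IsDerivAt U v s x t) :
    BG.At.IsDerivAt U v (fun x => C.phiAt x (s x)) x (C.phiAt x t) :=
  C.phi.intertwines _ hU s hs _ hv hv' _ hx t ht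

variable (hι : IsComplexLieSubgroup (V := V) (V' := V') ι)

/-- The difference `j_* - φ`, which vanishes on `ad(E_H)`. -/
def jStarSubPhi (C : BranchedCartanGeometry hj) (x : X) :
    BH.quotFiber BH.TT x →ₗ[ℂ] BG.quotFiber BG.TT x :=
  hj.jStar hι x - C.phiAt x

theorem atProj_jStarSubPhi (C : BranchedCartanGeometry hj) {x : X} (w : BH.quotFiber BH.TT x) :
    BG.atProj x (C.jStarSubPhi hι x w) = BH.atProj x w := by
  rw [jStarSubPhi, LinearMap.sub_apply, map_sub, C.atProj_phiAt, sub_zero, hj.atProj_jStar hι]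

/-- The difference `w - w'` comes from `ad(E_H)`, where `φ ∘ ι₂ = ι₁` makes `φ` and `j_*` agree. -/
theorem jStarSubPhi_eq_of_atProj_eq (C : BranchedCartanGeometry hj) {x : X}
    {w w' : BH.quotFiber BH.TT x} (h : BH.atProj x w = BH.atProj x w') :
    C.jStarSubPhi hι x w = C.jStarSubPhi hι x w' := by
  have h1 : BH.atProj x (w - w') = 0 := by rw [map_sub, h, sub_self]
  obtain ⟨u, hu⟩ := exists_verticalInclusion_eq h1
  have h2 : C.phiAt x (BH.verticalInclusion x u) = hj.jStar hι x (BH.verticalInclusion x u) :=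
    (hj.adExtEq_iff hι u _).1 (C.compat x u)
  rw [← sub_eq_zero, ← map_sub, ← hu, jStarSubPhi, LinearMap.sub_apply, h2, sub_self]

theorem jStarSubPhi_smooth (C : BranchedCartanGeometry hj) {U : Set X} (hU : IsOpen U)
    {s : ∀ x, BH.quotFiber BH.TT x} (hs : SmoothCVF (BH.proj ⁻¹' U) (BH.secField s)) :
    SmoothCVF (BG.proj ⁻¹' U) (BG.secField fun x => C.jStarSubPhi hι x (s x)) :=
  SmoothCVF.sub (hj.jStar_smooth hι hU hs) (C.phiAt_smooth hU hs)

theorem jStarSubPhi_isDerivAt (C : BranchedCartanGeometry hj) {U : Set X} (hU : IsOpen U)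
    {s : ∀ x, BH.quotFiber BH.TT x} (hs : SmoothCVF (BH.proj ⁻¹' U) (BH.secField s))
    {v : ∀ x : X, CTan E x} (hv : SmoothCVF U v) (hv' : ∀ x ∈ U, v x ∈ S.calF01 x) {x : X}
    (hx : x ∈ U) {t : BH.quotFiber BH.TT x} (ht : BH.At.IsDerivAt U v s x t) :
    BG.At.IsDerivAt U v (fun x => C.jStarSubPhi hι x (s x)) x (C.jStarSubPhi hι x t) :=
  isDerivAt_sub hU (hj.jStar_smooth hι hU hs) (C.phiAt_smooth hU hs) hx
    (hj.jStar_isDerivAt hι hU hs hv hv' hx ht) (C.phiAt_isDerivAt hU hs hv hv' hx ht)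

/-- The natural connection `F^{1,0} → At(E_G)`, on fibres. -/
def connection (C : BranchedCartanGeometry hj) (x : X) : S.F10 x →ₗ[ℂ] BG.quotFiber BG.TT x :=
  C.jStarSubPhi hι x ∘ₗ BH.horLift x

/-- This identity `D ∘ d'p = j_* - φ` shows that the connection does not depend on the horizontal
splitting used to define it. -/
theorem connection_atProj (C : BranchedCartanGeometry hj) {x : X} (w : BH.quotFiber BH.TT x) :
    C.connection hι x (BH.atProj x w) = hj.jStar hι x w - C.phiAt x w :=
  C.jStarSubPhi_eq_of_atProj_eq hι (atProj_horLift x _)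

theorem atProj_connection (C : BranchedCartanGeometry hj) {x : X} (f : S.F10 x) :
    BG.atProj x (C.connection hι x f) = f :=
  (C.atProj_jStarSubPhi hι _).trans (atProj_horLift x f)

theorem connection_smooth (C : BranchedCartanGeometry hj) {U : Set X} (hU : IsOpen U)
    {f : ∀ x, S.F10 x} (hf : SmoothCVF U (fun x => (f x : CTan E x))) :
    SmoothCVF (BG.proj ⁻¹' U) (BG.secField fun x => C.connection hι x (f x)) :=
  C.jStarSubPhi_smooth hι hU (horLift_smooth hU hf)

theorem connection_isDerivAt (C : BranchedCartanGeometry hj) {U : Set X} (hU : IsOpen U)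
    {f : ∀ x, S.F10 x} (hf : SmoothCVF U (fun x => (f x : CTan E x)))
    {v : ∀ x : X, CTan E x} (hv : SmoothCVF U v) (hv' : ∀ x ∈ U, v x ∈ S.calF01 x) {x : X}
    (hx : x ∈ U) {t : S.F10 x} (ht : S.F10Bundle.IsDerivAt U v f x t) :
    BG.At.IsDerivAt U v (fun x => C.connection hι x (f x)) x (C.connection hι x t) := by
  have hs := horLift_smooth (B := BH) hU hf
  -- `w` is the derivative of the horizontally lifted section; it need not be the lift of `t`. Its
  -- projection is `t`, which is all that `j_* - φ` sees.
  obtain ⟨w, hw⟩ := exists_isDerivAt_At hU hs hv hv' hx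
  have h1 := atProj_isDerivAt hU hv hv' hs hx hw
  simp only [atProj_horLift] at h1
  have h2 : BH.atProj x w = t := SasakianStructure.F10Bundle_isDerivAt_unique h1 ht
  have h3 : C.connection hι x t = C.jStarSubPhi hι x w := h2 ▸ C.connection_atProj hι w
  rw [h3]
  exact C.jStarSubPhi_isDerivAt hι hU hs hv hv' hx hw

/-- The natural connection, as a holomorphic homomorphism. -/
def connectionHom (C : BranchedCartanGeometry hj) : HolHom S S.F10Bundle BG.At where
  toFun := C.connection hι
  smooth _ hU _ hs := C.connection_smooth hι hU hs
  intertwines _ hU _ hs _ hv hv' _ hx _ ht := C.connection_isDerivAt hι hU hs hv hv' hx ht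

/-- The splitting `β = Id - D ∘ d'p` of the Atiyah sequence, with values in `At(E_G)`. -/
def splittingAt (C : BranchedCartanGeometry hj) (x : X) :
    BG.quotFiber BG.TT x →ₗ[ℂ] BG.quotFiber BG.TT x :=
  LinearMap.id - C.connection hι x ∘ₗ BG.atProj x

theorem atProj_splittingAt (C : BranchedCartanGeometry hj) {x : X} (a : BG.quotFiber BG.TT x) :
    BG.atProj x (C.splittingAt hι x a) = 0 := by
  rw [splittingAt, LinearMap.sub_apply, map_sub, LinearMap.comp_apply, C.atProj_connection hι,
    LinearMap.id_apply, sub_self]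

/-- The splitting `β : At(E_G) → ad(E_G)`, on fibres. -/
def splitting (C : BranchedCartanGeometry hj) (x : X) :
    BG.quotFiber BG.TT x →ₗ[ℂ] BG.quotFiber BG.K10 x :=
  ((BG.quotFiber BG.TT x).subtype ∘ₗ C.splittingAt hι x).codRestrict (BG.quotFiber BG.K10 x)
    fun a => by
      obtain ⟨u, hu⟩ := exists_verticalInclusion_eq (C.atProj_splittingAt hι a)
      exact mem_submodule_of_eq (congrArg Subtype.val hu.symm) u.2

theorem verticalInclusion_splitting (C : BranchedCartanGeometry hj) {x : X}
    (a : BG.quotFiber BG.TT x) : BG.verticalInclusion x (C.splitting hι x a)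
      = a - C.connection hι x (BG.atProj x a) :=
  rfl

theorem splitting_atSum (C : BranchedCartanGeometry hj) {x : X} (v : BG.quotFiber BG.K10 x)
    (w : BH.quotFiber BH.TT x) :
    C.splitting hι x (hj.atSum hι x (v, w))
      = v + (show BG.quotFiber BG.K10 x from C.phi.toFun x w) := by
  apply verticalInclusion_injective x
  have h1 : BG.verticalInclusion x (v + (show BG.quotFiber BG.K10 x from C.phi.toFun x w))
      = BG.verticalInclusion x v + C.phiAt x w := map_add _ _ _
  rw [h1, C.verticalInclusion_splitting hι, hj.atSum_apply hι, map_add, atProj_verticalInclusion,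
    zero_add, hj.atProj_jStar hι, C.connection_atProj hι]
  abel

theorem splitting_verticalInclusion (C : BranchedCartanGeometry hj) {x : X}
    (v : BG.quotFiber BG.K10 x) : C.splitting hι x (BG.verticalInclusion x v) = v := by
  apply verticalInclusion_injective x
  rw [C.verticalInclusion_splitting hι, atProj_verticalInclusion, map_zero, sub_zero]

theorem splittingAt_smooth (C : BranchedCartanGeometry hj) {U : Set X} (hU : IsOpen U)
    {s : ∀ x, BG.quotFiber BG.TT x} (hs : SmoothCVF (BG.proj ⁻¹' U) (BG.secField s)) :
    SmoothCVF (BG.proj ⁻¹' U) (BG.secField fun x => C.splittingAt hι x (s x)) :=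
  SmoothCVF.sub hs
    (C.connection_smooth hι hU (f := fun x => BG.atProj x (s x)) (atProj_smooth hs))

theorem splittingAt_isDerivAt (C : BranchedCartanGeometry hj) {U : Set X} (hU : IsOpen U)
    {s : ∀ x, BG.quotFiber BG.TT x} (hs : SmoothCVF (BG.proj ⁻¹' U) (BG.secField s))
    {v : ∀ x : X, CTan E x} (hv : SmoothCVF U v) (hv' : ∀ x ∈ U, v x ∈ S.calF01 x) {x : X}
    (hx : x ∈ U) {t : BG.quotFiber BG.TT x} (ht : BG.At.IsDerivAt U v s x t) :
    BG.At.IsDerivAt U v (fun x => C.splittingAt hι x (s x)) x (C.splittingAt hι x t) :=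
  isDerivAt_sub hU hs
    (C.connection_smooth hι hU (f := fun x => BG.atProj x (s x)) (atProj_smooth hs)) hx ht
    (C.connection_isDerivAt hι hU (f := fun x => BG.atProj x (s x)) (atProj_smooth hs) hv hv' hx
      (atProj_isDerivAt hU hv hv' hs hx ht))

/-- The splitting of the Atiyah sequence, as a holomorphic homomorphism. -/
def splittingHom (C : BranchedCartanGeometry hj) : HolHom S BG.At BG.ad where
  toFun := C.splitting hι
  smooth _ hU s hs := C.splittingAt_smooth hι hU (s := s) hs
  -- `ad` and `At` use the same invariant fields and the same bracket condition, so the result for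
  -- `splittingAt` applies verbatim.
  intertwines _ hU s hs _ hv hv' _ hx t ht :=
    C.splittingAt_isDerivAt hι hU (s := s) hs hv hv' hx (t := t) ht

end BranchedCartanGeometry

theorem HolHom.ext_toFun {W₁ W₂ : PartialBundle E X} {f f' : HolHom S W₁ W₂}
    (h : ∀ x w, f.toFun x w = f'.toFun x w) : f = f' := by
  have h1 : f.toFun = f'.toFun := funext fun x => LinearMap.ext (h x)
  cases f
  cases f'
  cases h1
  rfl

theorem HolPrincipalBundle.atProjEq_iff {B : HolPrincipalBundle S V H N P} (z : P)
    (w : B.quotFiber B.TT (B.proj z)) (f : S.F10 (B.proj z)) :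
    B.AtProjEq z w f ↔ B.atProj _ w = f := by
  refine Iff.trans ?_ Subtype.ext_iff.symm
  rw [atProj_eq w z rfl]
  exact Iff.rfl

theorem HolPrincipalBundle.isHolConnection_iff {B : HolPrincipalBundle S V H N P}
    (D : HolHom S S.F10Bundle B.At) :
    B.IsHolConnection D ↔ ∀ x (f : S.F10 x), B.atProj x (D.toFun x f) = f := by
  refine ⟨fun h x f => ?_, fun h z f => (atProjEq_iff z _ _).2 (h _ f)⟩
  obtain ⟨z, rfl⟩ := B.exists_proj_eq x
  exact (atProjEq_iff z _ _).1 (h z f)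

end NaturalConnection

end BranchedCartan

end

open BranchedCartan in
/-- The extension `BG` of a branched holomorphic Cartan geometry has a natural holomorphic
connection `D`. The map `α` identifies `At(BG)` with `(ad(BG) ⊕ At(BH)) / ad(BH)`, the map
`(v, w) ↦ v + φ(w)` descends to a splitting `β` of the Atiyah sequence of `BG`, and `D` is the
holomorphic connection with `a = β(a) + D(d'p'(a))` for every `a` in `At(BG)`. -/
theorem proposition4
    {E : Type*} [NormedAddCommGroup E] [NormedSpace ℝ E] [FiniteDimensional ℝ E]
    {X : Type*} [TopologicalSpace X] [ChartedSpace E X] [IsManifold 𝓘(ℝ, E) ∞ X]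
    [T2Space X] [SecondCountableTopology X] [ConnectedSpace X]
    {m : ℕ} (S : SasakianStructure E X m)
    {VH : Type*} [NormedAddCommGroup VH] [NormedSpace ℂ VH] [FiniteDimensional ℂ VH]
    {H : Type*} [TopologicalSpace H] [ChartedSpace VH H] [Group H] [LieGroup 𝓘(ℂ, VH) ∞ H]
    {VG : Type*} [NormedAddCommGroup VG] [NormedSpace ℂ VG] [FiniteDimensional ℂ VG]
    {G : Type*} [TopologicalSpace G] [ChartedSpace VG G] [Group G] [LieGroup 𝓘(ℂ, VG) ∞ G]
    [ConnectedSpace G]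
    (ι : H →* G) (hι : IsComplexLieSubgroup (V := VH) (V' := VG) ι)
    {N : Type*} [NormedAddCommGroup N] [NormedSpace ℝ N] [FiniteDimensional ℝ N]
    {P : Type*} [TopologicalSpace P] [ChartedSpace N P] [IsManifold 𝓘(ℝ, N) ∞ P]
    (BH : HolPrincipalBundle S VH H N P)
    {N' : Type*} [NormedAddCommGroup N'] [NormedSpace ℝ N'] [FiniteDimensional ℝ N']
    {Q : Type*} [TopologicalSpace Q] [ChartedSpace N' Q] [IsManifold 𝓘(ℝ, N') ∞ Q]
    (BG : HolPrincipalBundle S VG G N' Q)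
    (j : P → Q) (hj : IsExtension ι BH BG j)
    (C : BranchedCartanGeometry hj) :
    ∃! α : HolHom S (BG.ad.prod BH.At) BG.At,
      IsAtSum hj α ∧
      (∀ x, Function.Surjective (α.toFun x)) ∧
      (∀ (x : X) (v : BG.ad.Fiber x) (w : BH.At.Fiber x),
        α.toFun x (v, w) = 0 ↔ ∃ u : BH.ad.Fiber x, AdExtEq hj u v ∧ w = -BH.adToAt x u) ∧
      ∃! β : HolHom S BG.At BG.ad,
        (∀ (x : X) (v : BG.ad.Fiber x) (w : BH.At.Fiber x),
          β.toFun x (α.toFun x (v, w)) = v + C.phi.toFun x w) ∧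
        (∀ (x : X) (v : BG.ad.Fiber x), β.toFun x (BG.adToAt x v) = v) ∧
        ∃! D : HolHom S S.F10Bundle BG.At,
          BG.IsHolConnection D ∧
          ∀ (e : Q) (a : BG.At.Fiber (BG.proj e)) (f : S.F10Bundle.Fiber (BG.proj e)),
            BG.AtProjEq e a f →
              a = BG.adToAt _ (β.toFun _ a) + D.toFun _ f := by
  refine ⟨hj.atSumHom hι, ⟨?_, hj.atSum_surjective hι, hj.atSum_eq_zero_iff hι,
    C.splittingHom hι, ⟨fun x => C.splitting_atSum hι, fun x => C.splitting_verticalInclusion hι,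
      C.connectionHom hι, ⟨?_, ?_⟩, ?_⟩, ?_⟩, ?_⟩
  · intro x v w z hz
    exact congrArg (BG.adVal v (j z) _ + ·) (hj.jStar_val hι w z hz)
  · exact (BG.isHolConnection_iff _).2 fun x f => C.atProj_connection hι f
  · intro e a f h
    have h1 : BG.atProj _ a = f := (BG.atProjEq_iff e a f).1 h
    have h2 := C.verticalInclusion_splitting hι a
    rw [h1] at h2
    exact (sub_eq_iff_eq_add.1 h2.symm)
  -- Evaluate the decomposition at the element `a` given by the natural connection on `f`. Its
  -- vertical part `β(a)` vanishes and its projection is `f`, so `D(f) = a`.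
  · rintro D ⟨-, hD⟩
    refine HolHom.ext_toFun fun x f => ?_
    obtain ⟨e, rfl⟩ := BG.exists_proj_eq x
    have h1 : BG.atProj _ (C.connection hι _ f) = f := C.atProj_connection hι f
    have h2 := hD e _ f ((BG.atProjEq_iff e _ f).2 h1)
    have h3 := C.verticalInclusion_splitting hι (C.connection hι _ f)
    rw [h1, sub_self] at h3
    refine Eq.trans ?_ h2.symm
    exact (zero_add (D.toFun _ f)).symm.trans (congrArg (· + D.toFun _ f) h3.symm)
  -- Every element of `At(E_G)` has the form `α(v, w)`, where the value of `β` is prescribed.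
  · rintro β ⟨hβ, -⟩
    refine HolHom.ext_toFun fun x a => ?_
    obtain ⟨⟨v, w⟩, rfl⟩ := hj.atSum_surjective hι x a
    exact (hβ x v w).trans (C.splitting_atSum hι v w).symm
  -- The formula prescribes `α(v, w)` only along `j(P)`, but one point of each fibre determines an
  -- invariant element.
  · rintro α ⟨hα, -⟩
    refine HolHom.ext_toFun fun x vw => ?_
    obtain ⟨z, hz⟩ := BH.exists_proj_eq x
    refine HolPrincipalBundle.quotFiber_ext (j z) ((hj.proj_eq z).trans hz) ?_
    refine (hα x vw.1 vw.2 z hz).trans ?_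
    exact congrArg (BG.adVal vw.1 (j z) _ + ·) (hj.jStar_val hι vw.2 z hz).symm
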